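/- Let $0<\alpha\le 2$ and $1/\alpha<\gamma_2\le\gamma_1<1$. Let $\xi_{\mathbf i}$, $\mathbf i\in\mathbb Z^2$, be i.i.d. random variables with characteristic function $\exp(-|t|^\alpha)$, and consider the linear random field $$X_{k_1,k_2}=\sum_{i,j\ge 0}c_{i,j}\,\xi_{k_1-i,k_2-j},\qquad c_{i,j}=(1+i)^{-\gamma_1}\mathbf 1_{\{i\ge1,\ j=0\}}+(1+j)^{-\gamma_2}\mathbf 1_{\{i=j\ge1\}},$$ where the series is understood as the limit in probability of its finite partial sums (this limit exists). For real $n_1,n_2\ge0$ and $t_1,t_2\ge 0$ put $$S_{n_1,n_2}(t_1,t_2)=\sum_{k_1=0}^{\lfloor n_1t_1\rfloor}\sum_{k_2=0}^{\lfloor n_2t_2\rfloor}X_{k_1,k_2}.$$ Let $\tau_0=(1-\gamma_1)/(1-\gamma_2)$ and, for $\tau>0$, $$A_n(\tau)=\begin{cases} n^{(1+\tau)/\alpha+1-\gamma_1},&0<\tau<\tau_0,\\ n^{(1+\tau)/\alpha+\tau(1-\gamma_2)},&\tau_0\le\tau\le1,\\ n^{(1+\tau)/\alpha+1-\gamma_2},&\tau>1.\end{cases}$$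 Let $M$ be a symmetric $\alpha$-stable random measure on $\mathbb R^2$ with Lebesgue control measure, that is, $M$ is independently scattered, almost surely countably additive, and $M(B)$ has characteristic function $\exp(-|B|\,|t|^\alpha)$ for every Borel set $B$ of finite Lebesgue measure $|B|$. For $f\in L^\alpha(\mathbb R^2)$ the stable integral $\int f\,dM$ is the limit in probability of the integrals of simple functions converging to $f$ in $L^\alpha$. With $x_+=\max(0,x)$ let $$H_\gamma(u,t)=\frac{(t-u)_+^{1-\gamma}-(-u)_+^{1-\gamma}}{1-\gamma},\quad a(u_1,u_2)=\max(0,-u_1,-u_2),\quad b(u_1,u_2;t_1,t_2)=\min(t_1-u_1,t_2-u_2),$$ and let $V_1(\tau,t_1,t_2)$ be the stable integral $$V_1(\tau,t_1,t_2)=\begin{cases} \int_{\mathbb R^2} H_{\gamma_1}(u_1,t_1)\mathbf 1_{\{0\le u_2\le t_2\}}\,M(du_1\,du_2),&0<\tau<\tau_0,\\[2pt] \int_{\mathbb R^2}\bigl(\mathbf 1_{\{0\le u_2\le t_2\}}H_{\gamma_1}(u_1,t_1)+\mathbf 1_{\{0\le u_1\le t_1\}}H_{\gamma_2}(u_2,t_2)\bigr)M(du_1\,du_2),&\tau=\tau_0,\\[2pt]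 \int_{\mathbb R^2}\mathbf 1_{\{0\le u_1\le t_1\}}H_{\gamma_2}(u_2,t_2)\,M(du_1\,du_2),&\tau_0<\tau<1,\\[2pt] \int_{\mathbb R^2}\mathbf 1_{\{a<b\}}\dfrac{b^{1-\gamma_2}-a^{1-\gamma_2}}{1-\gamma_2}\,M(du_1\,du_2),&\tau=1>\tau_0,\\[2pt] \int_{\mathbb R^2}H_{\gamma_2}(u_1,t_1)\mathbf 1_{\{0\le u_2\le t_2\}}\,M(du_1\,du_2),&\tau>1, \end{cases}$$ where $a=a(u_1,u_2)$ and $b=b(u_1,u_2;t_1,t_2)$. These integrals exist. Then, as $n\to\infty$, in the sense of convergence of all finite-dimensional distributions over $(t_1,t_2)\in[0,\infty)^2$, $$A_n(\tau)^{-1}S_{n,n^\tau}(t_1,t_2)\longrightarrow V_1(\tau,t_1,t_2)$$ for every $\tau\in(0,\tau_0)$ and, if $\gamma_2<\gamma_1$, for every $\tau>0$. Moreover, if $\gamma_2<\gamma_1$, then $\tau_0<1$ and the points of scaling transition are exactly $\tau_0$ and $1$. Here $\tau_*>0$ is called a point of scaling transition if, for every $\tau>0$, $A_n(\tau)\to\infty$,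 the convergence above holds and $V_1(\tau,\cdot)$ is not identically zero almost surely, and if there is $0<\delta\le\tau_*$ such that the finite-dimensional distributions of $V_1(\tau,\cdot)$ do not depend on $\tau\in(\tau_*-\delta,\tau_*)$, do not depend on $\tau\in(\tau_*,\tau_*+\delta)$, and, for $\tau\in(\tau_*-\delta,\tau_*)$, $\tau'\in(\tau_*,\tau_*+\delta)$ and $c\in\mathbb R$, the fields $V_1(\tau',\cdot)$ and $c\,V_1(\tau,\cdot)$ never have the same finite-dimensional distributions. -/

import Mathlib

open MeasureTheory ProbabilityTheory Filter Topology
open scoped ENNReal NNReal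

namespace DiagonalField

noncomputable section

/-! ### Linear random fields on `ℤ²` and their partial sums -/

/-- The random variables `ξ i`, `i ∈ ℤ²`, are i.i.d. with the standard symmetric `α`-stable law,
i.e. with characteristic function `exp (-|t|^α)`. -/
structure IsStableNoise {Ω : Type*} [MeasurableSpace Ω] (P : Measure Ω) (α : ℝ)
    (ξ : ℤ × ℤ → Ω → ℝ) : Prop where
  measurable : ∀ i, Measurable (ξ i)
  indep : iIndepFun ξ P
  charFun_eq : ∀ i t, charFun (P.map (ξ i)) t = ((Real.exp (-(|t| ^ α)) : ℝ) : ℂ)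

/-- `X` is the linear random field `X k = ∑_{i ∈ ℤ₊²} c i ξ (k - i)`, `k ∈ ℤ²`. The (generally not
absolutely convergent) series is the limit in probability of its finite partial sums. -/
structure IsLinearField {Ω : Type*} [MeasurableSpace Ω] (P : Measure Ω)
    (c : ℕ × ℕ → ℝ) (ξ : ℤ × ℤ → Ω → ℝ) (X : ℤ × ℤ → Ω → ℝ) : Prop where
  aemeasurable : ∀ k, AEMeasurable (X k) P
  tendsto : ∀ k : ℤ × ℤ, TendstoInMeasure P
    (fun (s : Finset (ℕ × ℕ)) ω => ∑ i ∈ s, c i * ξ (k.1 - (i.1 : ℤ), k.2 - (i.2 : ℤ)) ω)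
    atTop (X k)

/-- The filter supported by the horizontal axis (exponent `γ₁`) and by the diagonal
(exponent `γ₂`). -/
def diagFilter (γ₁ γ₂ : ℝ) (i : ℕ × ℕ) : ℝ :=
  (if 1 ≤ i.1 ∧ i.2 = 0 then (1 + (i.1 : ℝ)) ^ (-γ₁) else 0) +
    (if i.1 = i.2 ∧ 1 ≤ i.2 then (1 + (i.2 : ℝ)) ^ (-γ₂) else 0)

/-- `S_{n₁,n₂}(t₁,t₂)`, the sum of `X (k₁, k₂)` over `0 ≤ k₁ ≤ ⌊n₁ t₁⌋`, `0 ≤ k₂ ≤ ⌊n₂ t₂⌋`,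
for real `n₁, n₂ ≥ 0`. -/
def partialSum {Ω : Type*} (X : ℤ × ℤ → Ω → ℝ) (n₁ n₂ : ℝ) (t : ℝ≥0 × ℝ≥0) (ω : Ω) : ℝ :=
  ∑ k₁ ∈ Finset.range (⌊n₁ * (t.1 : ℝ)⌋₊ + 1), ∑ k₂ ∈ Finset.range (⌊n₂ * (t.2 : ℝ)⌋₊ + 1),
    X ((k₁ : ℤ), (k₂ : ℤ)) ω

/-! ### Stable random measures and stable integrals on `ℝ²` -/

/-- `M` is a symmetric `α`-stable random measure on `ℝ²` with Lebesgue control measure. It is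
defined on the Borel sets of finite Lebesgue measure (its values at other sets are irrelevant). -/
structure IsStableRandomMeasure {Ω : Type*} [MeasurableSpace Ω] (P : Measure Ω) (α : ℝ)
    (M : Set (ℝ × ℝ) → Ω → ℝ) : Prop where
  aemeasurable : ∀ B, MeasurableSet B → volume B < ∞ → AEMeasurable (M B) P
  charFun_eq : ∀ B, MeasurableSet B → volume B < ∞ → ∀ t : ℝ,
    charFun (P.map (M B)) t = ((Real.exp (-((volume B).toReal * |t| ^ α)) : ℝ) : ℂ)
  /-- independently scattered -/
  indep : ∀ (m : ℕ) (B : Fin m → Set (ℝ × ℝ)), (∀ i, MeasurableSet (B i)) →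
    (∀ i, volume (B i) < ∞) → Pairwise (fun i j => Disjoint (B i) (B j)) →
    iIndepFun (fun i => M (B i)) P
  /-- almost surely countably additive -/
  sigma_additive : ∀ B : ℕ → Set (ℝ × ℝ), (∀ i, MeasurableSet (B i)) →
    volume (⋃ i, B i) < ∞ → Pairwise (fun i j => Disjoint (B i) (B j)) →
    ∀ᵐ ω ∂P, Tendsto (fun N : ℕ => ∑ i ∈ Finset.range N, M (B i) ω) atTop (𝓝 (M (⋃ i, B i) ω))

/-- The integral `∑_{c ≠ 0} c M({s = c})` of a simple function `s`. -/
def simpleIntegral {Ω : Type*} (M : Set (ℝ × ℝ) → Ω → ℝ) (s : SimpleFunc (ℝ × ℝ) ℝ) (ω : Ω) : ℝ :=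
  ∑ c ∈ s.range with c ≠ 0, c * M (s ⁻¹' {c}) ω

/-- `I` is (a version of) the stable integral `∫ f dM` of `f ∈ L^α(ℝ²)`: the limit in probability
of the integrals of simple functions converging to `f` in `L^α`. -/
structure IsStableIntegral {Ω : Type*} [MeasurableSpace Ω] (P : Measure Ω) (α : ℝ)
    (M : Set (ℝ × ℝ) → Ω → ℝ) (f : ℝ × ℝ → ℝ) (I : Ω → ℝ) : Prop where
  memLp : MemLp f (ENNReal.ofReal α) volume
  aemeasurable : AEMeasurable I P
  exists_approx : ∃ s : ℕ → SimpleFunc (ℝ × ℝ) ℝ, (∀ n, (s n).FinMeasSupp volume) ∧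
    Tendsto (fun n => eLpNorm (⇑(s n) - f) (ENNReal.ofReal α) volume) atTop (𝓝 0) ∧
    TendstoInMeasure P (fun n => simpleIntegral M (s n)) atTop I

/-! ### Normalization and limit kernels -/

/-- The first transition point `τ₀ = (1 - γ₁) / (1 - γ₂)`. -/
def tauZero (γ₁ γ₂ : ℝ) : ℝ := (1 - γ₁) / (1 - γ₂)

/-- The normalization `A_n(τ)`. -/
def normalization (α γ₁ γ₂ τ : ℝ) (n : ℕ) : ℝ :=
  if τ < tauZero γ₁ γ₂ then (n : ℝ) ^ ((1 + τ) / α + 1 - γ₁)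
  else if τ ≤ 1 then (n : ℝ) ^ ((1 + τ) / α + τ * (1 - γ₂))
  else (n : ℝ) ^ ((1 + τ) / α + 1 - γ₂)

/-- `H_γ(u,t) = ((t - u)₊^{1-γ} - (-u)₊^{1-γ}) / (1 - γ)`, for `γ < 1`. -/
def H (γ u t : ℝ) : ℝ :=
  ((max 0 (t - u)) ^ (1 - γ) - (max 0 (-u)) ^ (1 - γ)) / (1 - γ)

/-- The indicator of `0 ≤ u ≤ t`. -/
def ind (u t : ℝ) : ℝ := if 0 ≤ u ∧ u ≤ t then 1 else 0

/-- The kernel of the balanced limit at `τ = 1`. -/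
def diagKernel (γ t₁ t₂ u₁ u₂ : ℝ) : ℝ :=
  if max 0 (max (-u₁) (-u₂)) < min (t₁ - u₁) (t₂ - u₂) then
    ((min (t₁ - u₁) (t₂ - u₂)) ^ (1 - γ) - (max 0 (max (-u₁) (-u₂))) ^ (1 - γ)) / (1 - γ)
  else 0

/-- The kernel whose stable integral is `V₁(τ, t₁, t₂)`. -/
def limitKernel (γ₁ γ₂ τ : ℝ) (t : ℝ≥0 × ℝ≥0) (u : ℝ × ℝ) : ℝ :=
  if τ < tauZero γ₁ γ₂ then H γ₁ u.1 t.1 * ind u.2 t.2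
  else if τ = tauZero γ₁ γ₂ then ind u.2 t.2 * H γ₁ u.1 t.1 + ind u.1 t.1 * H γ₂ u.2 t.2
  else if τ < 1 then ind u.1 t.1 * H γ₂ u.2 t.2
  else if τ = 1 then diagKernel γ₂ t.1 t.2 u.1 u.2
  else H γ₂ u.1 t.1 * ind u.2 t.2

/-! ### Finite-dimensional distributions and scaling transition -/

/-- The random vector `(V (t 0), …, V (t (m-1)))`. -/
def fdVector {Ω T : Type*} (V : T → Ω → ℝ) {m : ℕ} (t : Fin m → T) (ω : Ω) :
    EuclideanSpace ℝ (Fin m) :=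
  WithLp.toLp 2 (fun l => V (t l) ω)

/-- Convergence of all finite-dimensional distributions. -/
def ConvergesFDD {Ω Ω' T : Type*} [MeasurableSpace Ω] [MeasurableSpace Ω']
    (P : Measure Ω) [IsProbabilityMeasure P] (Z : ℕ → T → Ω → ℝ)
    (P' : Measure Ω') [IsProbabilityMeasure P'] (V : T → Ω' → ℝ) : Prop :=
  ∀ (m : ℕ) (t : Fin m → T),
    TendstoInDistribution (fun n => fdVector (Z n) t) atTop (fdVector V t) (fun _ => P) P'

/-- Equality of all finite-dimensional distributions. -/
def SameFDD {Ω T : Type*} [MeasurableSpace Ω] (P : Measure Ω) (V W : T → Ω → ℝ) : Prop :=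
  ∀ (m : ℕ) (t : Fin m → T), IdentDistrib (fdVector V t) (fdVector W t) P P

/-- `τstar` is a point of scaling transition of the family of random fields `Z τ n`, `τ > 0`,
with normalizations `A τ n` and limit fields `V τ`: for every `τ > 0` the normalization tends to
infinity and `Z τ n / A τ n` converges to the nontrivial field `V τ`; the law of `V τ` is constant
for `τ` in a left neighbourhood of `τstar` and in a right neighbourhood of it, and the two laws are
not obtained from each other by scaling. -/
structure IsScalingTransitionPoint {Ω Ω' T : Type*} [MeasurableSpace Ω] [MeasurableSpace Ω']
    (P : Measure Ω) [IsProbabilityMeasure P] (Z : ℝ → ℕ → T → Ω → ℝ) (A : ℝ → ℕ → ℝ)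
    (P' : Measure Ω') [IsProbabilityMeasure P'] (V : ℝ → T → Ω' → ℝ) (τstar : ℝ) : Prop where
  normalization_tendsto : ∀ τ, 0 < τ → Tendsto (A τ) atTop atTop
  converges : ∀ τ, 0 < τ → ConvergesFDD P (fun n t ω => (A τ n)⁻¹ * Z τ n t ω) P' (V τ)
  nontrivial : ∀ τ, 0 < τ → ∃ t, ¬ (V τ t =ᵐ[P'] 0)
  transition : ∃ δ, 0 < δ ∧ δ ≤ τstar ∧
    (∀ τ ∈ Set.Ioo (τstar - δ) τstar, ∀ τ' ∈ Set.Ioo (τstar - δ) τstar,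
      SameFDD P' (V τ) (V τ')) ∧
    (∀ τ ∈ Set.Ioo τstar (τstar + δ), ∀ τ' ∈ Set.Ioo τstar (τstar + δ),
      SameFDD P' (V τ) (V τ')) ∧
    (∀ τ ∈ Set.Ioo (τstar - δ) τstar, ∀ τ' ∈ Set.Ioo τstar (τstar + δ), ∀ a : ℝ,
      ¬ SameFDD P' (V τ') (fun t ω => a * V τ t ω))

end

end DiagonalField

/-! All variables in play are symmetric `α`-stable, so each law is determined by a single number. A
linear combination of partial sums is a series `∑ a j * ξ j`, whose law has scale `∑ |a j| ^ α`; the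
same combination of the limit fields is a stable integral of a kernel `K`, with scale `∫ |K| ^ α`.
By characteristic functions, convergence of finite-dimensional distributions reduces to convergence
of these scales (`convergesFDD_of_hasStableLaw`). This follows once the coefficients, read as step
functions on `ℝ²` with cells of sides `n⁻¹` and `n ^ (-τ)`, converge in `L^α` to `K` after division
by a power of `n` (`HasScalingLimit.tendsto_lpPow_count`). The cell area `n ^ (-(1 + τ))` accounts
for the factor `n ^ ((1 + τ) / α)` of the normalization.

The coefficient of `ξ j` is the total filter weight of the two rays from `j`, one horizontal and one
diagonal, inside the rectangle of sides of order `n` and `n ^ τ`. Each is a Riemann sum for `∫ v₊ ^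
(-γ)` over the part of the ray in the rectangle. The horizontal ray can stay inside for about `n`
steps and contributes order `n ^ (1 - γ₁)`; the diagonal one leaves after about `min n (n ^ τ)`
steps and contributes order `n ^ (min τ 1 * (1 - γ₂))`. The larger exponent wins, and the two agree
at `τ₀`. The limit of the diagonal part also changes form at `τ = 1`, where after rescaling the
diagonal goes from vertical to horizontal. See `hasScalingLimit_horizontal`,
`hasScalingLimit_diagonal` and `hasScalingLimit_partialSum`.

The `L^α` convergence is a dominated convergence in which the dominating functions move with `n`:
they live on slabs of varying slope, but have the same `L^α` norm for every slope
(`lintegral_dominating`, `tendsto_lintegral_zero_of_dominated`).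

For the transition points: the kernel does not depend on `τ` inside each of the regimes `τ < τ₀`,
`τ₀ < τ < 1` and `1 < τ`, so no other point can be a transition. At `τ₀` and at `1` the kernel
changes between `H ⊗ ind` and `ind ⊗ H`. Doubling `t₂` multiplies the scale by `2` for the first and
by `2 ^ (1 + α * (1 - γ)) > 2` for the second, so no multiple of one field has the law of the other.
-/

namespace DiagonalField

/-! ### Convergence in measure -/

section ConvergenceInMeasure

variable {Ω ι : Type*} [MeasurableSpace Ω] {P : Measure Ω} {l : Filter ι}

theorem tendstoInMeasure_add {f g : ι → Ω → ℝ} {F G : Ω → ℝ} (hf : TendstoInMeasure P f l F)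
    (hg : TendstoInMeasure P g l G) :
    TendstoInMeasure P (fun i ω => f i ω + g i ω) l (fun ω => F ω + G ω) := by
  rw [tendstoInMeasure_iff_norm] at *
  intro ε hε
  have h := (hf (ε / 2) (half_pos hε)).add (hg (ε / 2) (half_pos hε))
  rw [add_zero] at h
  refine tendsto_of_tendsto_of_tendsto_of_le_of_le tendsto_const_nhds h (fun _ => zero_le) ?_
  intro i
  refine (measure_mono ?_).trans (measure_union_le _ _)
  intro ω hω
  simp only [Set.mem_ofPred_eq, Set.mem_union] at hω ⊢
  by_contra hc
  push Not at hc
  have := norm_add_le (f i ω - F ω) (g i ω - G ω)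
  rw [show f i ω - F ω + (g i ω - G ω) = f i ω + g i ω - (F ω + G ω) by ring] at this
  linarith

theorem tendstoInMeasure_const_mul {f : ι → Ω → ℝ} {F : Ω → ℝ} (a : ℝ)
    (hf : TendstoInMeasure P f l F) :
    TendstoInMeasure P (fun i ω => a * f i ω) l (fun ω => a * F ω) := by
  rw [tendstoInMeasure_iff_norm] at *
  intro ε hε
  refine tendsto_of_tendsto_of_tendsto_of_le_of_le tendsto_const_nhds
    (hf (ε / (|a| + 1)) (by positivity)) (fun _ => zero_le) ?_
  intro i
  refine measure_mono ?_
  intro ω hω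
  simp only [Set.mem_ofPred_eq] at hω ⊢
  rw [← mul_sub, norm_mul, Real.norm_eq_abs] at hω
  rw [div_le_iff₀ (by positivity)]
  nlinarith [norm_nonneg (f i ω - F ω)]

theorem tendstoInMeasure_finsetSum {κ : Type*} (s : Finset κ) {f : κ → ι → Ω → ℝ}
    {F : κ → Ω → ℝ} (hf : ∀ k ∈ s, TendstoInMeasure P (f k) l (F k)) :
    TendstoInMeasure P (fun i ω => ∑ k ∈ s, f k i ω) l (fun ω => ∑ k ∈ s, F k ω) := by
  classical
  induction s using Finset.induction_on with
  | empty =>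
    rw [tendstoInMeasure_iff_norm]
    intro ε hε
    simp [not_le.mpr hε, tendsto_const_nhds]
  | insert a s ha ih =>
    simp only [Finset.sum_insert ha]
    exact tendstoInMeasure_add (hf a (by simp)) (ih fun k hk => hf k (by simp [hk]))

/-- The space of random variables is complete for convergence in probability. -/
theorem exists_tendstoInMeasure_of_cauchy [IsFiniteMeasure P] [l.NeBot] {Y : ι → Ω → ℝ}
    (hY : ∀ i, AEMeasurable (Y i) P)
    (h : ∀ ε : ℝ, 0 < ε →
      Tendsto (fun p : ι × ι => P {ω | ε ≤ ‖Y p.1 ω - Y p.2 ω‖}) (l ×ˢ l) (𝓝 0)) :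
    ∃ Z, AEMeasurable Z P ∧ TendstoInMeasure P Y l Z := by
  have hs : ∀ k : ℕ, ∃ s ∈ l, ∀ p ∈ s, ∀ q ∈ s,
      P {ω | (1 / 2 : ℝ) ^ k ≤ ‖Y p ω - Y q ω‖} ≤ (2⁻¹ : ℝ≥0∞) ^ k := by
    intro k
    have h1 : ∀ᶠ p in l ×ˢ l,
        P {ω | (1 / 2 : ℝ) ^ k ≤ ‖Y p.1 ω - Y p.2 ω‖} ≤ (2⁻¹ : ℝ≥0∞) ^ k := by
      refine (h _ (by positivity)).eventually_le_const ?_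
      exact ENNReal.pow_pos (by simp) k
    obtain ⟨s, hs, hs'⟩ := mem_prod_same_iff.1 h1
    exact ⟨s, hs, fun p hp q hq => hs' (Set.mk_mem_prod hp hq)⟩
  choose s hsl hs using hs
  -- As `x k` lies in every `s j` with `j ≤ k`, both `x k` and `x (k + 1)` lie in `s k`.
  -- Borel–Cantelli then applies to this sequence, although `l` itself need not be countably
  -- generated.
  have hx : ∀ k : ℕ, ∃ x, ∀ j ≤ k, x ∈ s j := by
    intro k
    have : (⋂ j ∈ Finset.range (k + 1), s j) ∈ l :=
      (Filter.biInter_finset_mem _).2 fun j _ => hsl j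
    obtain ⟨x, hx⟩ := l.nonempty_of_mem this
    simp only [Finset.mem_range, Set.mem_iInter] at hx
    exact ⟨x, fun j hj => hx j (by lia)⟩
  choose x hx using hx
  have hsum : ∑' k : ℕ, P {ω | (1 / 2 : ℝ) ^ k ≤ ‖Y (x k) ω - Y (x (k + 1)) ω‖} ≠ ∞ := by
    refine ne_top_of_le_ne_top ?_
      (ENNReal.tsum_le_tsum fun k => hs k (x k) (hx k k le_rfl) (x (k + 1)) (hx _ k (by lia)))
    rw [ENNReal.tsum_geometric]
    simp
  have hlim : ∀ᵐ ω ∂P, ∃ z, Tendsto (fun k => Y (x k) ω) atTop (𝓝 z) := by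
    filter_upwards [ae_eventually_notMem hsum] with ω hω
    obtain ⟨N, hN⟩ := eventually_atTop.1 hω
    refine cauchySeq_tendsto_of_complete ?_
    rw [← cauchySeq_shift N]
    refine cauchySeq_of_le_geometric (1 / 2) 1 (by norm_num) fun n => ?_
    have h2 := hN (n + N) (by lia)
    simp only [not_le] at h2
    rw [show n + 1 + N = n + N + 1 by ring, dist_eq_norm, one_mul]
    refine h2.le.trans ?_
    exact pow_le_pow_of_le_one (by norm_num) (by norm_num) (by lia)
  obtain ⟨Z, hZm, hZ⟩ := measurable_limit_of_tendsto_metrizable_ae (fun k => hY (x k)) hlim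
  have hxZ : TendstoInMeasure P (fun k => Y (x k)) atTop Z :=
    tendstoInMeasure_of_tendsto_ae (fun k => (hY _).aestronglyMeasurable) hZ
  refine ⟨Z, hZm.aemeasurable, ?_⟩
  rw [tendstoInMeasure_iff_norm] at *
  intro ε hε
  rw [ENNReal.tendsto_nhds_zero]
  intro δ hδ
  have hδ2 : 0 < δ / 2 := ENNReal.half_pos hδ.ne'
  have e1 : ∀ᶠ k : ℕ in atTop, (1 / 2 : ℝ) ^ k ≤ ε / 2 :=
    (tendsto_pow_atTop_nhds_zero_of_lt_one (by norm_num) (by norm_num)).eventually_le_const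
      (half_pos hε)
  have e2 : ∀ᶠ k : ℕ in atTop, (2⁻¹ : ℝ≥0∞) ^ k ≤ δ / 2 :=
    (ENNReal.tendsto_pow_atTop_nhds_zero_of_lt_one (by simp)).eventually_le_const hδ2
  have e3 := (hxZ (ε / 2) (half_pos hε)).eventually_le_const hδ2
  obtain ⟨k, h1, h2, h3⟩ := (e1.and (e2.and e3)).exists
  filter_upwards [hsl k] with p hp
  calc P {ω | ε ≤ ‖Y p ω - Z ω‖}
      ≤ P ({ω | (1 / 2 : ℝ) ^ k ≤ ‖Y p ω - Y (x k) ω‖} ∪ {ω | ε / 2 ≤ ‖Y (x k) ω - Z ω‖}) := by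
        refine measure_mono fun ω hω => ?_
        simp only [Set.mem_ofPred_eq, Set.mem_union] at hω ⊢
        by_contra hc
        push Not at hc
        have := norm_add_le (Y p ω - Y (x k) ω) (Y (x k) ω - Z ω)
        rw [sub_add_sub_cancel] at this
        linarith
    _ ≤ _ := measure_union_le _ _
    _ ≤ δ / 2 + δ / 2 := add_le_add ((hs k p hp _ (hx k k le_rfl)).trans h2) h3
    _ = δ := ENNReal.add_halves δ

end ConvergenceInMeasure

/-! ### Symmetric stable laws -/

/-- `Y` has the symmetric `α`-stable law with characteristic function `exp (-κ |t|^α)`. -/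
structure HasStableLaw {Ω : Type*} [MeasurableSpace Ω] (P : Measure Ω) (α κ : ℝ)
    (Y : Ω → ℝ) : Prop where
  aemeasurable : AEMeasurable Y P
  charFun_eq : ∀ t, charFun (P.map Y) t = ((Real.exp (-(κ * |t| ^ α)) : ℝ) : ℂ)

namespace HasStableLaw

variable {Ω : Type*} [MeasurableSpace Ω] {P : Measure Ω} {α κ : ℝ} {Y : Ω → ℝ}

theorem congr {Z : Ω → ℝ} (h : HasStableLaw P α κ Y) (hZ : Y =ᵐ[P] Z) : HasStableLaw P α κ Z :=
  ⟨h.aemeasurable.congr hZ, fun t => by rw [← h.charFun_eq t, Measure.map_congr hZ]⟩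

theorem const_mul (h : HasStableLaw P α κ Y) (a : ℝ) :
    HasStableLaw P α (|a| ^ α * κ) (fun ω => a * Y ω) := by
  refine ⟨h.aemeasurable.const_mul a, fun t => ?_⟩
  have := charFun_map_mul_comp (μ := P) h.aemeasurable a t
  rw [this, h.charFun_eq, abs_mul, Real.mul_rpow (abs_nonneg _) (abs_nonneg _)]
  congr 3
  ring

theorem finsetSum {ι : Type*} {Y : ι → Ω → ℝ} {κ : ι → ℝ} (s : Finset ι)
    (h : ∀ i ∈ s, HasStableLaw P α (κ i) (Y i)) (hind : iIndepFun (s.restrict Y) P) :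
    HasStableLaw P α (∑ i ∈ s, κ i) (fun ω => ∑ i ∈ s, Y i ω) := by
  refine ⟨Finset.aemeasurable_fun_sum _ fun i hi => (h i hi).aemeasurable, fun t => ?_⟩
  rw [iIndepFun.charFun_map_fun_finsetSum_eq_prod (fun i hi => (h i hi).aemeasurable) hind,
    Finset.prod_apply, Finset.prod_congr rfl fun i hi => (h i hi).charFun_eq t,
    ← Complex.ofReal_prod, ← Real.exp_sum, Finset.sum_neg_distrib, Finset.sum_mul]

/-- The tail is controlled by the average of `1 - charFun` over `|t| ≤ 2 / r`, and `1 - exp (-x) ≤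
x`. The bound is linear in `κ`, so vanishing scales of differences give the Cauchy property in
probability. -/
theorem tail_le [IsProbabilityMeasure P] (hα : 0 < α) (hκ : 0 ≤ κ) (h : HasStableLaw P α κ Y)
    {r : ℝ} (hr : 0 < r) : P.real {ω | r < |Y ω|} ≤ 2 * (2 / r) ^ α * κ := by
  have := Measure.isProbabilityMeasure_map h.aemeasurable
  have h1 := measureReal_abs_gt_le_integral_charFun (μ := P.map Y) hr
  have hms : MeasurableSet {x : ℝ | r < |x|} := measurableSet_lt measurable_const measurable_norm
  rw [map_measureReal_apply_of_aemeasurable h.aemeasurable hms] at h1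
  refine (h1 : P.real {ω | r < |Y ω|} ≤ _).trans ?_
  have h2 : ‖∫ t in (-2 * r⁻¹)..(2 * r⁻¹), 1 - charFun (P.map Y) t‖
      ≤ (κ * (2 / r) ^ α) * |2 * r⁻¹ - -2 * r⁻¹| := by
    refine intervalIntegral.norm_integral_le_of_norm_le_const fun t ht => ?_
    have hr' : 0 < r⁻¹ := inv_pos.2 hr
    rw [Set.uIoc_of_le (by linarith)] at ht
    have ht' : |t| ≤ 2 / r := by
      rw [abs_le, div_eq_mul_inv]
      constructor <;> linarith [ht.1, ht.2]
    rw [h.charFun_eq, ← Complex.ofReal_one, ← Complex.ofReal_sub, Complex.norm_real,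
      Real.norm_eq_abs]
    have h3 : 0 ≤ κ * |t| ^ α := by positivity
    have h4 : κ * |t| ^ α ≤ κ * (2 / r) ^ α := by gcongr
    rw [abs_of_nonneg (by simpa using h3)]
    linarith [Real.one_sub_le_exp_neg (κ * |t| ^ α)]
  have h5 : |2 * r⁻¹ - -2 * r⁻¹| = 4 * r⁻¹ := by
    rw [abs_of_nonneg (by have : 0 < r⁻¹ := inv_pos.2 hr
                          linarith)]
    ring
  rw [h5] at h2
  calc 2⁻¹ * r * ‖∫ t in (-2 * r⁻¹)..(2 * r⁻¹), 1 - charFun (P.map Y) t‖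
      ≤ 2⁻¹ * r * ((κ * (2 / r) ^ α) * (4 * r⁻¹)) := by gcongr
    _ = 2 * (2 / r) ^ α * κ := by field_simp; ring

theorem ae_eq_zero_of_zero [IsProbabilityMeasure P] (h : HasStableLaw P α 0 Y) : Y =ᵐ[P] 0 := by
  have := Measure.isProbabilityMeasure_map h.aemeasurable
  have h1 : P.map Y = Measure.dirac 0 := by
    refine Measure.ext_of_charFun ?_
    ext t
    rw [h.charFun_eq]
    simp
  have h2 : ∀ᵐ y ∂(P.map Y), y = 0 := by
    rw [h1, ae_dirac_iff (measurableSet_eq)]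
  exact ae_of_ae_map h.aemeasurable h2

theorem not_ae_eq_zero [IsProbabilityMeasure P] (hκ : κ ≠ 0) (h : HasStableLaw P α κ Y) :
    ¬ Y =ᵐ[P] 0 := by
  intro h0
  have h1 := h.charFun_eq 1
  rw [Measure.map_congr h0, show (0 : Ω → ℝ) = fun _ => (0 : ℝ) from rfl, Measure.map_const] at h1
  simp only [measure_univ, one_smul, charFun_dirac, inner_zero_left, Complex.ofReal_zero, zero_mul,
    Complex.exp_zero, abs_one, Real.one_rpow, mul_one] at h1
  have h2 : Real.exp (-κ) = 1 := by exact_mod_cast h1.symm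
  rw [Real.exp_eq_one_iff] at h2
  exact hκ (by linarith)

theorem eq_of_map_eq {Ω₂ : Type*} [MeasurableSpace Ω₂] {P₂ : Measure Ω₂} {κ₂ : ℝ} {Z : Ω₂ → ℝ}
    (h : HasStableLaw P α κ Y) (h₂ : HasStableLaw P₂ α κ₂ Z) (hYZ : P.map Y = P₂.map Z) :
    κ = κ₂ := by
  have h1 := h.charFun_eq 1
  rw [hYZ, h₂.charFun_eq 1] at h1
  have h2 := Real.exp_injective (Complex.ofReal_injective h1)
  simp only [abs_one, Real.one_rpow, mul_one] at h2
  linarith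

/-- A sequence along `l` converges in distribution, and its characteristic functions can have only
one limit. General filters are allowed because the noise series converge along finite subsets of
`ℤ²`. -/
theorem of_tendstoInMeasure [IsProbabilityMeasure P] {ι : Type*} {l : Filter ι} [l.NeBot]
    [l.IsCountablyGenerated] {Y : ι → Ω → ℝ} {Z : Ω → ℝ} {κ : ι → ℝ} {κ' : ℝ}
    (h : ∀ i, HasStableLaw P α (κ i) (Y i)) (hκ : Tendsto κ l (𝓝 κ'))
    (hYZ : TendstoInMeasure P Y l Z) : HasStableLaw P α κ' Z := by
  obtain ⟨ns, hns, hseq⟩ := hYZ.exists_seq_tendstoInMeasure_atTop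
  have hZ : AEMeasurable Z P := hYZ.aemeasurable fun i => (h i).aemeasurable
  refine ⟨hZ, fun t => ?_⟩
  have hd := (hseq.tendstoInDistribution (fun n => (h (ns n)).aemeasurable)).tendsto
  have hc := ProbabilityMeasure.tendsto_iff_tendsto_charFun.1 hd t
  refine tendsto_nhds_unique hc ?_
  simp only [ProbabilityMeasure.coe_mk, (h _).charFun_eq]
  refine (Complex.continuous_ofReal.tendsto _).comp ((Real.continuous_exp.tendsto _).comp ?_)
  exact ((hκ.comp hns).mul_const _).neg

theorem exists_tendstoInMeasure [IsProbabilityMeasure P] (hα : 0 < α) {ι : Type*} {l : Filter ι}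
    [l.NeBot] {Y : ι → Ω → ℝ} {κ : ι × ι → ℝ}
    (hY : ∀ i, AEMeasurable (Y i) P) (hκ0 : ∀ p, 0 ≤ κ p)
    (h : ∀ p : ι × ι, HasStableLaw P α (κ p) (fun ω => Y p.1 ω - Y p.2 ω))
    (hκ : Tendsto κ (l ×ˢ l) (𝓝 0)) :
    ∃ Z, AEMeasurable Z P ∧ TendstoInMeasure P Y l Z := by
  refine exists_tendstoInMeasure_of_cauchy hY fun ε hε => ?_
  rw [← ENNReal.tendsto_toReal_zero_iff (fun _ => measure_ne_top _ _)]
  have h1 : Tendsto (fun p => 2 * (2 / (ε / 2)) ^ α * κ p) (l ×ˢ l) (𝓝 0) := by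
    simpa using hκ.const_mul (2 * (2 / (ε / 2)) ^ α)
  refine squeeze_zero (fun _ => ENNReal.toReal_nonneg) (fun p => ?_) h1
  refine le_trans ?_ ((h p).tail_le hα (hκ0 p) (half_pos hε))
  refine measureReal_mono (fun ω hω => ?_)
  simp only [Set.mem_ofPred_eq, Real.norm_eq_abs] at hω ⊢
  linarith

end HasStableLaw

/-! ### Finite-dimensional distributions of stable fields -/

section FiniteDimensional

variable {Ω Ω' T : Type*} [MeasurableSpace Ω] [MeasurableSpace Ω'] {P : Measure Ω}
  {P' : Measure Ω'} {α : ℝ}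

theorem aemeasurable_fdVector {V : T → Ω → ℝ} (hV : ∀ t, AEMeasurable (V t) P) {m : ℕ}
    (t : Fin m → T) : AEMeasurable (fdVector V t) P :=
  (PiLp.continuous_toLp 2 _).measurable.comp_aemeasurable (aemeasurable_pi_lambda _ fun l => hV (t l))

/-- The Cramér–Wold device: joint laws are reduced to the one-dimensional laws of linear
combinations. -/
theorem charFun_fdVector {V : T → Ω → ℝ} (hV : ∀ t, AEMeasurable (V t) P) {m : ℕ}
    (t : Fin m → T) (θ : EuclideanSpace ℝ (Fin m)) :
    charFun (P.map (fdVector V t)) θ = charFun (P.map (fun ω => ∑ l, θ l * V (t l) ω)) 1 := by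
  have hm : AEMeasurable (fun ω => ∑ l, θ l * V (t l) ω) P :=
    Finset.aemeasurable_fun_sum _ fun l _ => (hV (t l)).const_mul _
  rw [charFun_apply, charFun_apply, integral_map (aemeasurable_fdVector hV t) (by fun_prop),
    integral_map hm (by fun_prop)]
  congr with ω
  simp [fdVector, PiLp.inner_apply]

theorem convergesFDD_of_hasStableLaw [IsProbabilityMeasure P] [IsProbabilityMeasure P']
    {Z : ℕ → T → Ω → ℝ} {V : T → Ω' → ℝ}
    (hZm : ∀ n t, AEMeasurable (Z n t) P) (hVm : ∀ t, AEMeasurable (V t) P')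
    (h : ∀ (m : ℕ) (t : Fin m → T) (θ : Fin m → ℝ), ∃ (κ : ℕ → ℝ) (κ' : ℝ),
      (∀ᶠ n in atTop, HasStableLaw P α (κ n) (fun ω => ∑ l, θ l * Z n (t l) ω)) ∧
      HasStableLaw P' α κ' (fun ω => ∑ l, θ l * V (t l) ω) ∧ Tendsto κ atTop (𝓝 κ')) :
    ConvergesFDD P Z P' V := by
  intro m t
  refine ⟨fun n => aemeasurable_fdVector (hZm n) t, aemeasurable_fdVector hVm t, ?_⟩
  refine ProbabilityMeasure.tendsto_iff_tendsto_charFun.2 fun θ => ?_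
  obtain ⟨κ, κ', hκ, hκ', hlim⟩ := h m t θ
  simp only [ProbabilityMeasure.coe_mk]
  rw [charFun_fdVector hVm, hκ'.charFun_eq]
  have h2 : Tendsto (fun n => ((Real.exp (-(κ n * |1| ^ α)) : ℝ) : ℂ)) atTop
      (𝓝 ((Real.exp (-(κ' * |1| ^ α)) : ℝ) : ℂ)) :=
    (Complex.continuous_ofReal.tendsto _).comp
      ((Real.continuous_exp.tendsto _).comp (hlim.mul_const _).neg)
  refine h2.congr' ?_
  filter_upwards [hκ] with n hn
  rw [charFun_fdVector (hZm n), hn.charFun_eq]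

theorem sameFDD_of_hasStableLaw [IsProbabilityMeasure P] {V W : T → Ω → ℝ}
    (hVm : ∀ t, AEMeasurable (V t) P) (hWm : ∀ t, AEMeasurable (W t) P)
    (h : ∀ (m : ℕ) (t : Fin m → T) (θ : Fin m → ℝ), ∃ κ,
      HasStableLaw P α κ (fun ω => ∑ l, θ l * V (t l) ω) ∧
      HasStableLaw P α κ (fun ω => ∑ l, θ l * W (t l) ω)) :
    SameFDD P V W := by
  intro m t
  refine ⟨aemeasurable_fdVector hVm t, aemeasurable_fdVector hWm t, ?_⟩
  have := Measure.isProbabilityMeasure_map (aemeasurable_fdVector hVm t)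
  have := Measure.isProbabilityMeasure_map (aemeasurable_fdVector hWm t)
  refine Measure.ext_of_charFun ?_
  ext θ
  obtain ⟨κ, h1, h2⟩ := h m t θ
  rw [charFun_fdVector hVm, charFun_fdVector hWm, h1.charFun_eq, h2.charFun_eq]

theorem SameFDD.map_eq {V W : T → Ω → ℝ} (h : SameFDD P V W) (t : T) :
    P.map (V t) = P.map (W t) := by
  have h1 := (h 1 (fun _ => t)).comp (u := fun v : EuclideanSpace ℝ (Fin 1) => v 0) (by fun_prop)
  exact h1.map_eq

end FiniteDimensional

/-! ### The `α`-th power of the `L^α` norm -/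

/-- The scale parameter `∫ |f|^α dμ` of the stable integral of `f`. -/
noncomputable def lpPow {X : Type*} [MeasurableSpace X] (α : ℝ) (μ : Measure X) (f : X → ℝ) : ℝ :=
  (∫⁻ x, ‖f x‖ₑ ^ α ∂μ).toReal

section LpPow

variable {X : Type*} [MeasurableSpace X] {α : ℝ} {μ : Measure X} {f : X → ℝ}

theorem lpPow_nonneg (α : ℝ) (μ : Measure X) (f : X → ℝ) : 0 ≤ lpPow α μ f := ENNReal.toReal_nonneg

theorem eLpNorm_ofReal_eq (hα : 0 < α) (f : X → ℝ) :
    eLpNorm f (ENNReal.ofReal α) μ = (∫⁻ x, ‖f x‖ₑ ^ α ∂μ) ^ (1 / α) := by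
  rw [eLpNorm_eq_lintegral_rpow_enorm_toReal (by simpa using hα) ENNReal.ofReal_ne_top,
    ENNReal.toReal_ofReal hα.le]

theorem lintegral_enorm_rpow_eq (hα : 0 < α) (f : X → ℝ) :
    ∫⁻ x, ‖f x‖ₑ ^ α ∂μ = eLpNorm f (ENNReal.ofReal α) μ ^ α := by
  rw [eLpNorm_ofReal_eq hα, ← ENNReal.rpow_mul, one_div, inv_mul_cancel₀ hα.ne', ENNReal.rpow_one]

theorem lpPow_eq (hα : 0 < α) (f : X → ℝ) :
    lpPow α μ f = (eLpNorm f (ENNReal.ofReal α) μ).toReal ^ α := by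
  rw [lpPow, lintegral_enorm_rpow_eq hα, ENNReal.toReal_rpow]

theorem tendsto_eLpNorm_of_sub {ι : Type*} {l : Filter ι} {p : ℝ≥0∞} (hp : 1 ≤ p) {F : ι → X → ℝ}
    (hF : ∀ i, AEStronglyMeasurable (F i) μ) (hf : AEStronglyMeasurable f μ)
    (h : Tendsto (fun i => eLpNorm (F i - f) p μ) l (𝓝 0)) :
    Tendsto (fun i => eLpNorm (F i) p μ) l (𝓝 (eLpNorm f p μ)) := by
  have h1 : Tendsto (fun i => eLpNorm f p μ - eLpNorm (F i - f) p μ) l (𝓝 (eLpNorm f p μ)) := by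
    simpa using ENNReal.Tendsto.sub (tendsto_const_nhds (x := eLpNorm f p μ)) h (Or.inr (by simp))
  have h2 : Tendsto (fun i => eLpNorm f p μ + eLpNorm (F i - f) p μ) l (𝓝 (eLpNorm f p μ)) := by
    simpa using tendsto_const_nhds (x := eLpNorm f p μ).add h
  refine tendsto_of_tendsto_of_tendsto_of_le_of_le h1 h2 (fun i => ?_) (fun i => ?_)
  · rw [tsub_le_iff_right]
    have := eLpNorm_add_le (hF i) (hf.sub (hF i)) hp
    rwa [add_sub_cancel, eLpNorm_sub_comm] at this
  · have := eLpNorm_add_le hf ((hF i).sub hf) hp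
    rwa [add_sub_cancel] at this

theorem tendsto_lpPow {ι : Type*} {l : Filter ι} (hα : 1 ≤ α) {F : ι → X → ℝ}
    (hF : ∀ i, AEStronglyMeasurable (F i) μ) (hf : MemLp f (ENNReal.ofReal α) μ)
    (h : Tendsto (fun i => eLpNorm (F i - f) (ENNReal.ofReal α) μ) l (𝓝 0)) :
    Tendsto (fun i => lpPow α μ (F i)) l (𝓝 (lpPow α μ f)) := by
  have hα0 : 0 < α := by linarith
  simp only [lpPow_eq hα0]
  refine ((ENNReal.tendsto_toReal hf.2.ne).comp (tendsto_eLpNorm_of_sub ?_ hF hf.1 h)).rpow_const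
    (Or.inr hα0.le)
  simpa using hα

theorem lpPow_const_mul (hα : 0 < α) (a : ℝ) (f : X → ℝ) :
    lpPow α μ (fun x => a * f x) = |a| ^ α * lpPow α μ f := by
  rw [lpPow_eq hα, lpPow_eq hα]
  have : (fun x => a * f x) = a • f := rfl
  rw [this, eLpNorm_const_smul, ENNReal.toReal_mul, Real.mul_rpow (by positivity) (by positivity),
    toReal_enorm, Real.norm_eq_abs]

end LpPow

/-! ### Integrals of simple functions -/

section SimpleIntegral

variable {Ω : Type*} [MeasurableSpace Ω] {P : Measure Ω} {α : ℝ} {M : Set (ℝ × ℝ) → Ω → ℝ}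

namespace IsStableRandomMeasure

theorem hasStableLaw (hM : IsStableRandomMeasure P α M) {B : Set (ℝ × ℝ)} (hB : MeasurableSet B)
    (hB' : volume B < ∞) : HasStableLaw P α (volume B).toReal (M B) :=
  ⟨hM.aemeasurable B hB hB', hM.charFun_eq B hB hB'⟩

/-- The fibres of `s` are disjoint, so the terms are independent and their scales `|c| ^ α * volume
(s ⁻¹' {c})` add up to `∫ |s| ^ α`. -/
theorem simpleIntegral_hasStableLaw (hα : 0 < α) (hM : IsStableRandomMeasure P α M)
    {s : SimpleFunc (ℝ × ℝ) ℝ} (hs : s.FinMeasSupp volume) :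
    HasStableLaw P α (lpPow α volume s) (simpleIntegral M s) := by
  have hlaw : ∀ c ∈ s.range.filter (· ≠ 0), HasStableLaw P α
      (|c| ^ α * (volume (s ⁻¹' {c})).toReal) (fun ω => c * M (s ⁻¹' {c}) ω) := by
    intro c hc
    exact (hM.hasStableLaw (s.measurableSet_fiber c)
      (SimpleFunc.finMeasSupp_iff.1 hs c (Finset.mem_filter.1 hc).2)).const_mul c
  have hind : iIndepFun ((s.range.filter (· ≠ 0)).restrict
      (fun c ω => c * M (s ⁻¹' {c}) ω)) P := by
    -- Independent scattering is postulated for families indexed by `Fin m`, so the nonzero values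
    -- of `s` are enumerated.
    let e := (s.range.filter (· ≠ 0)).equivFin
    have h1 := hM.indep _ (fun i => s ⁻¹' {(e.symm i : ℝ)})
      (fun i => s.measurableSet_fiber _)
      (fun i => SimpleFunc.finMeasSupp_iff.1 hs _ (Finset.mem_filter.1 (e.symm i).2).2)
      (fun i j hij => (Set.disjoint_singleton.2 fun h =>
        hij (e.symm.injective (Subtype.ext h))).preimage _)
    have h2 := h1.precomp e.injective
    have h3 := h2.comp (fun c x => (c : ℝ) * x) (fun c => measurable_const_mul _)
    convert! h3 using 2 with c
    ext ω
    simp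
  have h := HasStableLaw.finsetSum _ hlaw hind
  have hκ : ∑ c ∈ s.range.filter (· ≠ 0), |c| ^ α * (volume (s ⁻¹' {c})).toReal
      = lpPow α volume s := by
    have h1 : ∫⁻ x, ‖s x‖ₑ ^ α = ∑ c ∈ s.range, ‖c‖ₑ ^ α * volume (s ⁻¹' {c}) := by
      have := SimpleFunc.map_lintegral (μ := volume) (fun c : ℝ => ‖c‖ₑ ^ α) s
      rw [← this, ← SimpleFunc.lintegral_eq_lintegral]
      rfl
    rw [lpPow, h1, ENNReal.toReal_sum, Finset.sum_filter]
    · refine Finset.sum_congr rfl fun c _ => ?_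
      split_ifs with hc
      · rw [ENNReal.toReal_mul, ← ENNReal.toReal_rpow, toReal_enorm, Real.norm_eq_abs]
      · push Not at hc
        simp [hc, hα]
    · intro c _
      rcases eq_or_ne c 0 with rfl | hc
      · simp [hα]
      · exact ENNReal.mul_ne_top (by simp [hα.le])
          (SimpleFunc.finMeasSupp_iff.1 hs c hc).ne
  rw [← hκ]
  exact h

variable [IsProbabilityMeasure P]

theorem empty_ae (hM : IsStableRandomMeasure P α M) : ∀ᵐ ω ∂P, M ∅ ω = 0 := by
  have := hM.hasStableLaw MeasurableSet.empty (by simp)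
  rw [measure_empty, ENNReal.toReal_zero] at this
  exact this.ae_eq_zero_of_zero

/-- Finite additivity comes from countable additivity along `A, B, ∅, ∅, …`; the empty sets
contribute zero almost surely because their scale is zero. -/
theorem union_ae (hM : IsStableRandomMeasure P α M) {A B : Set (ℝ × ℝ)} (hA : MeasurableSet A)
    (hB : MeasurableSet B) (hA' : volume A < ∞) (hB' : volume B < ∞) (hAB : Disjoint A B) :
    ∀ᵐ ω ∂P, M (A ∪ B) ω = M A ω + M B ω := by
  let S : ℕ → Set (ℝ × ℝ) := fun i => if i = 0 then A else if i = 1 then B else ∅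
  have hS : ⋃ i, S i = A ∪ B := by
    ext x
    simp only [S, Set.mem_iUnion, Set.mem_union]
    constructor
    · rintro ⟨i, hi⟩
      split_ifs at hi with h0 h1
      · exact Or.inl hi
      · exact Or.inr hi
      · exact hi.elim
    · rintro (h | h)
      · exact ⟨0, by simpa using h⟩
      · exact ⟨1, by simpa using h⟩
  have hfin : volume (⋃ i, S i) < ∞ := by
    rw [hS]
    exact (measure_union_le _ _).trans_lt (ENNReal.add_lt_top.2 ⟨hA', hB'⟩)
  have h := hM.sigma_additive S (fun i => by dsimp only [S]; split_ifs <;> simp [hA, hB]) hfin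
    (fun i j hij => by
      dsimp only [S]
      split_ifs <;> first | (exfalso; omega) | exact hAB | exact hAB.symm | simp)
  filter_upwards [h, hM.empty_ae] with ω hω h0
  rw [hS] at hω
  refine tendsto_nhds_unique hω (tendsto_const_nhds.congr' ?_)
  filter_upwards [eventually_ge_atTop 2] with N hN
  obtain ⟨k, rfl⟩ := Nat.exists_eq_add_of_le hN
  rw [Finset.sum_range_add]
  have hk : ∀ x, 2 + x ≠ 1 := fun x => by omega
  simp [Finset.sum_range_succ, S, h0, hk]

theorem biUnion_ae {β : Type*} (hM : IsStableRandomMeasure P α M) (s : Finset β)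
    {B : β → Set (ℝ × ℝ)} (hB : ∀ v ∈ s, MeasurableSet (B v)) (hB' : ∀ v ∈ s, volume (B v) < ∞)
    (hd : Pairwise (fun v w => Disjoint (B v) (B w))) :
    ∀ᵐ ω ∂P, M (⋃ v ∈ s, B v) ω = ∑ v ∈ s, M (B v) ω := by
  classical
  induction s using Finset.induction_on with
  | empty => simpa using hM.empty_ae
  | insert a s ha ih =>
    have hd' : Disjoint (B a) (⋃ v ∈ s, B v) :=
      Set.disjoint_iUnion₂_right.2 fun v hv => hd fun h => ha (h ▸ hv)
    have hfin : volume (⋃ v ∈ s, B v) < ∞ :=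
      (measure_biUnion_finset_le _ _).trans_lt
        (ENNReal.sum_lt_top.2 fun v hv => hB' v (by simp [hv]))
    filter_upwards [ih (fun v hv => hB v (by simp [hv])) (fun v hv => hB' v (by simp [hv])),
      hM.union_ae (hB a (by simp)) (Finset.measurableSet_biUnion s fun v hv => hB v (by simp [hv]))
        (hB' a (by simp)) hfin hd'] with ω h1 h2
    rw [Finset.set_biUnion_insert, h2, h1, Finset.sum_insert ha]

/-- The integral of a simple function may be computed on any finer partition, up to a null set.
Applied to the pair `(s, t)`, this puts `s`, `t` and their linear combinations on one partition and
yields linearity. The condition `g 0 = 0` removes the fibre of `0`, whose measure may be infinite.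
-/
theorem simpleIntegral_map_ae {β : Type*} [Zero β] [DecidableEq β]
    (hM : IsStableRandomMeasure P α M)
    (p : SimpleFunc (ℝ × ℝ) β) (hp : p.FinMeasSupp volume) (g : β → ℝ) (hg : g 0 = 0) :
    ∀ᵐ ω ∂P, simpleIntegral M (p.map g) ω = ∑ v ∈ p.range, g v * M (p ⁻¹' {v}) ω := by
  have key : ∀ c ∈ (p.map g).range, c ≠ 0 → ∀ᵐ ω ∂P,
      M ((p.map g) ⁻¹' {c}) ω = ∑ v ∈ p.range with g v = c, M (p ⁻¹' {v}) ω := by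
    intro c _ hc
    have h1 : (p.map g) ⁻¹' {c} = ⋃ v ∈ p.range.filter (fun v => g v = c), p ⁻¹' {v} := by
      ext x
      simp
    rw [h1]
    refine hM.biUnion_ae _ (fun v _ => p.measurableSet_fiber v) (fun v hv => ?_) (fun v w hvw => ?_)
    · refine SimpleFunc.finMeasSupp_iff.1 hp v fun h0 => hc ?_
      rw [← (Finset.mem_filter.1 hv).2, h0, hg]
    · exact (Set.disjoint_singleton.2 hvw).preimage _
  have key' : ∀ᵐ ω ∂P, ∀ c ∈ (p.map g).range, c ≠ 0 →
      M ((p.map g) ⁻¹' {c}) ω = ∑ v ∈ p.range with g v = c, M (p ⁻¹' {v}) ω := by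
    rw [Finset.eventually_all]
    intro c hc
    by_cases h0 : c = 0
    · simp [h0]
    · filter_upwards [key c hc h0] with ω hω _ using hω
  filter_upwards [key'] with ω hω
  have h2 : ∑ v ∈ p.range, g v * M (p ⁻¹' {v}) ω
      = ∑ c ∈ (p.map g).range, ∑ v ∈ p.range with g v = c, g v * M (p ⁻¹' {v}) ω := by
    refine (Finset.sum_fiberwise_of_maps_to (fun v hv => ?_) _).symm
    rw [SimpleFunc.range_map]
    exact Finset.mem_image_of_mem _ hv
  rw [h2, simpleIntegral, Finset.sum_filter]
  refine Finset.sum_congr rfl fun c hc => ?_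
  split_ifs with h0
  · rw [hω c hc h0, Finset.mul_sum]
    refine Finset.sum_congr rfl fun v hv => ?_
    rw [(Finset.mem_filter.1 hv).2]
  · push Not at h0
    refine (Finset.sum_eq_zero fun v hv => ?_).symm
    rw [(Finset.mem_filter.1 hv).2, h0, zero_mul]

theorem simpleIntegral_add_ae (hM : IsStableRandomMeasure P α M) {s t : SimpleFunc (ℝ × ℝ) ℝ}
    (hs : s.FinMeasSupp volume) (ht : t.FinMeasSupp volume) (a b : ℝ) :
    ∀ᵐ ω ∂P, simpleIntegral M (s.map (a * ·) + t.map (b * ·)) ω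
      = a * simpleIntegral M s ω + b * simpleIntegral M t ω := by
  have hp := hs.pair ht
  have h1 : s.map (a * ·) + t.map (b * ·) = (s.pair t).map (fun v => a * v.1 + b * v.2) := by
    ext x; simp
  have h2 : (s.pair t).map Prod.fst = s := by ext x; simp
  have h3 : (s.pair t).map Prod.snd = t := by ext x; simp
  have e2 := hM.simpleIntegral_map_ae (s.pair t) hp Prod.fst rfl
  have e3 := hM.simpleIntegral_map_ae (s.pair t) hp Prod.snd rfl
  rw [h2] at e2
  rw [h3] at e3
  rw [h1]
  filter_upwards [e2, e3, hM.simpleIntegral_map_ae (s.pair t) hp (fun v => a * v.1 + b * v.2)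
    (by simp)] with ω h4 h5 h6
  rw [h4, h5, h6, Finset.mul_sum, Finset.mul_sum, ← Finset.sum_add_distrib]
  exact Finset.sum_congr rfl fun v _ => by ring

end IsStableRandomMeasure

end SimpleIntegral

/-! ### Stable integrals -/

namespace IsStableIntegral

variable {Ω : Type*} [MeasurableSpace Ω] {P : Measure Ω} {α : ℝ}
  {M : Set (ℝ × ℝ) → Ω → ℝ} {f g : ℝ × ℝ → ℝ} {I J : Ω → ℝ}

theorem zero : IsStableIntegral P α M (fun _ => 0) (fun _ => 0) := by
  refine ⟨MemLp.zero, aemeasurable_const, fun _ => 0, fun n => ?_, ?_, ?_⟩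
  · refine SimpleFunc.finMeasSupp_iff.2 fun y hy => ?_
    have : (⇑(0 : SimpleFunc (ℝ × ℝ) ℝ)) ⁻¹' {y} = ∅ := by
      ext x
      simp [hy.symm]
    rw [this]
    simp
  · simp
  · have h0 : ∀ ω, simpleIntegral M 0 ω = 0 := by
      intro ω
      refine Finset.sum_eq_zero fun c hc => ?_
      simp only [Finset.mem_filter, SimpleFunc.mem_range, SimpleFunc.coe_zero] at hc
      obtain ⟨⟨x, hx⟩, hc⟩ := hc
      exact (hc hx.symm).elim
    rw [tendstoInMeasure_iff_norm]
    intro ε hε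
    simp [h0, not_le.2 hε]

variable [IsProbabilityMeasure P]

theorem hasStableLaw (hα : 1 ≤ α) (hM : IsStableRandomMeasure P α M)
    (h : IsStableIntegral P α M f I) : HasStableLaw P α (lpPow α volume f) I := by
  obtain ⟨s, hs, hsf, hsI⟩ := h.exists_approx
  exact HasStableLaw.of_tendstoInMeasure
    (fun n => hM.simpleIntegral_hasStableLaw (by linarith) (hs n))
    (tendsto_lpPow hα (fun n => (s n).aestronglyMeasurable) h.memLp hsf) hsI

theorem linear (hα : 1 ≤ α) (hM : IsStableRandomMeasure P α M) (hI : IsStableIntegral P α M f I)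
    (hJ : IsStableIntegral P α M g J) (a b : ℝ) :
    IsStableIntegral P α M (fun x => a * f x + b * g x) (fun ω => a * I ω + b * J ω) := by
  obtain ⟨s, hs, hsf, hsI⟩ := hI.exists_approx
  obtain ⟨t, ht, htg, htJ⟩ := hJ.exists_approx
  have h1α : 1 ≤ ENNReal.ofReal α := by simpa using hα
  refine ⟨(hI.memLp.const_mul a).add (hJ.memLp.const_mul b),
    (hI.aemeasurable.const_mul a).add (hJ.aemeasurable.const_mul b),
    fun n => (s n).map (a * ·) + (t n).map (b * ·), fun n => ?_, ?_, ?_⟩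
  · exact ((hs n).map (by simp)).add ((ht n).map (by simp))
  · have hlim : Tendsto (fun n => ‖a‖ₑ * eLpNorm (⇑(s n) - f) (ENNReal.ofReal α) volume
        + ‖b‖ₑ * eLpNorm (⇑(t n) - g) (ENNReal.ofReal α) volume) atTop (𝓝 0) := by
      simpa using (ENNReal.Tendsto.const_mul hsf (Or.inr (by simp))).add
        (ENNReal.Tendsto.const_mul htg (Or.inr (by simp)))
    refine tendsto_of_tendsto_of_tendsto_of_le_of_le tendsto_const_nhds hlim (fun _ => zero_le)
      fun n => ?_
    have h1 : (⇑((s n).map (a * ·) + (t n).map (b * ·)) - fun x => a * f x + b * g x)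
        = a • (⇑(s n) - f) + b • (⇑(t n) - g) := by
      ext x
      simp
      ring
    simp only [h1]
    refine (eLpNorm_add_le ?_ ?_ h1α).trans ?_
    · exact ((s n).aestronglyMeasurable.sub hI.memLp.1).const_smul a
    · exact ((t n).aestronglyMeasurable.sub hJ.memLp.1).const_smul b
    · rw [eLpNorm_const_smul, eLpNorm_const_smul]
  · refine (tendstoInMeasure_add (tendstoInMeasure_const_mul a hsI)
      (tendstoInMeasure_const_mul b htJ)).congr_left fun n => ?_
    filter_upwards [hM.simpleIntegral_add_ae (hs n) (ht n) a b] with ω hω using hω.symm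

theorem finsetSum (hα : 1 ≤ α) (hM : IsStableRandomMeasure P α M) {κ : Type*} (s : Finset κ)
    {f : κ → ℝ × ℝ → ℝ} {I : κ → Ω → ℝ} (h : ∀ k ∈ s, IsStableIntegral P α M (f k) (I k))
    (θ : κ → ℝ) : IsStableIntegral P α M (fun x => ∑ k ∈ s, θ k * f k x)
      (fun ω => ∑ k ∈ s, θ k * I k ω) := by
  classical
  induction s using Finset.induction_on with
  | empty => simpa using zero
  | insert a s ha ih =>
    simp only [Finset.sum_insert ha]
    simpa using linear hα hM (h a (by simp)) (ih fun k hk => h k (by simp [hk])) (θ a) 1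

/-- The difference of the integrals of two simple approximants is stable with scale the `α`-th power
of their `L^α` distance, so `L^α`-Cauchy implies Cauchy in probability. -/
theorem exists_of_memLp (hα : 1 ≤ α) (hM : IsStableRandomMeasure P α M)
    (hf : MemLp f (ENNReal.ofReal α) volume) : ∃ I, IsStableIntegral P α M f I := by
  have hα0 : 0 < α := by linarith
  have h1α : 1 ≤ ENNReal.ofReal α := by simpa using hα
  have hex : ∀ n : ℕ, ∃ s : SimpleFunc (ℝ × ℝ) ℝ,
      eLpNorm (f - ⇑s) (ENNReal.ofReal α) volume < ((n : ℝ≥0∞) + 1)⁻¹ ∧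
        s.FinMeasSupp volume := by
    intro n
    obtain ⟨s, hs, hs'⟩ := hf.exists_simpleFunc_eLpNorm_sub_lt ENNReal.ofReal_ne_top
      (ε := ((n : ℝ≥0∞) + 1)⁻¹) (by simp [ENNReal.add_eq_top])
    exact ⟨s, hs, (SimpleFunc.memLp_iff_finMeasSupp (by simpa using hα0)
      ENNReal.ofReal_ne_top).1 hs'⟩
  choose s hs hs' using hex
  have hlim : Tendsto (fun n => eLpNorm (⇑(s n) - f) (ENNReal.ofReal α) volume) atTop (𝓝 0) := by
    have h0 : Tendsto (fun n : ℕ => ((n : ℝ≥0∞) + 1)⁻¹) atTop (𝓝 0) := by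
      have := (tendsto_add_atTop_iff_nat 1).2 ENNReal.tendsto_inv_nat_nhds_zero
      simpa using this
    refine tendsto_of_tendsto_of_tendsto_of_le_of_le tendsto_const_nhds h0 (fun _ => zero_le)
      fun n => ?_
    simp only [eLpNorm_sub_comm (s n : ℝ × ℝ → ℝ) f]
    exact (hs n).le
  have hlaw : ∀ p : ℕ × ℕ, HasStableLaw P α (lpPow α volume (⇑(s p.1) - ⇑(s p.2)))
      (fun ω => simpleIntegral M (s p.1) ω - simpleIntegral M (s p.2) ω) := by
    intro p
    have h1 := hM.simpleIntegral_hasStableLaw hα0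
      (((hs' p.1).map (g := ((1 : ℝ) * ·)) (by simp)).add
        ((hs' p.2).map (g := ((-1 : ℝ) * ·)) (by simp)))
    have h2 : ⇑((s p.1).map ((1 : ℝ) * ·) + (s p.2).map ((-1 : ℝ) * ·))
        = ⇑(s p.1) - ⇑(s p.2) := by
      ext x
      simp [sub_eq_add_neg]
    rw [h2] at h1
    refine h1.congr ?_
    filter_upwards [hM.simpleIntegral_add_ae (hs' p.1) (hs' p.2) 1 (-1)] with ω hω
    rw [hω]
    ring
  have hκ : Tendsto (fun p : ℕ × ℕ => lpPow α volume (⇑(s p.1) - ⇑(s p.2)))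
      (atTop ×ˢ atTop) (𝓝 0) := by
    have h3 : Tendsto (fun p : ℕ × ℕ => eLpNorm (⇑(s p.1) - f) (ENNReal.ofReal α) volume
        + eLpNorm (⇑(s p.2) - f) (ENNReal.ofReal α) volume) (atTop ×ˢ atTop) (𝓝 0) := by
      simpa using (hlim.comp tendsto_fst).add (hlim.comp tendsto_snd)
    have h4 : Tendsto (fun p : ℕ × ℕ => eLpNorm (⇑(s p.1) - ⇑(s p.2)) (ENNReal.ofReal α) volume)
        (atTop ×ˢ atTop) (𝓝 0) := by
      refine tendsto_of_tendsto_of_tendsto_of_le_of_le tendsto_const_nhds h3 (fun _ => zero_le)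
        fun p => ?_
      have := eLpNorm_sub_le (μ := volume) ((s p.1).aestronglyMeasurable.sub hf.1)
        ((s p.2).aestronglyMeasurable.sub hf.1) h1α
      rwa [sub_sub_sub_cancel_right] at this
    simp only [lpPow_eq hα0]
    have h5 := ((ENNReal.tendsto_toReal (by simp)).comp h4).rpow_const (p := α) (Or.inr hα0.le)
    simpa [Real.zero_rpow hα0.ne'] using h5
  obtain ⟨I, hI, hI'⟩ := HasStableLaw.exists_tendstoInMeasure hα0
    (fun n => (hM.simpleIntegral_hasStableLaw hα0 (hs' n)).aemeasurable)
    (fun p => lpPow_nonneg _ _ _) hlaw hκ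
  exact ⟨I, hf, hI, s, hs', hlim, hI'⟩

end IsStableIntegral

/-! ### Series in the noise -/

section NoiseSeries

variable {Ω : Type*} [MeasurableSpace Ω] {P : Measure Ω} {α : ℝ} {ξ : ℤ × ℤ → Ω → ℝ}

theorem IsStableNoise.hasStableLaw_sum (hξ : IsStableNoise P α ξ) {ι : Type*} {e : ι → ℤ × ℤ}
    (he : Function.Injective e) (a : ι → ℝ) (s : Finset ι) :
    HasStableLaw P α (∑ i ∈ s, |a i| ^ α) (fun ω => ∑ i ∈ s, a i * ξ (e i) ω) := by
  refine HasStableLaw.finsetSum s (fun i _ => ?_) ?_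
  · have h : HasStableLaw P α 1 (ξ (e i)) :=
      ⟨(hξ.measurable _).aemeasurable, fun t => by rw [hξ.charFun_eq, one_mul]⟩
    simpa using h.const_mul (a i)
  · have h1 := hξ.indep.precomp (he.comp Subtype.val_injective : Function.Injective
      (fun i : s => e i))
    exact h1.comp (fun i x => a i * x) (fun i => measurable_const_mul _)

/-- `Y` is the limit in probability of the finite partial sums of `∑ j, a j * ξ j`. -/
def IsNoiseSeries (P : Measure Ω) (ξ : ℤ × ℤ → Ω → ℝ) (a : ℤ × ℤ → ℝ) (Y : Ω → ℝ) : Prop :=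
  TendstoInMeasure P (fun (J : Finset (ℤ × ℤ)) ω => ∑ j ∈ J, a j * ξ j ω) atTop Y

namespace IsNoiseSeries

theorem const_mul {a : ℤ × ℤ → ℝ} {Y : Ω → ℝ} (h : IsNoiseSeries P ξ a Y) (b : ℝ) :
    IsNoiseSeries P ξ (fun j => b * a j) (fun ω => b * Y ω) := by
  have := tendstoInMeasure_const_mul b h
  simpa only [IsNoiseSeries, Finset.mul_sum, mul_assoc] using this

theorem finsetSum {κ : Type*} (s : Finset κ) {a : κ → ℤ × ℤ → ℝ} {Y : κ → Ω → ℝ}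
    (h : ∀ k ∈ s, IsNoiseSeries P ξ (a k) (Y k)) :
    IsNoiseSeries P ξ (fun j => ∑ k ∈ s, a k j) (fun ω => ∑ k ∈ s, Y k ω) := by
  have := tendstoInMeasure_finsetSum s h
  refine this.congr_left fun J => Eventually.of_forall fun ω => ?_
  simp only [Finset.sum_mul]
  exact Finset.sum_comm

theorem hasStableLaw [IsProbabilityMeasure P] (hα : 0 < α) (hξ : IsStableNoise P α ξ)
    {a : ℤ × ℤ → ℝ} {Y : Ω → ℝ}
    (h : IsNoiseSeries P ξ a Y) (ha : ∫⁻ j, ‖a j‖ₑ ^ α ∂Measure.count ≠ ∞) :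
    HasStableLaw P α (lpPow α Measure.count a) Y := by
  refine HasStableLaw.of_tendstoInMeasure
    (fun J => hξ.hasStableLaw_sum Function.injective_id a J) ?_ h
  rw [lintegral_count] at ha
  have h1 : Tendsto (fun J : Finset (ℤ × ℤ) => ∑ j ∈ J, ‖a j‖ₑ ^ α) atTop
      (𝓝 (∑' j, ‖a j‖ₑ ^ α)) := ENNReal.summable.hasSum
  have h2 := (ENNReal.tendsto_toReal ha).comp h1
  rw [lpPow, lintegral_count]
  refine h2.congr fun J => ?_
  rw [Function.comp_apply, ENNReal.toReal_sum (fun j _ => by simp [hα.le])]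
  refine Finset.sum_congr rfl fun j _ => ?_
  rw [← ENNReal.toReal_rpow, toReal_enorm, Real.norm_eq_abs]

end IsNoiseSeries

/-- The extension of `c` to `ℤ²` by zero. -/
def extendZero (c : ℕ × ℕ → ℝ) (d : ℤ × ℤ) : ℝ :=
  if 0 ≤ d.1 ∧ 0 ≤ d.2 then c (d.1.toNat, d.2.toNat) else 0

theorem injective_sub_cast (k : ℤ × ℤ) :
    Function.Injective (fun i : ℕ × ℕ => (k.1 - (i.1 : ℤ), k.2 - (i.2 : ℤ))) := by
  rintro ⟨i₁, i₂⟩ ⟨j₁, j₂⟩ h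
  simp only [Prod.mk.injEq] at h ⊢
  omega

theorem IsLinearField.isNoiseSeries {c : ℕ × ℕ → ℝ} {X : ℤ × ℤ → Ω → ℝ}
    (hX : IsLinearField P c ξ X) (k : ℤ × ℤ) :
    IsNoiseSeries P ξ (fun j => extendZero c (k - j)) (X k) := by
  -- Reindexing by `j = k - i`: a finite `J ⊆ ℤ²` is pulled back to filter indices, and the points
  -- of `J` outside the range carry coefficient zero.
  have h1 := (hX.tendsto k).comp (tendsto_finset_preimage_atTop_atTop (injective_sub_cast k))
  refine h1.congr_left fun J => Eventually.of_forall fun ω => ?_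
  have h2 := Finset.sum_preimage (fun i : ℕ × ℕ => (k.1 - (i.1 : ℤ), k.2 - (i.2 : ℤ))) J
    (injective_sub_cast k).injOn (fun j => extendZero c (k - j) * ξ j ω) (fun j _ hj => by
      have : ¬ (0 ≤ (k - j).1 ∧ 0 ≤ (k - j).2) := by
        rintro ⟨h1, h2⟩
        refine hj ⟨((k - j).1.toNat, (k - j).2.toNat), ?_⟩
        simp only [Prod.fst_sub, Prod.snd_sub] at h1 h2
        ext <;> simp only [Prod.fst_sub, Prod.snd_sub] <;> omega
      rw [extendZero, if_neg this, zero_mul])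
  simp only [Function.comp_apply]
  rw [← h2]
  refine Finset.sum_congr rfl fun i _ => ?_
  simp [extendZero]

theorem IsLinearField.isNoiseSeries_partialSum {c : ℕ × ℕ → ℝ} {X : ℤ × ℤ → Ω → ℝ}
    (hX : IsLinearField P c ξ X) (n₁ n₂ : ℝ) (t : ℝ≥0 × ℝ≥0) :
    IsNoiseSeries P ξ (fun j => ∑ k₁ ∈ Finset.range (⌊n₁ * (t.1 : ℝ)⌋₊ + 1),
      ∑ k₂ ∈ Finset.range (⌊n₂ * (t.2 : ℝ)⌋₊ + 1), extendZero c (((k₁ : ℤ), (k₂ : ℤ)) - j))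
      (partialSum X n₁ n₂ t) :=
  IsNoiseSeries.finsetSum _ fun k₁ _ => IsNoiseSeries.finsetSum _ fun k₂ _ =>
    hX.isNoiseSeries ((k₁ : ℤ), (k₂ : ℤ))

theorem IsLinearField.aemeasurable_partialSum {c : ℕ × ℕ → ℝ} {X : ℤ × ℤ → Ω → ℝ}
    (hX : IsLinearField P c ξ X) (n₁ n₂ : ℝ) (t : ℝ≥0 × ℝ≥0) :
    AEMeasurable (partialSum X n₁ n₂ t) P :=
  Finset.aemeasurable_fun_sum _ fun _ _ => Finset.aemeasurable_fun_sum _ fun _ _ =>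
    hX.aemeasurable _

/-- Two finite partial sums differ by a signed sum over the symmetric difference of their index
sets. Signs do not affect the scale, so that scale is `∑ |c i| ^ α` over the symmetric difference,
which vanishes in the limit by summability. -/
theorem exists_isLinearField [IsProbabilityMeasure P] (hα : 0 < α) (hξ : IsStableNoise P α ξ)
    {c : ℕ × ℕ → ℝ} (hc : Summable fun i => |c i| ^ α) : ∃ X, IsLinearField P c ξ X := by
  classical
  have key : ∀ k : ℤ × ℤ, ∃ Z, AEMeasurable Z P ∧ TendstoInMeasure P
      (fun (s : Finset (ℕ × ℕ)) ω => ∑ i ∈ s, c i * ξ (k.1 - (i.1 : ℤ), k.2 - (i.2 : ℤ)) ω)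
      atTop Z := by
    intro k
    refine HasStableLaw.exists_tendstoInMeasure (κ := fun p => ∑ i ∈ symmDiff p.1 p.2, |c i| ^ α)
      hα (fun s => ?_) (fun p => by positivity) (fun p => ?_) ?_
    · exact Finset.aemeasurable_fun_sum _ fun i _ => (hξ.measurable _).aemeasurable.const_mul _
    · have h := hξ.hasStableLaw_sum (injective_sub_cast k)
        (fun i => if i ∈ p.1 then c i else -c i) (symmDiff p.1 p.2)
      have h1 : ∀ i, |if i ∈ p.1 then c i else -c i| = |c i| := fun i => by
        split_ifs <;> simp
      simp only [h1] at h
      convert! h using 2 with ω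
      rw [Finset.symmDiff_def, Finset.sum_union disjoint_sdiff_sdiff,
        Finset.sum_congr (s₁ := p.1 \ p.2) rfl
          (g := fun i => c i * ξ (k.1 - (i.1 : ℤ), k.2 - (i.2 : ℤ)) ω)
          (fun i hi => by rw [if_pos (Finset.mem_sdiff.1 hi).1]),
        Finset.sum_congr (s₁ := p.2 \ p.1) rfl
          (g := fun i => -(c i * ξ (k.1 - (i.1 : ℤ), k.2 - (i.2 : ℤ)) ω))
          (fun i hi => by rw [if_neg (Finset.mem_sdiff.1 hi).2, neg_mul]),
        Finset.sum_neg_distrib, ← sub_eq_add_neg, Finset.sum_sdiff_sub_sum_sdiff]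
    · rw [tendsto_def]
      intro e he
      obtain ⟨s, hs⟩ := summable_iff_vanishing.1 hc e he
      refine mem_prod_iff.2 ⟨Set.Ici s, mem_atTop s, Set.Ici s, mem_atTop s, ?_⟩
      rintro ⟨p, q⟩ ⟨hp, hq⟩
      refine hs _ (Finset.disjoint_left.2 fun i hi his => ?_)
      simp only [Set.mem_Ici] at hp hq
      rcases Finset.mem_symmDiff.1 hi with h | h
      · exact h.2 (hq his)
      · exact h.2 (hp his)
  choose X hX hX' using key
  exact ⟨X, hX, hX'⟩

end NoiseSeries

/-! ### The coefficients of the partial sums -/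

section Coefficients

/-- The weights of the filter along one of its two rays. -/
noncomputable def rayWeight (γ : ℝ) (s : ℤ) : ℝ := if 1 ≤ s then (1 + (s : ℝ)) ^ (-γ) else 0

/-- The sum of the filter weights along the ray of direction `(1, σ)` started at `j`, restricted to
the rectangle `[0, T₁] × [0, T₂]`. -/
noncomputable def rayCoeff (σ : ℤ) (γ : ℝ) (T₁ T₂ : ℕ) (j : ℤ × ℤ) : ℝ :=
  ∑ k ∈ Finset.range (T₁ + 1),
    if 0 ≤ j.2 + σ * (k - j.1) ∧ j.2 + σ * (k - j.1) ≤ T₂ then rayWeight γ (k - j.1) else 0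

theorem rayWeight_nonneg (γ : ℝ) (s : ℤ) : 0 ≤ rayWeight γ s := by
  unfold rayWeight
  split_ifs with h
  · have : (1 : ℝ) ≤ s := by exact_mod_cast h
    positivity
  · exact le_rfl

theorem extendZero_diagFilter (γ₁ γ₂ : ℝ) (d : ℤ × ℤ) :
    extendZero (diagFilter γ₁ γ₂) d =
      (if d.2 = 0 * d.1 then rayWeight γ₁ d.1 else 0) +
        (if d.2 = 1 * d.1 then rayWeight γ₂ d.1 else 0) := by
  obtain ⟨a, b⟩ := d
  simp only [extendZero, diagFilter, rayWeight, zero_mul, one_mul]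
  by_cases ha : 0 ≤ a
  · by_cases hb : 0 ≤ b
    · lift a to ℕ using ha
      lift b to ℕ using hb
      simp only [Int.toNat_natCast, Nat.cast_nonneg, and_self, if_true, Int.cast_natCast]
      congr 1
      · by_cases h0 : b = 0 <;> by_cases h1 : 1 ≤ a <;> simp [h0, h1]
      · by_cases h0 : a = b
        · subst h0
          by_cases h1 : 1 ≤ a <;> simp [h1]
        · have : b ≠ a := fun h => h0 h.symm
          simp [h0, this]
    · have h1 : b ≠ 0 := by omega
      have h2 : b ≠ a := by omega
      simp [hb, h1, h2]
  · have h1 : ¬ 1 ≤ a := by omega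
    simp [ha, h1]

/-- In each column `k₁` the ray meets a single row, so the inner sum has at most one nonzero term.
-/
theorem sum_ray_indicator (σ : ℤ) (γ : ℝ) (T₁ T₂ : ℕ) (j : ℤ × ℤ) :
    ∑ k₁ ∈ Finset.range (T₁ + 1), ∑ k₂ ∈ Finset.range (T₂ + 1),
      (if (k₂ : ℤ) - j.2 = σ * (k₁ - j.1) then rayWeight γ (k₁ - j.1) else 0)
      = rayCoeff σ γ T₁ T₂ j := by
  refine Finset.sum_congr rfl fun k₁ _ => ?_
  split_ifs with h
  · obtain ⟨m, hm⟩ := Int.eq_ofNat_of_zero_le h.1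
    rw [Finset.sum_eq_single m]
    · rw [if_pos (by omega)]
    · intro b _ hb
      rw [if_neg (by omega)]
    · intro hm'
      simp only [Finset.mem_range] at hm'
      omega
  · refine Finset.sum_eq_zero fun k₂ hk₂ => if_neg fun hk => h ?_
    simp only [Finset.mem_range] at hk₂
    omega

theorem sum_extendZero_diagFilter (γ₁ γ₂ : ℝ) (T₁ T₂ : ℕ) (j : ℤ × ℤ) :
    ∑ k₁ ∈ Finset.range (T₁ + 1), ∑ k₂ ∈ Finset.range (T₂ + 1),
      extendZero (diagFilter γ₁ γ₂) (((k₁ : ℤ), (k₂ : ℤ)) - j)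
      = rayCoeff 0 γ₁ T₁ T₂ j + rayCoeff 1 γ₂ T₁ T₂ j := by
  simp only [extendZero_diagFilter, Finset.sum_add_distrib, Prod.fst_sub, Prod.snd_sub,
    sum_ray_indicator]

/-- On the diagonal both coordinate displacements agree, so reflection preserves the weights. This
allows the shorter side of the rectangle always to be taken as the first one. -/
theorem rayCoeff_one_swap (γ : ℝ) (T₁ T₂ : ℕ) (j : ℤ × ℤ) :
    rayCoeff 1 γ T₁ T₂ j = rayCoeff 1 γ T₂ T₁ j.swap := by
  rw [← sum_ray_indicator, ← sum_ray_indicator, Finset.sum_comm]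
  refine Finset.sum_congr rfl fun k₁ _ => Finset.sum_congr rfl fun k₂ _ => ?_
  simp only [one_mul, Prod.fst_swap, Prod.snd_swap]
  by_cases h : (k₁ : ℤ) - j.2 = k₂ - j.1
  · rw [h]
  · rw [if_neg h, if_neg fun h' => h h'.symm]

/-- The axis and the diagonal with `j ≥ 1` are disjoint, so the `α`-th powers do not mix, and each
ray gives a series of terms `(1 + m) ^ (-αγ)`. -/
theorem summable_diagFilter {α γ₁ γ₂ : ℝ} (hα : 0 < α) (h₁ : 1 < α * γ₁) (h₂ : 1 < α * γ₂) :
    Summable fun i => |diagFilter γ₁ γ₂ i| ^ α := by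
  have hs : ∀ γ : ℝ, 1 < α * γ → Summable fun i : ℕ => |(1 + (i : ℝ)) ^ (-γ)| ^ α := by
    intro γ hγ
    have h := (summable_nat_add_iff 1).2 (Real.summable_nat_rpow (p := -(α * γ)).2 (by linarith))
    refine h.congr fun i => ?_
    have h0 : (0 : ℝ) ≤ 1 + i := by positivity
    rw [abs_of_nonneg (by positivity), ← Real.rpow_mul h0]
    push_cast
    congr 1 <;> ring
  have hray : ∀ (γ : ℝ) (e : ℕ → ℕ × ℕ), Function.Injective e → 1 < α * γ →
      Summable fun i : ℕ × ℕ => ∑' m : ℕ, if e m = i then |(1 + (m : ℝ)) ^ (-γ)| ^ α else 0 := by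
    intro γ e he hγ
    refine (he.summable_iff fun i hi => ?_).1 ?_
    · simp only [Set.mem_range, not_exists] at hi
      simp [hi]
    · refine (hs γ hγ).congr fun m => ?_
      simp only [Function.comp_apply, he.eq_iff]
      simp
  have h := (hray γ₁ (fun m => (m, 0)) (fun a b h => by simpa using h) h₁).add
    (hray γ₂ (fun m => (m, m)) (fun a b h => by simpa using h) h₂)
  refine Summable.of_nonneg_of_le (fun i => by positivity) (fun i => ?_) h
  obtain ⟨a, b⟩ := i
  have e1 : ∀ f : ℕ → ℝ, (∑' m : ℕ, if ((m, 0) : ℕ × ℕ) = (a, b) then f m else 0)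
      = if b = 0 then f a else 0 := by
    intro f
    rw [tsum_eq_single a (fun m hm => by simp [hm])]
    simp [eq_comm]
  have e2 : ∀ f : ℕ → ℝ, (∑' m : ℕ, if ((m, m) : ℕ × ℕ) = (a, b) then f m else 0)
      = if a = b then f b else 0 := by
    intro f
    rw [tsum_eq_single b (fun m hm => by simp [hm])]
    simp [eq_comm]
  rw [e1, e2]
  have hp1 : 0 ≤ |(1 + (a : ℝ)) ^ (-γ₁)| ^ α := by positivity
  have hp2 : 0 ≤ |(1 + (b : ℝ)) ^ (-γ₂)| ^ α := by positivity
  simp only [diagFilter]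
  by_cases hb : b = 0
  · subst hb
    by_cases ha : a = 0
    · simp [ha, hα.ne']
    · have : 1 ≤ a := by omega
      simp [ha, this]
  · have hb' : 1 ≤ b := by omega
    by_cases hab : a = b
    · simp [hb, hab, hb']
    · simp [hb, hab, hα.ne']

end Coefficients

/-! ### Measure-theoretic preliminaries -/

/-- Dominated convergence with varying dominating functions of constant integral. -/
theorem tendsto_lintegral_zero_of_dominated {X : Type*} [MeasurableSpace X] {μ : Measure X}
    {h D : ℕ → X → ℝ≥0∞} {D' : X → ℝ≥0∞} {C : ℝ≥0∞}
    (hh : ∀ n, AEMeasurable (h n) μ) (hD : ∀ n, AEMeasurable (D n) μ) (hD' : AEMeasurable D' μ)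
    (hle : ∀ᶠ n in atTop, h n ≤ᵐ[μ] D n)
    (hh0 : ∀ᵐ x ∂μ, Tendsto (fun n => h n x) atTop (𝓝 0))
    (hDlim : ∀ᵐ x ∂μ, Tendsto (fun n => D n x) atTop (𝓝 (D' x)))
    (hDC : ∀ n, ∫⁻ x, D n x ∂μ = C) (hDC' : ∫⁻ x, D' x ∂μ = C) (hC : C ≠ ∞) :
    Tendsto (fun n => ∫⁻ x, h n x ∂μ) atTop (𝓝 0) := by
  have hfin : ∀ᵐ x ∂μ, D' x < ∞ := ae_lt_top' hD' (hDC' ▸ hC)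
  have h1 : Tendsto (fun n => ∫⁻ x, min (h n x) (D' x) ∂μ) atTop (𝓝 0) := by
    have := tendsto_lintegral_of_dominated_convergence' (μ := μ) (f := fun _ => (0 : ℝ≥0∞))
      (F := fun n x => min (h n x) (D' x)) D' (fun n => (hh n).min hD')
      (fun n => Eventually.of_forall fun x => min_le_right _ _) (hDC' ▸ hC) (by
        filter_upwards [hh0] with x hx
        simpa using hx.min (tendsto_const_nhds (x := D' x)))
    simpa using this
  have h2 : Tendsto (fun n => ∫⁻ x, (D' x - D n x) ∂μ) atTop (𝓝 0) := by
    have := tendsto_lintegral_of_dominated_convergence' (μ := μ) (f := fun _ => (0 : ℝ≥0∞))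
      (F := fun n x => D' x - D n x) D' (fun n => hD'.sub (hD n))
      (fun n => Eventually.of_forall fun x => tsub_le_self) (hDC' ▸ hC) (by
        filter_upwards [hDlim, hfin] with x hx hx'
        have := ENNReal.Tendsto.sub (tendsto_const_nhds (x := D' x)) hx (Or.inl hx'.ne)
        simpa using this)
    simpa using this
  -- Scheffé's argument: since `D n` and `D'` have the same integral, the positive and negative
  -- parts of their difference do too. Only the part bounded by `D'` is accessible to dominated
  -- convergence, and the bound `h n ≤ min (h n) D' + (D n - D')` finishes.
  have h3 : ∀ n, ∫⁻ x, (D n x - D' x) ∂μ = ∫⁻ x, (D' x - D n x) ∂μ := by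
    intro n
    have e : ∫⁻ x, (D n x - D' x) ∂μ + C = ∫⁻ x, (D' x - D n x) ∂μ + C := by
      rw [← hDC', ← lintegral_add_right' _ hD', hDC', ← hDC n, ← lintegral_add_right' _ (hD n)]
      refine lintegral_congr fun x => ?_
      rw [tsub_add_eq_max, tsub_add_eq_max, max_comm]
    exact (ENNReal.add_left_inj hC).1 e
  have h4 := h1.add h2
  rw [add_zero] at h4
  refine tendsto_of_tendsto_of_tendsto_of_le_of_le' tendsto_const_nhds h4
    (Eventually.of_forall fun _ => zero_le) ?_
  filter_upwards [hle] with n hn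
  rw [← h3, ← lintegral_add_left' ((hh n).min hD')]
  refine lintegral_mono_ae ?_
  filter_upwards [hn] with x hx
  rcases le_total (h n x) (D' x) with h | h
  · rw [min_eq_left h]
    exact le_self_add
  · rw [min_eq_right h, add_comm, tsub_add_eq_max]
    exact hx.trans (le_max_left _ _)

/-- Each integer is the image of an interval of length `N⁻¹`. This converts lattice sums into
integrals of step functions. -/
theorem map_floor_mul {N : ℝ} (hN : 0 < N) :
    Measure.map (fun x : ℝ => ⌊N * x⌋) volume = ENNReal.ofReal N⁻¹ • Measure.count := by
  have hm : Measurable (fun x : ℝ => ⌊N * x⌋) := Int.measurable_floor.comp (measurable_const_mul N)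
  rw [Measure.ext_iff_singleton]
  intro i
  rw [Measure.map_apply hm (measurableSet_singleton i)]
  have : (fun x : ℝ => ⌊N * x⌋) ⁻¹' {i} = Set.Ico (i / N) ((i + 1) / N) := by
    ext x
    simp only [Set.mem_preimage, Set.mem_singleton_iff, Int.floor_eq_iff, Set.mem_Ico,
      div_le_iff₀ hN, lt_div_iff₀ hN, mul_comm N]
  rw [this, Real.volume_Ico, Measure.smul_apply, Measure.count_singleton, smul_eq_mul, mul_one]
  congr 1
  field_simp
  ring

theorem integral_comp_floor_mul {N : ℝ} (hN : 0 < N) {φ : ℤ → ℝ} (hφ : Summable fun i => ‖φ i‖) :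
    ∫ x : ℝ, φ ⌊N * x⌋ = N⁻¹ * ∑' i, φ i := by
  have hm : Measurable (fun x : ℝ => ⌊N * x⌋) := Int.measurable_floor.comp (measurable_const_mul N)
  have hi : Integrable φ Measure.count :=
    ⟨measurable_from_top.aestronglyMeasurable, by rwa [hasFiniteIntegral_count_iff]⟩
  rw [← integral_map (φ := fun x : ℝ => ⌊N * x⌋) (f := φ) hm.aemeasurable
    measurable_from_top.aestronglyMeasurable, map_floor_mul hN, integral_smul_measure,
    integral_countable hi]
  simp [Measure.real, (inv_pos.2 hN).le]

/-- The scaling map of `ℝ²` onto the lattice `ℤ²`. -/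
noncomputable def latticeMap (N₁ N₂ : ℝ) (u : ℝ × ℝ) : ℤ × ℤ := (⌊N₁ * u.1⌋, ⌊N₂ * u.2⌋)

theorem measurable_latticeMap (N₁ N₂ : ℝ) : Measurable (latticeMap N₁ N₂) :=
  (Int.measurable_floor.comp (measurable_fst.const_mul N₁)).prodMk
    (Int.measurable_floor.comp (measurable_snd.const_mul N₂))

theorem map_latticeMap {N₁ N₂ : ℝ} (h₁ : 0 < N₁) (h₂ : 0 < N₂) :
    Measure.map (latticeMap N₁ N₂) volume = ENNReal.ofReal (N₁ * N₂)⁻¹ • Measure.count := by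
  have hm : ∀ N : ℝ, Measurable (fun x : ℝ => ⌊N * x⌋) := fun N =>
    Int.measurable_floor.comp (measurable_const_mul N)
  rw [Measure.ext_iff_singleton]
  rintro ⟨i, j⟩
  rw [Measure.map_apply (measurable_latticeMap _ _) (measurableSet_singleton _)]
  have e : latticeMap N₁ N₂ ⁻¹' {(i, j)}
      = ((fun x : ℝ => ⌊N₁ * x⌋) ⁻¹' {i}) ×ˢ ((fun x : ℝ => ⌊N₂ * x⌋) ⁻¹' {j}) := by
    ext u
    simp [latticeMap]
  rw [e, Measure.volume_eq_prod, Measure.prod_prod, ← Measure.map_apply (hm _)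
    (measurableSet_singleton _), ← Measure.map_apply (hm _) (measurableSet_singleton _),
    map_floor_mul h₁, map_floor_mul h₂]
  simp only [Measure.smul_apply, Measure.count_singleton, smul_eq_mul, mul_one]
  rw [← ENNReal.ofReal_mul (inv_pos.2 h₁).le, mul_inv]

theorem lintegral_comp_latticeMap {N₁ N₂ : ℝ} (h₁ : 0 < N₁) (h₂ : 0 < N₂) (φ : ℤ × ℤ → ℝ≥0∞) :
    ∫⁻ u, φ (latticeMap N₁ N₂ u) = ENNReal.ofReal (N₁ * N₂)⁻¹ * ∫⁻ j, φ j ∂Measure.count := by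
  rw [← lintegral_map (f := φ) (measurable_of_countable φ) (measurable_latticeMap _ _),
    map_latticeMap h₁ h₂, lintegral_smul_measure, smul_eq_mul]

theorem ae_line_ne (r c : ℝ) : ∀ᵐ u : ℝ × ℝ, u.2 - r * u.1 ≠ c := by
  have hs : MeasurableSet {u : ℝ × ℝ | ¬ u.2 - r * u.1 ≠ c} := by
    simp only [not_not]
    exact measurableSet_eq_fun (by fun_prop) measurable_const
  rw [ae_iff, Measure.volume_eq_prod, Measure.measure_prod_null hs]
  refine Eventually.of_forall fun x => ?_
  have : Prod.mk x ⁻¹' {u : ℝ × ℝ | ¬ u.2 - r * u.1 ≠ c} = {c + r * x} := by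
    ext y
    simp [sub_eq_iff_eq_add]
  exact (congrArg volume this).trans (by simp)

/-- Off the boundary `z = 0` the truth value of a lattice inequality is eventually that of its
limit; this is what makes the indicators converge almost everywhere. -/
theorem eventually_nonneg_iff_of_tendsto_div {y N : ℕ → ℝ} {z : ℝ} (hN : ∀ᶠ n in atTop, 0 < N n)
    (h : Tendsto (fun n => y n / N n) atTop (𝓝 z)) (hz : z ≠ 0) :
    ∀ᶠ n in atTop, (0 ≤ y n ↔ 0 ≤ z) := by
  rcases hz.lt_or_gt with hz | hz
  · filter_upwards [hN, h.eventually_lt_const hz] with n h1 h2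
    have : y n < 0 := by
      rwa [div_lt_iff₀ h1, zero_mul] at h2
    simp [not_le.2 this, not_le.2 hz]
  · filter_upwards [hN, h.eventually_const_lt hz] with n h1 h2
    have : 0 < y n := by
      rwa [lt_div_iff₀ h1, zero_mul] at h2
    simp [this.le, hz.le]

theorem tendsto_floor_mul_div {N : ℕ → ℝ} (hN : Tendsto N atTop atTop) (x : ℝ) :
    Tendsto (fun n => (⌊N n * x⌋ : ℝ) / N n) atTop (𝓝 x) := by
  have h0 : Tendsto (fun n => x - (N n)⁻¹) atTop (𝓝 x) := by
    simpa using tendsto_const_nhds (x := x).sub (tendsto_inv_atTop_zero.comp hN)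
  refine tendsto_of_tendsto_of_tendsto_of_le_of_le' h0 tendsto_const_nhds ?_ ?_
  · filter_upwards [hN.eventually_gt_atTop 0] with n hn
    rw [le_div_iff₀ hn, sub_mul, inv_mul_cancel₀ hn.ne']
    linarith [Int.lt_floor_add_one (N n * x)]
  · filter_upwards [hN.eventually_gt_atTop 0] with n hn
    rw [div_le_iff₀ hn]
    linarith [Int.floor_le (N n * x)]

/-! ### The limit kernels as integrals of a power function -/

section Kernels

variable {γ : ℝ}

/-- The function `v₊ ^ (-γ)`. -/
noncomputable def posPow (γ v : ℝ) : ℝ := if 0 < v then v ^ (-γ) else 0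

theorem posPow_nonneg (γ v : ℝ) : 0 ≤ posPow γ v := by
  unfold posPow
  split_ifs <;> positivity

theorem ind_nonneg (u t : ℝ) : 0 ≤ ind u t := by
  unfold ind
  split_ifs <;> simp

theorem ind_le_one (u t : ℝ) : ind u t ≤ 1 := by
  unfold ind
  split_ifs <;> simp

theorem measurable_ind (t : ℝ) : Measurable (fun u => ind u t) :=
  Measurable.ite measurableSet_Icc measurable_const measurable_const

theorem integrableOn_posPow (hγ : γ < 1) {a b : ℝ} (ha : 0 ≤ a) :
    IntegrableOn (posPow γ) (Set.Ioc a b) := by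
  rcases lt_or_ge b a with h | h
  · simp [Set.Ioc_eq_empty_of_le h.le]
  have h1 := (intervalIntegral.intervalIntegrable_rpow' (a := a) (b := b) (r := -γ)
    (by linarith)).1
  refine h1.congr_fun (fun v hv => ?_) measurableSet_Ioc
  simp [posPow, ha.trans_lt hv.1]

theorem setIntegral_posPow (hγ : γ < 1) {a b : ℝ} (ha : 0 ≤ a) :
    ∫ v in Set.Ioc a b, posPow γ v =
      if a < b then (b ^ (1 - γ) - a ^ (1 - γ)) / (1 - γ) else 0 := by
  split_ifs with h
  · have h1 : ∫ v in Set.Ioc a b, posPow γ v = ∫ v in Set.Ioc a b, v ^ (-γ) :=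
      setIntegral_congr_fun measurableSet_Ioc fun v hv => by simp [posPow, ha.trans_lt hv.1]
    rw [h1, ← intervalIntegral.integral_of_le h.le, integral_rpow (Or.inl (by linarith)),
      neg_add_eq_sub]
  · simp [Set.Ioc_eq_empty h]

theorem posPow_mul_ind_eq_indicator (γ u t v : ℝ) : posPow γ v * ind (u + v) t
    = (Set.Icc (max 0 (-u)) (t - u)).indicator (posPow γ) v := by
  simp only [Set.indicator, Set.mem_Icc, ind, max_le_iff, posPow]
  by_cases hv : 0 < v
  · have : (0 ≤ v ∧ -u ≤ v) ∧ v ≤ t - u ↔ 0 ≤ u + v ∧ u + v ≤ t := by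
      constructor
      · rintro ⟨⟨_, h1⟩, h2⟩; constructor <;> linarith
      · rintro ⟨h1, h2⟩; exact ⟨⟨hv.le, by linarith⟩, by linarith⟩
    simp only [this, hv, if_true]
    split_ifs <;> simp
  · simp [hv]

theorem integrable_posPow_mul_ind (hγ : γ < 1) (u t : ℝ) :
    Integrable (fun v => posPow γ v * ind (u + v) t) := by
  have h := (integrableOn_posPow hγ (le_max_left 0 (-u)) (b := t - u)).congr_set_ae
    Ioc_ae_eq_Icc.symm
  rw [← integrable_indicator_iff measurableSet_Icc] at h
  exact h.congr (Eventually.of_forall fun v => (posPow_mul_ind_eq_indicator γ u t v).symm)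

theorem integral_posPow_mul_ind (hγ : γ < 1) (u : ℝ) {t : ℝ} (ht : 0 ≤ t) :
    ∫ v, posPow γ v * ind (u + v) t = H γ u t := by
  simp only [posPow_mul_ind_eq_indicator]
  rw [integral_indicator measurableSet_Icc, integral_Icc_eq_integral_Ioc,
    setIntegral_posPow hγ (le_max_left _ _), H]
  split_ifs with h
  · rw [max_eq_right ((le_max_left _ _).trans h.le)]
  · have h0 : max 0 (t - u) = max 0 (-u) := by
      refine le_antisymm (max_le (le_max_left _ _) (not_lt.1 h)) (max_le_max le_rfl (by linarith))
    rw [h0, sub_self, zero_div]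

/-- The limit of the scaled coefficients along the ray of slope `r`. -/
noncomputable def rayKernel (γ r : ℝ) (t : ℝ≥0 × ℝ≥0) (u : ℝ × ℝ) : ℝ :=
  ∫ v, posPow γ v * (ind (u.1 + v) t.1 * ind (u.2 + r * v) t.2)

theorem rayKernel_zero (hγ : γ < 1) (t : ℝ≥0 × ℝ≥0) (u : ℝ × ℝ) :
    rayKernel γ 0 t u = H γ u.1 t.1 * ind u.2 t.2 := by
  rw [← integral_posPow_mul_ind hγ u.1 t.1.coe_nonneg, ← integral_mul_const]
  simp [rayKernel, mul_assoc]

theorem rayKernel_one (hγ : γ < 1) (t : ℝ≥0 × ℝ≥0) (u : ℝ × ℝ) :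
    rayKernel γ 1 t u = diagKernel γ t.1 t.2 u.1 u.2 := by
  have h1 : ∀ v, posPow γ v * (ind (u.1 + v) t.1 * ind (u.2 + 1 * v) t.2)
      = (Set.Icc (max 0 (max (-u.1) (-u.2))) (min (t.1 - u.1) (t.2 - u.2))).indicator
        (posPow γ) v := by
    intro v
    simp only [Set.indicator, Set.mem_Icc, ind, max_le_iff, le_min_iff, posPow, one_mul]
    by_cases hv : 0 < v
    · have : (0 ≤ v ∧ -u.1 ≤ v ∧ -u.2 ≤ v) ∧ v ≤ t.1 - u.1 ∧ v ≤ t.2 - u.2 ↔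
          (0 ≤ u.1 + v ∧ u.1 + v ≤ t.1) ∧ (0 ≤ u.2 + v ∧ u.2 + v ≤ t.2) := by
        constructor
        · rintro ⟨⟨_, h1, h2⟩, h3, h4⟩; refine ⟨⟨?_, ?_⟩, ?_, ?_⟩ <;> linarith
        · rintro ⟨⟨h1, h2⟩, h3, h4⟩; refine ⟨⟨hv.le, ?_, ?_⟩, ?_, ?_⟩ <;> linarith
      simp only [this, hv, if_true]
      by_cases ha : 0 ≤ u.1 + v ∧ u.1 + v ≤ t.1 <;>
        by_cases hb : 0 ≤ u.2 + v ∧ u.2 + v ≤ t.2 <;> simp [ha, hb]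
    · simp [hv]
  simp only [rayKernel, h1]
  rw [integral_indicator measurableSet_Icc, integral_Icc_eq_integral_Ioc,
    setIntegral_posPow hγ (le_max_left _ _), diagKernel]

theorem H_nonneg (hγ : γ < 1) (u : ℝ) {t : ℝ} (ht : 0 ≤ t) : 0 ≤ H γ u t := by
  rw [← integral_posPow_mul_ind hγ u ht]
  exact integral_nonneg fun v => mul_nonneg (posPow_nonneg _ _) (ind_nonneg _ _)

theorem continuous_H (hγ : γ < 1) (t : ℝ) : Continuous (fun u => H γ u t) := by
  have h : 0 ≤ 1 - γ := by linarith
  exact (((continuous_const.max (continuous_const.sub continuous_id)).rpow_const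
    fun _ => Or.inr h).sub ((continuous_const.max continuous_neg).rpow_const
    fun _ => Or.inr h)).div_const _

/-- `H` vanishes for `u ≥ t` and is bounded on `[-1, t]`, where `1 + |u| ≤ 2 + t`. For `u < -1` it
is the integral of `v ^ (-γ)` over `[-u, t - u]`, hence at most `t * (-u) ^ (-γ)`, and `1 + |u| ≤
2|u|`. The two summands of the constant correspond to the last two ranges. -/
theorem H_le (h0 : 0 < γ) (hγ : γ < 1) {t : ℝ} (ht : 0 ≤ t) :
    ∃ C, ∀ u, |H γ u t| ≤ C * (1 + ‖u‖) ^ (-γ) := by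
  have h1 : 0 < 1 - γ := by linarith
  have hC₁ : 0 ≤ (t + 1) ^ (1 - γ) / (1 - γ) * (2 + t) ^ γ := by positivity
  have hC₂ : 0 ≤ t * 2 ^ γ := by positivity
  refine ⟨(t + 1) ^ (1 - γ) / (1 - γ) * (2 + t) ^ γ + t * 2 ^ γ, fun u => ?_⟩
  rw [abs_of_nonneg (H_nonneg hγ u ht), add_mul]
  have hn : 0 ≤ ‖u‖ := norm_nonneg u
  have hp : 0 ≤ (1 + ‖u‖) ^ (-γ) := by positivity
  rcases le_or_gt t u with hu | hu
  · have : H γ u t = 0 := by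
      rw [H, max_eq_left (by linarith), max_eq_left (by linarith), sub_self, zero_div]
    rw [this]
    positivity
  rcases le_or_gt (-1) u with hu' | hu'
  · have h2 : H γ u t ≤ (t + 1) ^ (1 - γ) / (1 - γ) := by
      rw [H]
      gcongr
      have h3 : (max 0 (t - u)) ^ (1 - γ) ≤ (t + 1) ^ (1 - γ) := by
        refine Real.rpow_le_rpow (le_max_left _ _) (max_le (by linarith) (by linarith)) h1.le
      have h4 : 0 ≤ (max 0 (-u)) ^ (1 - γ) := Real.rpow_nonneg (le_max_left _ _) _
      linarith
    have h3 : (1 : ℝ) ≤ (2 + t) ^ γ * (1 + ‖u‖) ^ (-γ) := by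
      rw [Real.rpow_neg (by positivity), ← div_eq_mul_inv, ← Real.div_rpow (by positivity)
        (by positivity)]
      refine Real.one_le_rpow ?_ h0.le
      rw [one_le_div (by positivity)]
      have : ‖u‖ ≤ 1 + t := by
        rw [Real.norm_eq_abs, abs_le]
        constructor <;> linarith
      linarith
    have h5 : 0 ≤ (t + 1) ^ (1 - γ) / (1 - γ) := by positivity
    nlinarith [mul_nonneg hC₂ hp, mul_le_mul_of_nonneg_left h3 h5]
  · have h2 : H γ u t ≤ t * (-u) ^ (-γ) := by
      have hu0 : 0 ≤ -u := by linarith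
      rw [H, max_eq_right (by linarith), max_eq_right hu0]
      have h3 := intervalIntegral.norm_integral_le_of_norm_le_const (a := -u) (b := t - u)
        (f := fun v : ℝ => v ^ (-γ)) (C := (-u) ^ (-γ)) (fun v hv => by
          rw [Set.uIoc_of_le (by linarith)] at hv
          have hv0 : 0 < v := by linarith [hv.1]
          rw [Real.norm_eq_abs, abs_of_nonneg (by positivity)]
          exact Real.rpow_le_rpow_of_nonpos (by linarith) hv.1.le (by linarith))
      rw [integral_rpow (Or.inl (by linarith)), neg_add_eq_sub] at h3
      have h4 : |t - u - -u| = t := by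
        rw [sub_neg_eq_add, sub_add_cancel, abs_of_nonneg ht]
      rw [h4, mul_comm] at h3
      exact (le_abs_self _).trans h3
    have h3 : (-u) ^ (-γ) ≤ 2 ^ γ * (1 + ‖u‖) ^ (-γ) := by
      have hu0 : 0 < -u := by linarith
      rw [Real.norm_eq_abs, abs_of_neg (by linarith), Real.rpow_neg hu0.le,
        Real.rpow_neg (by linarith), ← div_eq_mul_inv, ← Real.div_rpow (by norm_num) (by linarith),
        ← Real.inv_rpow hu0.le]
      refine Real.rpow_le_rpow (by positivity) ?_ h0.le
      rw [inv_eq_one_div, div_le_div_iff₀ hu0 (by linarith)]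
      linarith
    nlinarith [mul_nonneg hC₁ hp, mul_le_mul_of_nonneg_left h3 ht]

theorem memLp_H {α : ℝ} (hα : 0 < α) (h0 : 0 < γ) (hγ : γ < 1) (hαγ : 1 < α * γ) {t : ℝ}
    (ht : 0 ≤ t) :
    MemLp (fun u => H γ u t) (ENNReal.ofReal α) volume := by
  obtain ⟨C, hC⟩ := H_le h0 hγ ht
  have hm : AEStronglyMeasurable (fun u : ℝ => (1 + ‖u‖) ^ (-γ)) volume :=
    Measurable.aestronglyMeasurable (by fun_prop)
  have hg : MemLp (fun u : ℝ => (1 + ‖u‖) ^ (-γ)) (ENNReal.ofReal α) volume := by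
    rw [← integrable_norm_rpow_iff hm (by simpa using hα) ENNReal.ofReal_ne_top,
      ENNReal.toReal_ofReal hα.le]
    have h1 := integrable_one_add_norm (E := ℝ) (μ := volume) (r := α * γ) (by simpa using hαγ)
    refine h1.congr (Eventually.of_forall fun u => ?_)
    have h2 : 0 ≤ 1 + ‖u‖ := by positivity
    dsimp only
    rw [Real.norm_of_nonneg (by positivity : 0 ≤ (1 + ‖u‖) ^ (-γ)), ← Real.rpow_mul h2]
    congr 1
    ring
  refine hg.of_le_mul (c := C) (continuous_H hγ t).aestronglyMeasurable
    (Eventually.of_forall fun u => ?_)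
  have h2 : 0 ≤ 1 + ‖u‖ := by positivity
  rw [Real.norm_eq_abs, Real.norm_eq_abs, abs_of_nonneg (a := (1 + ‖u‖) ^ (-γ)) (by positivity)]
  exact hC u

end Kernels

/-! ### Scaling limit of the ray coefficients -/

section Scaling

variable {σ : ℤ} {γ N₁ N₂ : ℝ} {t : ℝ≥0 × ℝ≥0} {u : ℝ × ℝ}

/-- The ray coefficients of the rectangle `[0, N₁ t₁] × [0, N₂ t₂]`, scaled to a function
on `ℝ²`. -/
noncomputable def scaledRay (σ : ℤ) (γ N₁ N₂ : ℝ) (t : ℝ≥0 × ℝ≥0) (u : ℝ × ℝ) : ℝ :=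
  N₁ ^ (γ - 1) * rayCoeff σ γ ⌊N₁ * (t.1 : ℝ)⌋₊ ⌊N₂ * (t.2 : ℝ)⌋₊ (latticeMap N₁ N₂ u)

/-- The condition that the point at distance `s` on the ray of direction `(1, σ)` started at `j`
lies in the rectangle `[0, T₁] × [0, T₂]`. -/
def rayCond (σ : ℤ) (T₁ T₂ : ℕ) (j : ℤ × ℤ) (s : ℤ) : Prop :=
  (0 ≤ j.1 + s ∧ j.1 + s ≤ T₁) ∧ (0 ≤ j.2 + σ * s ∧ j.2 + σ * s ≤ T₂)

open Classical in
-- The sum over columns is rewritten over displacements `s = k - j.1` ranging over all of `ℤ`, the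
-- form to which `integral_comp_floor_mul` applies.
theorem hasSum_rayCoeff (σ : ℤ) (γ : ℝ) (T₁ T₂ : ℕ) (j : ℤ × ℤ) :
    HasSum (fun s => if rayCond σ T₁ T₂ j s then rayWeight γ s else 0) (rayCoeff σ γ T₁ T₂ j) ∧
      Summable (fun s => ‖if rayCond σ T₁ T₂ j s then rayWeight γ s else 0‖) := by
  let e : ℕ ↪ ℤ := ⟨fun k => (k : ℤ) - j.1, fun a b h => by simpa using h⟩
  have hz : ∀ s ∉ (Finset.range (T₁ + 1)).map e,
      (if rayCond σ T₁ T₂ j s then rayWeight γ s else 0) = 0 := by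
    intro s hs
    refine if_neg fun h => hs ?_
    obtain ⟨k, hk⟩ := Int.eq_ofNat_of_zero_le h.1.1
    refine Finset.mem_map.2 ⟨k, Finset.mem_range.2 ?_, ?_⟩
    · have := h.1.2
      omega
    · change (k : ℤ) - j.1 = s
      omega
  refine ⟨?_, summable_of_ne_finset_zero (s := (Finset.range (T₁ + 1)).map e)
    fun s hs => by rw [hz s hs, norm_zero]⟩
  have h := hasSum_sum_of_ne_finset_zero (L := .unconditional ℤ) hz
  rw [Finset.sum_map] at h
  convert! h using 1
  refine Finset.sum_congr rfl fun k hk => ?_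
  have hk' : k ≤ T₁ := by simpa [Nat.lt_succ_iff] using hk
  have h1 : rayCond σ T₁ T₂ j (e k) ↔
      (0 ≤ j.2 + σ * (k - j.1) ∧ j.2 + σ * (k - j.1) ≤ T₂) := by
    rw [show e k = (k : ℤ) - j.1 from rfl]
    simp only [rayCond, add_sub_cancel]
    refine and_iff_right ⟨by omega, by omega⟩
  simp only [h1]
  rfl

open Classical in
/-- The integrand representing `scaledRay`. -/
noncomputable def rayIntegrand (σ : ℤ) (γ N₁ N₂ : ℝ) (t : ℝ≥0 × ℝ≥0) (u : ℝ × ℝ) (v : ℝ) : ℝ :=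
  N₁ ^ γ * if rayCond σ ⌊N₁ * (t.1 : ℝ)⌋₊ ⌊N₂ * (t.2 : ℝ)⌋₊ (latticeMap N₁ N₂ u) ⌊N₁ * v⌋
    then rayWeight γ ⌊N₁ * v⌋ else 0

theorem scaledRay_eq_integral (hN : 0 < N₁) :
    scaledRay σ γ N₁ N₂ t u = ∫ v, rayIntegrand σ γ N₁ N₂ t u v := by
  classical
  obtain ⟨h1, h2⟩ := hasSum_rayCoeff σ γ ⌊N₁ * (t.1 : ℝ)⌋₊ ⌊N₂ * (t.2 : ℝ)⌋₊ (latticeMap N₁ N₂ u)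
  have h3 := integral_comp_floor_mul hN h2
  simp only [rayIntegrand]
  rw [integral_const_mul, scaledRay, Real.rpow_sub_one hN.ne', ← h1.tsum_eq, div_eq_mul_inv,
    mul_assoc]
  congr 1
  convert! h3.symm

theorem measurable_rayIntegrand : Measurable (rayIntegrand σ γ N₁ N₂ t u) := by
  classical
  have hm : Measurable (fun v : ℝ => ⌊N₁ * v⌋) :=
    Int.measurable_floor.comp (measurable_const_mul N₁)
  exact ((measurable_of_countable (fun s : ℤ => if rayCond σ ⌊N₁ * (t.1 : ℝ)⌋₊ ⌊N₂ * (t.2 : ℝ)⌋₊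
    (latticeMap N₁ N₂ u) s then rayWeight γ s else 0)).comp hm).const_mul _

theorem measurable_scaledRay : Measurable (scaledRay σ γ N₁ N₂ t) :=
  ((measurable_of_countable (rayCoeff σ γ ⌊N₁ * (t.1 : ℝ)⌋₊ ⌊N₂ * (t.2 : ℝ)⌋₊)).comp
    (measurable_latticeMap N₁ N₂)).const_mul _

theorem rayIntegrand_nonneg (hN : 0 ≤ N₁) (v : ℝ) : 0 ≤ rayIntegrand σ γ N₁ N₂ t u v := by
  unfold rayIntegrand
  refine mul_nonneg (by positivity) ?_
  split_ifs
  · exact rayWeight_nonneg _ _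
  · exact le_rfl

/-- Since `N₁ * v ≤ 1 + ⌊N₁ * v⌋`, the shift by `1` in the filter makes the limit itself a bound for
the rescaled weights, with no extra constant. -/
theorem mul_rayWeight_le (hγ : 0 < γ) (hN : 0 < N₁) (v : ℝ) :
    N₁ ^ γ * rayWeight γ ⌊N₁ * v⌋ ≤ posPow γ v := by
  unfold rayWeight posPow
  split_ifs with h h' h'
  · have h1 : N₁ * v ≤ 1 + (⌊N₁ * v⌋ : ℝ) := by linarith [Int.lt_floor_add_one (N₁ * v)]
    have h2 : (1 + (⌊N₁ * v⌋ : ℝ)) ^ (-γ) ≤ (N₁ * v) ^ (-γ) :=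
      Real.rpow_le_rpow_of_nonpos (by positivity) h1 (by linarith)
    calc N₁ ^ γ * (1 + (⌊N₁ * v⌋ : ℝ)) ^ (-γ) ≤ N₁ ^ γ * (N₁ * v) ^ (-γ) := by gcongr
      _ = v ^ (-γ) := by
        rw [Real.mul_rpow hN.le h'.le, ← mul_assoc, ← Real.rpow_add hN, add_neg_cancel,
          Real.rpow_zero, one_mul]
  · exfalso
    have h1 : ((1 : ℤ) : ℝ) ≤ N₁ * v := Int.le_floor.1 h
    push_cast at h1
    nlinarith [not_lt.1 h']
  · simp only [mul_zero]
    positivity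
  · simp

/-- The indicator of the slab `-(t₁ + 1) ≤ u₂ - r u₁ ≤ t₂ + 1`. -/
noncomputable def slab (t : ℝ≥0 × ℝ≥0) (r : ℝ) (u : ℝ × ℝ) : ℝ :=
  ind (u.2 - r * u.1 + (t.1 + 1)) (t.1 + 1 + (t.2 + 1))

/-- Eliminating `s` shows that a starting point whose ray meets the rectangle lies in a strip along
the ray. For `σ = 1` the lower bound is `-N₁ t₁` up to rounding, which `N₁ ≤ N₂` turns into `-N₂
t₁`; the rounding is absorbed by the `+ 1`, as `N₂ ≥ 1`. -/
theorem rayCond.bounds {s : ℤ} (hσ : σ = 0 ∨ σ = 1) (h₁ : 1 ≤ N₁) (h₂ : 1 ≤ N₂)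
    (h₁₂ : σ * N₁ ≤ N₂)
    (h : rayCond σ ⌊N₁ * (t.1 : ℝ)⌋₊ ⌊N₂ * (t.2 : ℝ)⌋₊ (latticeMap N₁ N₂ u) s) :
    0 ≤ ⌊N₁ * u.1⌋ + s ∧ (⌊N₁ * u.1⌋ + s : ℝ) ≤ N₁ * t.1 ∧
      -(N₂ * (t.1 + 1)) ≤ N₂ * u.2 - σ * N₁ * u.1 ∧
        N₂ * u.2 - σ * N₁ * u.1 ≤ N₂ * (t.2 + 1) := by
  obtain ⟨⟨a1, a2⟩, a3, a4⟩ := h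
  simp only [latticeMap] at a1 a2 a3 a4
  have ht1 : (0 : ℝ) ≤ t.1 := t.1.coe_nonneg
  have ht2 : (0 : ℝ) ≤ t.2 := t.2.coe_nonneg
  have f1 : ((⌊N₁ * (t.1 : ℝ)⌋₊ : ℤ) : ℝ) ≤ N₁ * t.1 := by
    exact_mod_cast Nat.floor_le (by positivity)
  have f2 : ((⌊N₂ * (t.2 : ℝ)⌋₊ : ℤ) : ℝ) ≤ N₂ * t.2 := by
    exact_mod_cast Nat.floor_le (by positivity)
  have b1 : (0 : ℝ) ≤ ⌊N₁ * u.1⌋ + s := by exact_mod_cast a1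
  have b2 : (⌊N₁ * u.1⌋ + s : ℝ) ≤ N₁ * t.1 := le_trans (by exact_mod_cast a2) f1
  have b3 : (0 : ℝ) ≤ ⌊N₂ * u.2⌋ + σ * s := by exact_mod_cast a3
  have b4 : (⌊N₂ * u.2⌋ + σ * s : ℝ) ≤ N₂ * t.2 := le_trans (by exact_mod_cast a4) f2
  refine ⟨a1, b2, ?_⟩
  have g1 := Int.floor_le (N₁ * u.1)
  have g2 := Int.lt_floor_add_one (N₁ * u.1)
  have g3 := Int.floor_le (N₂ * u.2)
  have g4 := Int.lt_floor_add_one (N₂ * u.2)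
  rcases hσ with rfl | rfl
  · push_cast at *
    have : 0 ≤ N₂ * t.1 := by positivity
    constructor <;> linarith
  · push_cast at *
    have h5 : N₁ * t.1 ≤ N₂ * t.1 := by
      rw [one_mul] at h₁₂
      gcongr
    constructor <;> linarith

theorem rayIntegrand_le (hγ : 0 < γ) (hσ : σ = 0 ∨ σ = 1) (h₁ : 1 ≤ N₁) (h₂ : 1 ≤ N₂)
    (h₁₂ : σ * N₁ ≤ N₂) (v : ℝ) :
    rayIntegrand σ γ N₁ N₂ t u v ≤
      posPow γ v * ind (u.1 + v) (t.1 + 2) * slab t (σ * N₁ / N₂) u := by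
  have hN : 0 < N₁ := by linarith
  have hN2 : 0 < N₂ := by linarith
  unfold rayIntegrand
  split_ifs with h
  · obtain ⟨b1, b2, b3, b4⟩ := rayCond.bounds hσ h₁ h₂ h₁₂ h
    have b1' : (0 : ℝ) ≤ ⌊N₁ * u.1⌋ + ⌊N₁ * v⌋ := by exact_mod_cast b1
    have c1 : ind (u.1 + v) (t.1 + 2) = 1 := by
      refine if_pos ⟨?_, ?_⟩
      · have : 0 ≤ N₁ * (u.1 + v) := by
          linarith [Int.floor_le (N₁ * u.1), Int.floor_le (N₁ * v)]
        exact nonneg_of_mul_nonneg_right this hN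
      -- The two floors lose less than `2` altogether, and `2 ≤ N₁ * 2`.
      · have : N₁ * (u.1 + v) ≤ N₁ * (t.1 + 2) := by
          linarith [Int.lt_floor_add_one (N₁ * u.1), Int.lt_floor_add_one (N₁ * v)]
        exact le_of_mul_le_mul_left this hN
    have c2 : slab t (σ * N₁ / N₂) u = 1 := by
      have e : N₂ * u.2 - σ * N₁ * u.1 = N₂ * (u.2 - σ * N₁ / N₂ * u.1) := by
        field_simp
      rw [e] at b3 b4
      have b5 := le_of_mul_le_mul_left b4 hN2
      have b6 : -((t.1 : ℝ) + 1) ≤ u.2 - σ * N₁ / N₂ * u.1 := by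
        rw [← mul_neg] at b3
        exact le_of_mul_le_mul_left b3 hN2
      exact if_pos ⟨by linarith, by linarith⟩
    rw [c1, c2, mul_one, mul_one]
    exact mul_rayWeight_le hγ hN v
  · rw [mul_zero]
    exact mul_nonneg (mul_nonneg (posPow_nonneg _ _) (ind_nonneg _ _)) (ind_nonneg _ _)

/-- The function dominating `scaledRay`. -/
noncomputable def dominating (γ : ℝ) (t : ℝ≥0 × ℝ≥0) (r : ℝ) (u : ℝ × ℝ) : ℝ :=
  H γ u.1 (t.1 + 2) * slab t r u

theorem scaledRay_nonneg (hN : 0 < N₁) : 0 ≤ scaledRay σ γ N₁ N₂ t u := by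
  rw [scaledRay_eq_integral hN]
  exact integral_nonneg fun v => rayIntegrand_nonneg hN.le v

theorem scaledRay_le (hγ : 0 < γ) (hγ1 : γ < 1) (hσ : σ = 0 ∨ σ = 1) (h₁ : 1 ≤ N₁) (h₂ : 1 ≤ N₂)
    (h₁₂ : σ * N₁ ≤ N₂) :
    scaledRay σ γ N₁ N₂ t u ≤ dominating γ t (σ * N₁ / N₂) u := by
  have hN : 0 < N₁ := by linarith
  rw [scaledRay_eq_integral hN, dominating,
    ← integral_posPow_mul_ind hγ1 u.1 (t := (t.1 : ℝ) + 2) (by positivity), ← integral_mul_const]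
  exact integral_mono_of_nonneg (Eventually.of_forall fun v => rayIntegrand_nonneg hN.le v)
    ((integrable_posPow_mul_ind hγ1 _ _).mul_const _)
    (Eventually.of_forall fun v => rayIntegrand_le hγ hσ h₁ h₂ h₁₂ v)

end Scaling

/-! ### Pointwise limit of the scaled ray coefficients -/

section Limit

variable {σ : ℤ} {γ r : ℝ} {N₁ N₂ : ℕ → ℝ} {t : ℝ≥0 × ℝ≥0} {u : ℝ × ℝ}

theorem tendsto_mul_rayWeight (h₁ : Tendsto N₁ atTop atTop) {v : ℝ} (hv : v ≠ 0) :
    Tendsto (fun n => N₁ n ^ γ * rayWeight γ ⌊N₁ n * v⌋) atTop (𝓝 (posPow γ v)) := by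
  rcases hv.lt_or_gt with hv | hv
  · have h : posPow γ v = 0 := by simp [posPow, hv.le]
    rw [h]
    refine tendsto_const_nhds.congr' ?_
    filter_upwards [h₁.eventually_gt_atTop 0] with n hn
    have : ¬ 1 ≤ ⌊N₁ n * v⌋ := by
      rw [Int.le_floor]
      push_cast
      nlinarith
    simp [rayWeight, this]
  · have h : posPow γ v = v ^ (-γ) := by simp [posPow, hv]
    rw [h]
    have h3 : Tendsto (fun n => (1 + (⌊N₁ n * v⌋ : ℝ)) / N₁ n) atTop (𝓝 v) := by
      have := (tendsto_inv_atTop_zero.comp h₁).add (tendsto_floor_mul_div h₁ v)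
      rw [zero_add] at this
      refine this.congr fun n => ?_
      rw [Function.comp_apply, add_div, one_div]
    refine (h3.rpow_const (p := -γ) (Or.inl hv.ne')).congr' ?_
    filter_upwards [h₁.eventually_gt_atTop 0, h₁.eventually_ge_atTop (1 / v)] with n hn hn'
    have h4 : 1 ≤ ⌊N₁ n * v⌋ := by
      rw [Int.le_floor]
      push_cast
      rwa [div_le_iff₀ hv] at hn'
    have h5 : (1 : ℝ) ≤ ⌊N₁ n * v⌋ := by exact_mod_cast h4
    rw [rayWeight, if_pos h4, Real.div_rpow (by positivity) hn.le, Real.rpow_neg hn.le,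
      div_inv_eq_mul, mul_comm]

/-- The four inequalities in `rayCond`, divided by `N₁` or `N₂`, converge to those of the limit
rectangle. The excluded equalities keep the limit off its boundary. -/
theorem tendsto_rayIntegrand (h₁ : Tendsto N₁ atTop atTop)
    (h₂ : Tendsto N₂ atTop atTop) (hr : Tendsto (fun n => σ * N₁ n / N₂ n) atTop (𝓝 r)) {v : ℝ}
    (hv : v ≠ 0) (hv1 : u.1 + v ≠ 0) (hv2 : u.1 + v ≠ t.1) (hv3 : u.2 + r * v ≠ 0)
    (hv4 : u.2 + r * v ≠ t.2) :
    Tendsto (fun n => rayIntegrand σ γ (N₁ n) (N₂ n) t u v) atTop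
      (𝓝 (posPow γ v * (ind (u.1 + v) t.1 * ind (u.2 + r * v) t.2))) := by
  have p₁ := h₁.eventually_gt_atTop 0
  have p₂ := h₂.eventually_gt_atTop 0
  have natFloor : ∀ (N : ℕ → ℝ), Tendsto N atTop atTop → ∀ x : ℝ≥0,
      Tendsto (fun n => ((⌊N n * (x : ℝ)⌋₊ : ℕ) : ℝ) / N n) atTop (𝓝 x) := by
    intro N hN x
    refine (tendsto_floor_mul_div hN x).congr' ?_
    filter_upwards [hN.eventually_ge_atTop 0] with n hn
    rw [natCast_floor_eq_intCast_floor (by positivity)]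
  have l1 : Tendsto (fun n => ((⌊N₁ n * u.1⌋ : ℝ) + ⌊N₁ n * v⌋) / N₁ n) atTop (𝓝 (u.1 + v)) := by
    simpa only [add_div] using (tendsto_floor_mul_div h₁ u.1).add (tendsto_floor_mul_div h₁ v)
  have l2 : Tendsto (fun n => (((⌊N₁ n * (t.1 : ℝ)⌋₊ : ℕ) : ℝ) -
      ((⌊N₁ n * u.1⌋ : ℝ) + ⌊N₁ n * v⌋)) / N₁ n) atTop (𝓝 (t.1 - (u.1 + v))) := by
    simpa only [sub_div] using (natFloor N₁ h₁ t.1).sub l1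
  have l3 : Tendsto (fun n => ((⌊N₂ n * u.2⌋ : ℝ) + σ * ⌊N₁ n * v⌋) / N₂ n) atTop
      (𝓝 (u.2 + r * v)) := by
    refine ((tendsto_floor_mul_div h₂ u.2).add (hr.mul (tendsto_floor_mul_div h₁ v))).congr' ?_
    filter_upwards [p₁, p₂] with n a b
    field_simp
  have l4 : Tendsto (fun n => (((⌊N₂ n * (t.2 : ℝ)⌋₊ : ℕ) : ℝ) -
      ((⌊N₂ n * u.2⌋ : ℝ) + σ * ⌊N₁ n * v⌋)) / N₂ n) atTop (𝓝 (t.2 - (u.2 + r * v))) := by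
    simpa only [sub_div] using (natFloor N₂ h₂ t.2).sub l3
  have e1 := eventually_nonneg_iff_of_tendsto_div p₁ l1 hv1
  have e2 := eventually_nonneg_iff_of_tendsto_div p₁ l2 (sub_ne_zero.2 hv2.symm)
  have e3 := eventually_nonneg_iff_of_tendsto_div p₂ l3 hv3
  have e4 := eventually_nonneg_iff_of_tendsto_div p₂ l4 (sub_ne_zero.2 hv4.symm)
  refine ((tendsto_mul_rayWeight (γ := γ) h₁ hv).mul_const
    (ind (u.1 + v) t.1 * ind (u.2 + r * v) t.2)).congr' ?_
  filter_upwards [e1, e2, e3, e4] with n a1 a2 a3 a4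
  rw [sub_nonneg, sub_nonneg] at a2 a4
  have hc : rayCond σ ⌊N₁ n * (t.1 : ℝ)⌋₊ ⌊N₂ n * (t.2 : ℝ)⌋₊ (latticeMap (N₁ n) (N₂ n) u)
      ⌊N₁ n * v⌋ ↔ (0 ≤ u.1 + v ∧ u.1 + v ≤ t.1) ∧ (0 ≤ u.2 + r * v ∧ u.2 + r * v ≤ t.2) := by
    rw [← a1, ← a2, ← a3, ← a4]
    simp only [rayCond, latticeMap]
    norm_cast
  unfold rayIntegrand
  simp only [hc, ind]
  by_cases ha : 0 ≤ u.1 + v ∧ u.1 + v ≤ t.1 <;>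
    by_cases hb : 0 ≤ u.2 + r * v ∧ u.2 + r * v ≤ t.2 <;> simp [ha, hb]

theorem tendsto_scaledRay (hγ : 0 < γ) (hγ1 : γ < 1) (hσ : σ = 0 ∨ σ = 1)
    (h₁ : Tendsto N₁ atTop atTop) (h₂ : Tendsto N₂ atTop atTop)
    (h₁₂ : ∀ᶠ n in atTop, σ * N₁ n ≤ N₂ n)
    (hr : Tendsto (fun n => σ * N₁ n / N₂ n) atTop (𝓝 r)) (hu : u.2 ≠ 0) (hu' : u.2 ≠ t.2) :
    Tendsto (fun n => scaledRay σ γ (N₁ n) (N₂ n) t u) atTop (𝓝 (rayKernel γ r t u)) := by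
  have h : Tendsto (fun n => ∫ v, rayIntegrand σ γ (N₁ n) (N₂ n) t u v) atTop
      (𝓝 (rayKernel γ r t u)) := by
    refine tendsto_integral_filter_of_dominated_convergence
      (fun v => posPow γ v * ind (u.1 + v) (t.1 + 2))
      (Eventually.of_forall fun n => measurable_rayIntegrand.aestronglyMeasurable) ?_
      (integrable_posPow_mul_ind hγ1 _ _) ?_
    · filter_upwards [h₁.eventually_ge_atTop 1, h₂.eventually_ge_atTop 1, h₁₂] with n a b c
      refine Eventually.of_forall fun v => ?_
      rw [Real.norm_of_nonneg (rayIntegrand_nonneg (by linarith) v)]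
      refine (rayIntegrand_le hγ hσ a b c v).trans ?_
      exact mul_le_of_le_one_right (mul_nonneg (posPow_nonneg _ _) (ind_nonneg _ _))
        (ind_le_one _ _)
    -- When `r = 0` the second coordinate does not move with `v`, so the boundary values of `u.2`
    -- must be excluded beforehand; otherwise a single `v` is lost.
    · have hne : ∀ c : ℝ, u.2 ≠ c → ∀ᵐ v : ℝ, u.2 + r * v ≠ c := by
        intro c hc
        rcases eq_or_ne r 0 with rfl | hr0
        · simpa using hc
        · filter_upwards [Measure.ae_ne volume ((c - u.2) / r)] with v hv h
          exact hv (by rw [← h]; field_simp; ring)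
      filter_upwards [Measure.ae_ne volume (0 : ℝ), Measure.ae_ne volume (-u.1),
        Measure.ae_ne volume (t.1 - u.1), hne 0 hu, hne t.2 hu'] with v c1 c2 c3 c4 c5
      refine tendsto_rayIntegrand h₁ h₂ hr c1 (fun h => c2 ?_) (fun h => c3 ?_) c4 c5 <;> linarith
  refine h.congr' ?_
  filter_upwards [h₁.eventually_gt_atTop 0] with n hn
  rw [scaledRay_eq_integral hn]

end Limit

/-! ### Convergence of the scaled ray coefficients in `L^α` -/

section LpConvergence

variable {α γ r : ℝ} {t : ℝ≥0 × ℝ≥0}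

theorem measurable_slab : Measurable (slab t r) :=
  (measurable_ind _).comp (by fun_prop)

theorem measurable_dominating (hγ : γ < 1) : Measurable (dominating γ t r) :=
  ((continuous_H hγ _).measurable.comp measurable_fst).mul measurable_slab

/-- For each first coordinate the section of the slab is an interval of length `t₁ + 1 + (t₂ + 1)`,
whatever the slope, so the right side is free of `r`. This is what permits dominating functions
whose slope varies with `n`. -/
theorem lintegral_dominating (hα : 0 < α) (hγ : γ < 1) (r : ℝ) :
    ∫⁻ u, ‖dominating γ t r u‖ₑ ^ α =
      (∫⁻ x, ‖H γ x (t.1 + 2)‖ₑ ^ α) * ENNReal.ofReal (t.1 + 1 + (t.2 + 1)) := by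
  have hH : Measurable (fun x => ‖H γ x (t.1 + 2)‖ₑ ^ α) :=
    ((continuous_H hγ _).measurable.enorm).pow_const _
  rw [Measure.volume_eq_prod, lintegral_prod _
    ((measurable_dominating hγ).enorm.pow_const _).aemeasurable, ← lintegral_mul_const _ hH]
  refine lintegral_congr fun x => ?_
  have h1 : ∀ y : ℝ, ‖dominating γ t r (x, y)‖ₑ ^ α = ‖H γ x (t.1 + 2)‖ₑ ^ α *
      (Set.Icc (r * x - (t.1 + 1)) (r * x + (t.2 + 1))).indicator (fun _ => (1 : ℝ≥0∞)) y := by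
    intro y
    rw [dominating, enorm_mul, ENNReal.mul_rpow_of_nonneg _ _ hα.le]
    congr 1
    simp only [slab, ind, Set.indicator, Set.mem_Icc]
    have : 0 ≤ y - r * x + (t.1 + 1) ∧ y - r * x + (t.1 + 1) ≤ (t.1 + 1 + (t.2 + 1) : ℝ) ↔
        r * x - (t.1 + 1) ≤ y ∧ y ≤ r * x + (t.2 + 1) := by
      constructor <;> rintro ⟨a, b⟩ <;> constructor <;> linarith
    simp only [this]
    split_ifs <;> simp [hα]
  simp only [h1]
  rw [lintegral_const_mul _ (measurable_const.indicator measurableSet_Icc),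
    lintegral_indicator measurableSet_Icc, setLIntegral_const, one_mul, Real.volume_Icc]
  congr 2
  ring

theorem lintegral_dominating_ne_top (hα : 0 < α) (h0 : 0 < γ) (hγ : γ < 1) (hαγ : 1 < α * γ) :
    (∫⁻ x, ‖H γ x (t.1 + 2)‖ₑ ^ α) * ENNReal.ofReal (t.1 + 1 + (t.2 + 1)) ≠ ∞ := by
  refine ENNReal.mul_ne_top ?_ ENNReal.ofReal_ne_top
  rw [lintegral_enorm_rpow_eq hα]
  exact ENNReal.rpow_ne_top_of_nonneg hα.le
    (memLp_H hα h0 hγ hαγ (t := (t.1 : ℝ) + 2) (by positivity)).2.ne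

theorem memLp_dominating (hα : 0 < α) (h0 : 0 < γ) (hγ : γ < 1) (hαγ : 1 < α * γ) (r : ℝ) :
    MemLp (dominating γ t r) (ENNReal.ofReal α) volume := by
  refine ⟨(measurable_dominating hγ).aestronglyMeasurable, ?_⟩
  rw [eLpNorm_ofReal_eq hα, lintegral_dominating hα hγ]
  exact (ENNReal.rpow_lt_top_of_nonneg (by positivity)
    (lintegral_dominating_ne_top hα h0 hγ hαγ))

theorem tendsto_ind {y : ℕ → ℝ} {z T : ℝ} (h : Tendsto y atTop (𝓝 z)) (h0 : z ≠ 0) (hT : z ≠ T) :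
    Tendsto (fun n => ind (y n) T) atTop (𝓝 (ind z T)) := by
  have e1 := eventually_nonneg_iff_of_tendsto_div (y := y) (N := fun _ => 1) (by simp)
    (by simpa using h) h0
  have e2 := eventually_nonneg_iff_of_tendsto_div (y := fun n => T - y n) (N := fun _ => 1)
    (by simp) (by simpa using tendsto_const_nhds (x := T).sub h) (sub_ne_zero.2 hT.symm)
  refine tendsto_const_nhds.congr' ?_
  filter_upwards [e1, e2] with n a b
  rw [sub_nonneg, sub_nonneg] at b
  simp only [ind, a, b]

theorem tendsto_dominating {R : ℕ → ℝ} (hR : Tendsto R atTop (𝓝 r)) :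
    ∀ᵐ u, Tendsto (fun n => dominating γ t (R n) u) atTop (𝓝 (dominating γ t r u)) := by
  filter_upwards [ae_line_ne r (-(t.1 + 1)), ae_line_ne r (t.2 + 1)] with u h1 h2
  refine Tendsto.const_mul _ (tendsto_ind ?_ (fun h => h1 ?_) (fun h => h2 ?_))
  · exact (tendsto_const_nhds.sub (hR.mul_const _)).add_const _
  · linarith
  · linarith

variable {σ : ℤ} {N₁ N₂ : ℕ → ℝ}

theorem dominating_nonneg (hγ : γ < 1) (u : ℝ × ℝ) : 0 ≤ dominating γ t r u :=
  mul_nonneg (H_nonneg hγ _ (by positivity)) (ind_nonneg _ _)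

theorem memLp_scaledRay {n₁ n₂ : ℝ} (hα : 0 < α) (h0 : 0 < γ) (hγ : γ < 1) (hαγ : 1 < α * γ)
    (hσ : σ = 0 ∨ σ = 1) (h₁ : 1 ≤ n₁) (h₂ : 1 ≤ n₂) (h₁₂ : σ * n₁ ≤ n₂) :
    MemLp (scaledRay σ γ n₁ n₂ t) (ENNReal.ofReal α) volume := by
  refine (memLp_dominating hα h0 hγ hαγ (σ * n₁ / n₂) (t := t)).mono
    measurable_scaledRay.aestronglyMeasurable (Eventually.of_forall fun u => ?_)
  rw [Real.norm_of_nonneg (scaledRay_nonneg (by linarith)),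
    Real.norm_of_nonneg (dominating_nonneg hγ u)]
  exact scaledRay_le h0 hγ hσ h₁ h₂ h₁₂

theorem ae_tendsto_scaledRay (h0 : 0 < γ) (hγ : γ < 1) (hσ : σ = 0 ∨ σ = 1)
    (h₁ : Tendsto N₁ atTop atTop) (h₂ : Tendsto N₂ atTop atTop)
    (h₁₂ : ∀ᶠ n in atTop, σ * N₁ n ≤ N₂ n)
    (hr : Tendsto (fun n => σ * N₁ n / N₂ n) atTop (𝓝 r)) :
    ∀ᵐ u, Tendsto (fun n => scaledRay σ γ (N₁ n) (N₂ n) t u) atTop (𝓝 (rayKernel γ r t u)) := by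
  filter_upwards [ae_line_ne 0 0, ae_line_ne 0 t.2] with u hu hu'
  simp only [zero_mul, sub_zero] at hu hu'
  exact tendsto_scaledRay h0 hγ hσ h₁ h₂ h₁₂ hr hu hu'

/-- Measurability and the bound by `dominating` are inherited from the approximants, which is why
sequences `N₁`, `N₂` enter a statement about `r` alone. -/
theorem memLp_rayKernel (hα : 0 < α) (h0 : 0 < γ) (hγ : γ < 1) (hαγ : 1 < α * γ)
    (hσ : σ = 0 ∨ σ = 1) (h₁ : Tendsto N₁ atTop atTop) (h₂ : Tendsto N₂ atTop atTop)
    (h₁₂ : ∀ᶠ n in atTop, σ * N₁ n ≤ N₂ n)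
    (hr : Tendsto (fun n => σ * N₁ n / N₂ n) atTop (𝓝 r)) :
    MemLp (rayKernel γ r t) (ENNReal.ofReal α) volume ∧
      ∀ᵐ u, 0 ≤ rayKernel γ r t u ∧ rayKernel γ r t u ≤ dominating γ t r u := by
  have hlim := ae_tendsto_scaledRay (t := t) h0 hγ hσ h₁ h₂ h₁₂ hr
  have hb : ∀ᵐ u, 0 ≤ rayKernel γ r t u ∧ rayKernel γ r t u ≤ dominating γ t r u := by
    filter_upwards [hlim, tendsto_dominating (γ := γ) (t := t) hr] with u a b
    refine ⟨ge_of_tendsto a ?_, le_of_tendsto_of_tendsto a b ?_⟩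
    · filter_upwards [h₁.eventually_gt_atTop 0] with n hn using scaledRay_nonneg hn
    · filter_upwards [h₁.eventually_ge_atTop 1, h₂.eventually_ge_atTop 1, h₁₂] with n c d e
      exact scaledRay_le h0 hγ hσ c d e
  refine ⟨(memLp_dominating hα h0 hγ hαγ r (t := t)).mono (aestronglyMeasurable_of_tendsto_ae atTop
    (fun n => measurable_scaledRay.aestronglyMeasurable) hlim) ?_, hb⟩
  filter_upwards [hb] with u hu
  rw [Real.norm_of_nonneg hu.1, Real.norm_of_nonneg (dominating_nonneg hγ u)]
  exact hu.2

theorem tendsto_eLpNorm_scaledRay (hα : 1 ≤ α) (h0 : 0 < γ) (hγ : γ < 1) (hαγ : 1 < α * γ)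
    (hσ : σ = 0 ∨ σ = 1) (h₁ : Tendsto N₁ atTop atTop) (h₂ : Tendsto N₂ atTop atTop)
    (h₁₂ : ∀ᶠ n in atTop, σ * N₁ n ≤ N₂ n)
    (hr : Tendsto (fun n => σ * N₁ n / N₂ n) atTop (𝓝 r)) :
    Tendsto (fun n => eLpNorm (scaledRay σ γ (N₁ n) (N₂ n) t - rayKernel γ r t)
      (ENNReal.ofReal α) volume) atTop (𝓝 0) := by
  have hα0 : 0 < α := by linarith
  obtain ⟨hK, hKb⟩ := memLp_rayKernel (t := t) hα0 h0 hγ hαγ hσ h₁ h₂ h₁₂ hr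
  have hlim := ae_tendsto_scaledRay (t := t) h0 hγ hσ h₁ h₂ h₁₂ hr
  set C := (∫⁻ x, ‖H γ x (t.1 + 2)‖ₑ ^ α) * ENNReal.ofReal (t.1 + 1 + (t.2 + 1))
  have hC : C ≠ ∞ := lintegral_dominating_ne_top hα0 h0 hγ hαγ
  -- The convexity constant in `(x + y) ^ α ≤ 2 ^ (α - 1) * (x ^ α + y ^ α)`.
  let c : ℝ≥0∞ := 2 ^ (α - 1)
  have hc : c ≠ ∞ := by simp [c, ENNReal.rpow_eq_top_iff]
  have hmD : ∀ r : ℝ, Measurable (fun u => ‖dominating γ t r u‖ₑ ^ α) := fun r =>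
    (measurable_dominating hγ).enorm.pow_const _
  have hint : ∀ r₁ r₂ : ℝ, ∫⁻ u, c * (‖dominating γ t r₁ u‖ₑ ^ α + ‖dominating γ t r₂ u‖ₑ ^ α)
      = c * (C + C) := by
    intro r₁ r₂
    rw [lintegral_const_mul' _ _ hc, lintegral_add_left (hmD _), lintegral_dominating hα0 hγ,
      lintegral_dominating hα0 hγ]
  have key : Tendsto (fun n => ∫⁻ u, ‖scaledRay σ γ (N₁ n) (N₂ n) t u - rayKernel γ r t u‖ₑ ^ α)
      atTop (𝓝 0) := by
    refine tendsto_lintegral_zero_of_dominated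
      (D := fun n u => c * (‖dominating γ t (σ * N₁ n / N₂ n) u‖ₑ ^ α
        + ‖dominating γ t r u‖ₑ ^ α))
      (D' := fun u => c * (‖dominating γ t r u‖ₑ ^ α + ‖dominating γ t r u‖ₑ ^ α))
      (C := c * (C + C)) (fun n => ?_) (fun n => ?_) ?_ ?_ ?_ ?_ (fun n => ?_) ?_ ?_
    · exact (measurable_scaledRay.aestronglyMeasurable.sub hK.1).aemeasurable.enorm.pow_const _
    · exact (((hmD _).add (hmD _)).const_mul _).aemeasurable
    · exact (((hmD _).add (hmD _)).const_mul _).aemeasurable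
    · filter_upwards [h₁.eventually_ge_atTop 1, h₂.eventually_ge_atTop 1, h₁₂] with n a b d
      filter_upwards [hKb] with u hu
      have h3 : ∀ x y : ℝ, 0 ≤ x → x ≤ y → ‖x‖ₑ ≤ ‖y‖ₑ := fun x y hx hxy =>
        enorm_le_iff_norm_le.2 (by rwa [Real.norm_of_nonneg hx, Real.norm_of_nonneg
          (hx.trans hxy)])
      calc ‖scaledRay σ γ (N₁ n) (N₂ n) t u - rayKernel γ r t u‖ₑ ^ α
          ≤ (‖scaledRay σ γ (N₁ n) (N₂ n) t u‖ₑ + ‖rayKernel γ r t u‖ₑ) ^ α := by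
            gcongr
            exact enorm_sub_le
        _ ≤ c * (‖scaledRay σ γ (N₁ n) (N₂ n) t u‖ₑ ^ α + ‖rayKernel γ r t u‖ₑ ^ α) :=
            ENNReal.rpow_add_le_mul_rpow_add_rpow _ _ hα
        _ ≤ _ := by
            gcongr
            · exact h3 _ _ (scaledRay_nonneg (by linarith)) (scaledRay_le h0 hγ hσ a b d)
            · exact h3 _ _ hu.1 hu.2
    · filter_upwards [hlim] with u hu
      have h4 := ((hu.sub_const (rayKernel γ r t u)).enorm).ennrpow_const α
      simpa [hα0] using h4
    · filter_upwards [tendsto_dominating (γ := γ) (t := t) hr] with u hu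
      exact ENNReal.Tendsto.const_mul ((hu.enorm.ennrpow_const α).add tendsto_const_nhds)
        (Or.inr hc)
    · exact hint _ _
    · exact hint _ _
    · exact ENNReal.mul_ne_top hc (ENNReal.add_ne_top.2 ⟨hC, hC⟩)
  simp only [eLpNorm_ofReal_eq hα0]
  have h5 := key.ennrpow_const (1 / α)
  rw [ENNReal.zero_rpow_of_pos (by positivity)] at h5
  exact h5

end LpConvergence

/-! ### Scaling limits of lattice functions -/

/-- The lattice functions `a n`, scaled by `n` and `n ^ τ` in the two coordinates and divided by
`n ^ β`, converge to `K` in `L^α(ℝ²)`. -/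
structure HasScalingLimit (α τ : ℝ) (a : ℕ → ℤ × ℤ → ℝ) (β : ℝ) (K : ℝ × ℝ → ℝ) : Prop where
  memLp : MemLp K (ENNReal.ofReal α) volume
  eventually_memLp : ∀ᶠ n : ℕ in atTop,
    MemLp (fun u => (n : ℝ) ^ (-β) * a n (latticeMap n ((n : ℝ) ^ τ) u)) (ENNReal.ofReal α) volume
  tendsto : Tendsto (fun n : ℕ => eLpNorm
    ((fun u => (n : ℝ) ^ (-β) * a n (latticeMap n ((n : ℝ) ^ τ) u)) - K) (ENNReal.ofReal α) volume)
    atTop (𝓝 0)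

namespace HasScalingLimit

variable {α τ β : ℝ} {a b : ℕ → ℤ × ℤ → ℝ} {K L : ℝ × ℝ → ℝ}

theorem aestronglyMeasurable (c x y : ℝ) (φ : ℤ × ℤ → ℝ) :
    AEStronglyMeasurable (fun u => c * φ (latticeMap x y u)) volume :=
  (((measurable_of_countable φ).comp (measurable_latticeMap _ _)).const_mul c).aestronglyMeasurable

theorem zero : HasScalingLimit α τ (fun _ _ => 0) β (fun _ => 0) := by
  refine ⟨MemLp.zero, Eventually.of_forall fun n => ?_, ?_⟩
  · simp
  · have : ∀ n : ℕ, ((fun u : ℝ × ℝ => (n : ℝ) ^ (-β) * 0) - fun _ => (0 : ℝ)) = 0 := fun n => by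
      ext
      simp
    simp only [this, eLpNorm_zero]
    exact tendsto_const_nhds

theorem add (hα : 1 ≤ α) (h : HasScalingLimit α τ a β K) (h' : HasScalingLimit α τ b β L) :
    HasScalingLimit α τ (fun n j => a n j + b n j) β (fun u => K u + L u) := by
  refine ⟨h.memLp.add h'.memLp, ?_, ?_⟩
  · filter_upwards [h.eventually_memLp, h'.eventually_memLp] with n h1 h2
    simp only [mul_add]
    exact h1.add h2
  · have h3 := h.tendsto.add h'.tendsto
    rw [add_zero] at h3
    refine tendsto_of_tendsto_of_tendsto_of_le_of_le tendsto_const_nhds h3 (fun _ => zero_le)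
      fun n => ?_
    refine le_trans (le_of_eq ?_) (eLpNorm_add_le ((aestronglyMeasurable _ _ _ _).sub h.memLp.1)
      ((aestronglyMeasurable _ _ _ _).sub h'.memLp.1) (by simpa using hα))
    congr 1
    ext u
    simp only [Pi.sub_apply, Pi.add_apply]
    ring

theorem const_mul (h : HasScalingLimit α τ a β K) (c : ℝ) :
    HasScalingLimit α τ (fun n j => c * a n j) β (fun u => c * K u) := by
  refine ⟨h.memLp.const_mul c, ?_, ?_⟩
  · filter_upwards [h.eventually_memLp] with n h1
    simpa only [mul_left_comm] using h1.const_mul c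
  · have h3 := ENNReal.Tendsto.const_mul (a := ‖c‖ₑ) h.tendsto (Or.inr (by simp))
    rw [mul_zero] at h3
    refine h3.congr fun n => ?_
    rw [← eLpNorm_const_smul]
    congr 1
    ext u
    simp only [Pi.sub_apply, Pi.smul_apply, smul_eq_mul]
    ring

theorem finsetSum (hα : 1 ≤ α) {ι : Type*} (s : Finset ι) {a : ι → ℕ → ℤ × ℤ → ℝ}
    {K : ι → ℝ × ℝ → ℝ} (h : ∀ i ∈ s, HasScalingLimit α τ (a i) β (K i)) (θ : ι → ℝ) :
    HasScalingLimit α τ (fun n j => ∑ i ∈ s, θ i * a i n j) β (fun u => ∑ i ∈ s, θ i * K i u) := by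
  classical
  induction s using Finset.induction_on with
  | empty => simpa using zero
  | insert i s hi ih =>
    simp only [Finset.sum_insert hi]
    exact ((h i (by simp)).const_mul (θ i)).add hα (ih fun k hk => h k (by simp [hk]))

/-- The component of the field of smaller order is discarded by this lemma. -/
theorem of_lt (hα : 1 ≤ α) (h : HasScalingLimit α τ a β K) {β' : ℝ} (hβ : β < β') :
    HasScalingLimit α τ a β' (fun _ => 0) := by
  have e : ∀ᶠ n : ℕ in atTop, (fun u => (n : ℝ) ^ (-β') * a n (latticeMap n ((n : ℝ) ^ τ) u))
      = (n : ℝ) ^ (-(β' - β)) •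
        (fun u => (n : ℝ) ^ (-β) * a n (latticeMap n ((n : ℝ) ^ τ) u)) := by
    filter_upwards [eventually_gt_atTop 0] with n hn
    have hn' : (0 : ℝ) < n := by exact_mod_cast hn
    ext u
    rw [Pi.smul_apply, smul_eq_mul, ← mul_assoc, ← Real.rpow_add hn']
    congr 2
    ring
  refine ⟨MemLp.zero, ?_, ?_⟩
  · filter_upwards [e, h.eventually_memLp] with n h1 h2
    rw [h1]
    exact h2.const_smul _
  · have h1 : Tendsto (fun n : ℕ => ‖(n : ℝ) ^ (-(β' - β))‖ₑ) atTop (𝓝 0) := by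
      have := ((tendsto_rpow_neg_atTop (sub_pos.2 hβ)).comp tendsto_natCast_atTop_atTop).enorm
      simpa using this
    have h2 := tendsto_eLpNorm_of_sub (by simpa using hα)
      (fun n => aestronglyMeasurable _ _ _ _) h.memLp.1 h.tendsto
    have h3 := ENNReal.Tendsto.mul h1 (Or.inr h.memLp.2.ne) h2 (Or.inr (by simp))
    rw [zero_mul] at h3
    refine h3.congr' ?_
    filter_upwards [e] with n hn
    have : ∀ f : ℝ × ℝ → ℝ, (f - fun _ => (0 : ℝ)) = f := fun f => by
      ext
      simp
    rw [← eLpNorm_const_smul, this, hn]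

/-- A lattice cell has area `n ^ (-(1 + τ))`, which is the `α`-th power of `n ^ (-(1 + τ) / α)`. So
the discrete scale with the full normalization is exactly the `L^α` scale of the step function, and
the latter converges. -/
theorem tendsto_lpPow_count (hα : 1 ≤ α) (h : HasScalingLimit α τ a β K) :
    (∀ᶠ n : ℕ in atTop,
      ∫⁻ j, ‖((n : ℝ) ^ ((1 + τ) / α + β))⁻¹ * a n j‖ₑ ^ α ∂Measure.count ≠ ∞) ∧
    Tendsto (fun n : ℕ => lpPow α Measure.count
      (fun j => ((n : ℝ) ^ ((1 + τ) / α + β))⁻¹ * a n j)) atTop (𝓝 (lpPow α volume K)) := by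
  have hα0 : 0 < α := by linarith
  have e : ∀ᶠ n : ℕ in atTop,
      ∫⁻ j, ‖((n : ℝ) ^ ((1 + τ) / α + β))⁻¹ * a n j‖ₑ ^ α ∂Measure.count =
        ∫⁻ u, ‖(n : ℝ) ^ (-β) * a n (latticeMap n ((n : ℝ) ^ τ) u)‖ₑ ^ α := by
    filter_upwards [eventually_gt_atTop 0] with n hn
    have hn' : (0 : ℝ) < n := by exact_mod_cast hn
    have hnτ : (0 : ℝ) < (n : ℝ) ^ τ := by positivity
    rw [lintegral_comp_latticeMap hn' hnτ (fun j => ‖(n : ℝ) ^ (-β) * a n j‖ₑ ^ α),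
      ← lintegral_const_mul _ (measurable_of_countable _)]
    refine lintegral_congr fun j => ?_
    have hc : (n : ℝ) * (n : ℝ) ^ τ = (n : ℝ) ^ (1 + τ) := by
      rw [Real.rpow_add hn', Real.rpow_one]
    have h0 : (0 : ℝ) < ((n : ℝ) ^ (1 + τ))⁻¹ := by positivity
    have h1 : ENNReal.ofReal (((n : ℝ) * (n : ℝ) ^ τ)⁻¹)
        = ‖(n : ℝ) ^ (-((1 + τ) / α))‖ₑ ^ α := by
      rw [hc, Real.enorm_eq_ofReal (by positivity), ENNReal.ofReal_rpow_of_nonneg (by positivity)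
        hα0.le, ← Real.rpow_mul hn'.le, ← Real.rpow_neg hn'.le]
      congr 2
      field_simp
    rw [h1, ← ENNReal.mul_rpow_of_nonneg _ _ hα0.le, ← enorm_mul, ← mul_assoc,
      ← Real.rpow_add hn', ← Real.rpow_neg hn'.le, neg_add]
  constructor
  · filter_upwards [e, h.eventually_memLp] with n h1 h2
    rw [h1, lintegral_enorm_rpow_eq hα0]
    exact ENNReal.rpow_ne_top_of_nonneg hα0.le h2.2.ne
  · refine (tendsto_lpPow hα (fun n => aestronglyMeasurable _ _ _ _) h.memLp h.tendsto).congr' ?_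
    filter_upwards [e] with n h1
    rw [lpPow, lpPow, h1]

end HasScalingLimit

/-! ### Scaling limits of the two components of the field -/

section Components

variable {α γ τ : ℝ}

theorem tendsto_natCast_rpow (hτ : 0 < τ) : Tendsto (fun n : ℕ => (n : ℝ) ^ τ) atTop atTop :=
  (tendsto_rpow_atTop hτ).comp tendsto_natCast_atTop_atTop

theorem hasScalingLimit_of_scaledRay {σ : ℤ} {r : ℝ} {t : ℝ≥0 × ℝ≥0} {T₁ T₂ : ℕ → ℕ}
    (hT₁ : ∀ n : ℕ, T₁ n = ⌊(n : ℝ) * (t.1 : ℝ)⌋₊)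
    (hT₂ : ∀ n : ℕ, T₂ n = ⌊(n : ℝ) ^ τ * (t.2 : ℝ)⌋₊) (hα : 1 ≤ α) (h0 : 0 < γ) (hγ : γ < 1)
    (hαγ : 1 < α * γ) (hσ : σ = 0 ∨ σ = 1) (hτ : 0 < τ)
    (h₁₂ : ∀ᶠ n : ℕ in atTop, σ * (n : ℝ) ≤ (n : ℝ) ^ τ)
    (hr : Tendsto (fun n : ℕ => σ * (n : ℝ) / (n : ℝ) ^ τ) atTop (𝓝 r)) :
    HasScalingLimit α τ (fun n => rayCoeff σ γ (T₁ n) (T₂ n)) (1 - γ) (rayKernel γ r t) := by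
  have hα0 : 0 < α := by linarith
  have t1 := tendsto_natCast_atTop_atTop (R := ℝ)
  have t2 := tendsto_natCast_rpow hτ
  have e : ∀ n : ℕ, (fun u => (n : ℝ) ^ (-(1 - γ)) *
      rayCoeff σ γ (T₁ n) (T₂ n) (latticeMap n ((n : ℝ) ^ τ) u))
        = scaledRay σ γ n ((n : ℝ) ^ τ) t := by
    intro n
    ext u
    rw [scaledRay, neg_sub, hT₁, hT₂]
  refine ⟨(memLp_rayKernel hα0 h0 hγ hαγ hσ t1 t2 h₁₂ hr).1, ?_, ?_⟩
  · filter_upwards [t1.eventually_ge_atTop 1, t2.eventually_ge_atTop 1, h₁₂] with n a b c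
    rw [e]
    exact memLp_scaledRay hα0 h0 hγ hαγ hσ a b c
  · simp only [e]
    exact tendsto_eLpNorm_scaledRay hα h0 hγ hαγ hσ t1 t2 h₁₂ hr

theorem hasScalingLimit_horizontal (hα : 1 ≤ α) (h0 : 0 < γ) (hγ : γ < 1)
    (hαγ : 1 < α * γ) (hτ : 0 < τ) (t : ℝ≥0 × ℝ≥0) :
    HasScalingLimit α τ
      (fun n => rayCoeff 0 γ ⌊(n : ℝ) * (t.1 : ℝ)⌋₊ ⌊(n : ℝ) ^ τ * (t.2 : ℝ)⌋₊) (1 - γ)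
      (fun u => H γ u.1 t.1 * ind u.2 t.2) := by
  have h := hasScalingLimit_of_scaledRay (σ := 0) (r := 0) (t := t) (fun _ => rfl) (fun _ => rfl)
    hα h0 hγ hαγ (Or.inl rfl) hτ (by
      refine Eventually.of_forall fun n => ?_
      push_cast
      rw [zero_mul]
      positivity) (by simp)
  have e : rayKernel γ 0 t = fun u => H γ u.1 t.1 * ind u.2 t.2 := funext (rayKernel_zero hγ t)
  rwa [e] at h

/-- The scaling limit of the diagonal component. -/
noncomputable def diagLimit (γ τ : ℝ) (t : ℝ≥0 × ℝ≥0) (u : ℝ × ℝ) : ℝ :=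
  if τ < 1 then ind u.1 t.1 * H γ u.2 t.2
  else if τ = 1 then diagKernel γ t.1 t.2 u.1 u.2
  else H γ u.1 t.1 * ind u.2 t.2

theorem tendsto_eLpNorm_comp_swap {F : ℕ → ℝ × ℝ → ℝ} {K : ℝ × ℝ → ℝ} {p : ℝ≥0∞}
    (hF : ∀ n, AEStronglyMeasurable (F n) volume) (hK : AEStronglyMeasurable K volume)
    (h : Tendsto (fun n => eLpNorm (F n - K) p volume) atTop (𝓝 0)) :
    Tendsto (fun n => eLpNorm ((fun u : ℝ × ℝ => F n u.swap) - fun u => K u.swap) p volume) atTop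
      (𝓝 0) := by
  refine h.congr fun n => ?_
  exact (eLpNorm_comp_measurePreserving ((hF n).sub hK) (Measure.measurePreserving_swap
    (μ := (volume : Measure ℝ)) (ν := (volume : Measure ℝ)))).symm

/-- For `τ < 1` the coordinates are exchanged, so that the ray is always parametrized by the shorter
side, of order `n ^ min τ 1`. The rescaled slope is then the ratio of the shorter to the longer
side: it tends to `0` for `τ ≠ 1` and equals `1` for `τ = 1`. -/
theorem hasScalingLimit_diagonal (hα : 1 ≤ α) (h0 : 0 < γ) (hγ : γ < 1)
    (hαγ : 1 < α * γ) (hτ : 0 < τ) (t : ℝ≥0 × ℝ≥0) :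
    HasScalingLimit α τ
      (fun n => rayCoeff 1 γ ⌊(n : ℝ) * (t.1 : ℝ)⌋₊ ⌊(n : ℝ) ^ τ * (t.2 : ℝ)⌋₊)
      (min τ 1 * (1 - γ)) (diagLimit γ τ t) := by
  have hα0 : 0 < α := by linarith
  have ratio : ∀ᶠ n : ℕ in atTop, (n : ℝ) / (n : ℝ) ^ τ = (n : ℝ) ^ (-(τ - 1)) := by
    filter_upwards [eventually_gt_atTop 0] with n hn
    have hn' : (0 : ℝ) < n := by exact_mod_cast hn
    rw [neg_sub, Real.rpow_sub hn', Real.rpow_one]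
  rcases lt_or_ge τ 1 with hτ1 | hτ1
  · have t1 := tendsto_natCast_atTop_atTop (R := ℝ)
    have t2 := tendsto_natCast_rpow hτ
    have hle : ∀ᶠ n : ℕ in atTop, ((1 : ℤ) : ℝ) * (n : ℝ) ^ τ ≤ (n : ℝ) := by
      filter_upwards [eventually_ge_atTop 1] with n hn
      have hn' : (1 : ℝ) ≤ n := by exact_mod_cast hn
      push_cast
      rw [one_mul]
      calc (n : ℝ) ^ τ ≤ (n : ℝ) ^ (1 : ℝ) := Real.rpow_le_rpow_of_exponent_le hn' hτ1.le
        _ = n := Real.rpow_one _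
    have hr : Tendsto (fun n : ℕ => ((1 : ℤ) : ℝ) * (n : ℝ) ^ τ / (n : ℝ)) atTop (𝓝 0) := by
      have h := (tendsto_rpow_neg_atTop (sub_pos.2 hτ1)).comp (tendsto_natCast_atTop_atTop (R := ℝ))
      refine h.congr' ?_
      filter_upwards [eventually_gt_atTop 0] with n hn
      have hn' : (0 : ℝ) < n := by exact_mod_cast hn
      push_cast
      rw [Function.comp_apply, neg_sub, Real.rpow_sub hn', Real.rpow_one, one_mul]
    have e : ∀ᶠ n : ℕ in atTop, (fun u => (n : ℝ) ^ (-(min τ 1 * (1 - γ))) *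
        rayCoeff 1 γ ⌊(n : ℝ) * (t.1 : ℝ)⌋₊ ⌊(n : ℝ) ^ τ * (t.2 : ℝ)⌋₊
          (latticeMap n ((n : ℝ) ^ τ) u))
          = fun u => scaledRay 1 γ ((n : ℝ) ^ τ) n t.swap u.swap := by
      filter_upwards [eventually_gt_atTop 0] with n hn
      have hn' : (0 : ℝ) < n := by exact_mod_cast hn
      ext u
      rw [scaledRay, rayCoeff_one_swap, min_eq_left hτ1.le, ← Real.rpow_mul hn'.le]
      congr 2
      ring
    have eK : diagLimit γ τ t = fun u => rayKernel γ 0 t.swap u.swap := by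
      ext u
      rw [rayKernel_zero hγ, diagLimit, if_pos hτ1, mul_comm]
      rfl
    have hK := (memLp_rayKernel (t := t.swap) hα0 h0 hγ hαγ (Or.inr rfl) t2 t1 hle hr).1
    have swapMP : MeasurePreserving (Prod.swap : ℝ × ℝ → ℝ × ℝ) volume volume :=
      Measure.measurePreserving_swap
    rw [eK]
    refine ⟨hK.comp_measurePreserving swapMP, ?_, ?_⟩
    · filter_upwards [e, t1.eventually_ge_atTop 1, t2.eventually_ge_atTop 1, hle] with n h1 a b c
      rw [h1]
      exact (memLp_scaledRay hα0 h0 hγ hαγ (Or.inr rfl) b a c).comp_measurePreserving swapMP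
    · refine (tendsto_eLpNorm_comp_swap (fun n => measurable_scaledRay.aestronglyMeasurable) hK.1
        (tendsto_eLpNorm_scaledRay (t := t.swap) hα h0 hγ hαγ (Or.inr rfl) t2 t1 hle hr)).congr' ?_
      filter_upwards [e] with n h1
      rw [h1]
  · have hle : ∀ᶠ n : ℕ in atTop, ((1 : ℤ) : ℝ) * (n : ℝ) ≤ (n : ℝ) ^ τ := by
      filter_upwards [eventually_ge_atTop 1] with n hn
      have hn' : (1 : ℝ) ≤ n := by exact_mod_cast hn
      push_cast
      rw [one_mul]
      calc (n : ℝ) = (n : ℝ) ^ (1 : ℝ) := (Real.rpow_one _).symm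
        _ ≤ (n : ℝ) ^ τ := Real.rpow_le_rpow_of_exponent_le hn' hτ1
    rw [min_eq_right hτ1, one_mul]
    rcases hτ1.eq_or_lt with rfl | hτ1
    · have eK : diagLimit γ 1 t = rayKernel γ 1 t := by
        ext u
        rw [rayKernel_one hγ, diagLimit, if_neg (lt_irrefl _), if_pos rfl]
      rw [eK]
      refine hasScalingLimit_of_scaledRay (fun _ => rfl) (fun _ => rfl) hα h0 hγ hαγ (Or.inr rfl)
        hτ hle (tendsto_const_nhds.congr' ?_)
      filter_upwards [ratio] with n hn
      push_cast
      rw [one_mul, hn]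
      simp
    · have eK : diagLimit γ τ t = rayKernel γ 0 t := by
        ext u
        rw [rayKernel_zero hγ, diagLimit, if_neg hτ1.not_gt, if_neg hτ1.ne']
      rw [eK]
      have h := (tendsto_rpow_neg_atTop (sub_pos.2 hτ1)).comp (tendsto_natCast_atTop_atTop (R := ℝ))
      refine hasScalingLimit_of_scaledRay (fun _ => rfl) (fun _ => rfl) hα h0 hγ hαγ (Or.inr rfl)
        hτ hle (h.congr' ?_)
      filter_upwards [ratio] with n hn
      push_cast
      rw [one_mul, hn, Function.comp_apply]

end Components

/-! ### Convergence of the partial sums -/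

section Limit

variable {α γ₁ γ₂ τ : ℝ}

/-- The exponent of the normalization, up to `(1 + τ) / α`. -/
noncomputable def limitExponent (γ₁ γ₂ τ : ℝ) : ℝ :=
  if τ < tauZero γ₁ γ₂ then 1 - γ₁ else if τ ≤ 1 then τ * (1 - γ₂) else 1 - γ₂

theorem normalization_eq (n : ℕ) :
    normalization α γ₁ γ₂ τ n = (n : ℝ) ^ ((1 + τ) / α + limitExponent γ₁ γ₂ τ) := by
  unfold normalization limitExponent
  split_ifs <;> simp only [add_sub_assoc]

theorem limitExponent_pos (hγ₁ : γ₁ < 1) (hγ₂ : γ₂ < 1) (hτ : 0 < τ) :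
    0 < limitExponent γ₁ γ₂ τ := by
  unfold limitExponent
  split_ifs
  · linarith
  · exact mul_pos hτ (by linarith)
  · linarith

theorem tauZero_pos (hγ₁ : γ₁ < 1) (hγ₂ : γ₂ < 1) : 0 < tauZero γ₁ γ₂ :=
  div_pos (by linarith) (by linarith)

theorem tauZero_le_one (hγ₂ : γ₂ < 1) (h : γ₂ ≤ γ₁) : tauZero γ₁ γ₂ ≤ 1 := by
  rw [tauZero, div_le_one (by linarith)]
  linarith

theorem tauZero_lt_one (hγ₂ : γ₂ < 1) (h : γ₂ < γ₁) : tauZero γ₁ γ₂ < 1 := by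
  rw [tauZero, div_lt_one (by linarith)]
  linarith

theorem limitKernel_of_lt {t : ℝ≥0 × ℝ≥0} {u : ℝ × ℝ} (h : τ < tauZero γ₁ γ₂) :
    limitKernel γ₁ γ₂ τ t u = H γ₁ u.1 t.1 * ind u.2 t.2 := if_pos h

theorem limitKernel_of_gt {t : ℝ≥0 × ℝ≥0} {u : ℝ × ℝ} (h : tauZero γ₁ γ₂ < τ) :
    limitKernel γ₁ γ₂ τ t u = diagLimit γ₂ τ t u := by
  rw [limitKernel, if_neg h.not_gt, if_neg h.ne', diagLimit]

theorem limitKernel_tauZero {t : ℝ≥0 × ℝ≥0} {u : ℝ × ℝ} :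
    limitKernel γ₁ γ₂ (tauZero γ₁ γ₂) t u =
      ind u.2 t.2 * H γ₁ u.1 t.1 + ind u.1 t.1 * H γ₂ u.2 t.2 := by
  rw [limitKernel, if_neg (lt_irrefl _), if_pos rfl]

theorem memLp_limitKernel (hα : 1 ≤ α) (h₁ : 0 < γ₁) (hγ₁ : γ₁ < 1) (h₂ : 0 < γ₂) (hγ₂ : γ₂ < 1)
    (hαγ₁ : 1 < α * γ₁) (hαγ₂ : 1 < α * γ₂) (hτ : 0 < τ) (t : ℝ≥0 × ℝ≥0) :
    MemLp (limitKernel γ₁ γ₂ τ t) (ENNReal.ofReal α) volume := by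
  have hor := (hasScalingLimit_horizontal hα h₁ hγ₁ hαγ₁ one_pos t).memLp
  have diag := fun τ (hτ : 0 < τ) => (hasScalingLimit_diagonal hα h₂ hγ₂ hαγ₂ hτ t).memLp
  rcases lt_trichotomy τ (tauZero γ₁ γ₂) with h | rfl | h
  · rwa [show limitKernel γ₁ γ₂ τ t = _ from funext fun u => limitKernel_of_lt h]
  -- Any exponent below `1` yields the kernel `ind * H`. The value `τ₀` itself would not do, as `τ₀
  -- < 1` is not assumed here.
  · have hd := diag (1 / 2) (by norm_num)
    refine (hor.add hd).ae_eq (Eventually.of_forall fun u => ?_)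
    rw [limitKernel_tauZero, Pi.add_apply, diagLimit, if_pos (by norm_num), mul_comm (ind u.2 _)]
  · rw [show limitKernel γ₁ γ₂ τ t = _ from funext fun u => limitKernel_of_gt h]
    exact diag τ hτ

/-- The exponents `1 - γ₁` and `min τ 1 * (1 - γ₂)` are compared; they cross at `τ₀`, where both
components survive. If `γ₂ = γ₁` they would coincide for every `τ ≥ 1`, and neither component would
be negligible; `hτγ` excludes this. -/
theorem hasScalingLimit_partialSum (hα : 1 ≤ α) (h₁ : 0 < γ₁) (hγ₁ : γ₁ < 1) (h₂ : 0 < γ₂)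
    (hγ₂ : γ₂ < 1) (hαγ₁ : 1 < α * γ₁) (hαγ₂ : 1 < α * γ₂) (hγ : γ₂ ≤ γ₁) (hτ : 0 < τ)
    (hτγ : τ < tauZero γ₁ γ₂ ∨ γ₂ < γ₁) (t : ℝ≥0 × ℝ≥0) :
    HasScalingLimit α τ (fun n j =>
      rayCoeff 0 γ₁ ⌊(n : ℝ) * (t.1 : ℝ)⌋₊ ⌊(n : ℝ) ^ τ * (t.2 : ℝ)⌋₊ j +
        rayCoeff 1 γ₂ ⌊(n : ℝ) * (t.1 : ℝ)⌋₊ ⌊(n : ℝ) ^ τ * (t.2 : ℝ)⌋₊ j)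
      (limitExponent γ₁ γ₂ τ) (limitKernel γ₁ γ₂ τ t) := by
  have hor := hasScalingLimit_horizontal hα h₁ hγ₁ hαγ₁ hτ t
  have diag := hasScalingLimit_diagonal hα h₂ hγ₂ hαγ₂ hτ t
  have hpos : 0 < 1 - γ₂ := by linarith
  rcases lt_trichotomy τ (tauZero γ₁ γ₂) with h | h | h
  · have hτ1 : τ < 1 := h.trans_le (tauZero_le_one hγ₂ hγ)
    have hlt : min τ 1 * (1 - γ₂) < 1 - γ₁ := by
      rw [min_eq_left hτ1.le]
      rwa [tauZero, lt_div_iff₀ hpos] at h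
    have := hor.add hα (diag.of_lt hα hlt)
    rw [limitExponent, if_pos h,
      show limitKernel γ₁ γ₂ τ t = _ from funext fun u => limitKernel_of_lt h]
    simpa only [add_zero] using this
  · have hγ' : γ₂ < γ₁ := hτγ.resolve_left h.not_lt
    have hτ1 : τ < 1 := h ▸ tauZero_lt_one hγ₂ hγ'
    have heq : 1 - γ₁ = min τ 1 * (1 - γ₂) := by
      rw [min_eq_left hτ1.le, h, tauZero, div_mul_cancel₀ _ hpos.ne']
    rw [heq] at hor
    have := hor.add hα diag
    have e : limitExponent γ₁ γ₂ τ = min τ 1 * (1 - γ₂) := by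
      rw [limitExponent, if_neg h.not_lt, if_pos hτ1.le, min_eq_left hτ1.le]
    have eK : limitKernel γ₁ γ₂ τ t
        = fun u => H γ₁ u.1 t.1 * ind u.2 t.2 + diagLimit γ₂ τ t u := by
      ext u
      rw [diagLimit, if_pos hτ1, limitKernel, if_neg h.not_lt, if_pos h, mul_comm (ind u.2 _)]
    rwa [e, eK]
  · have hlt : 1 - γ₁ < min τ 1 * (1 - γ₂) := by
      rcases le_total τ 1 with h' | h'
      · rw [min_eq_left h']
        rwa [tauZero, div_lt_iff₀ hpos] at h
      · have hγ' : γ₂ < γ₁ := hτγ.resolve_left h.not_gt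
        rw [min_eq_right h', one_mul]
        linarith
    have := (hor.of_lt hα hlt).add hα diag
    have e : limitExponent γ₁ γ₂ τ = min τ 1 * (1 - γ₂) := by
      rw [limitExponent, if_neg h.not_gt]
      split_ifs with h'
      · rw [min_eq_left h']
      · rw [min_eq_right (not_le.1 h').le, one_mul]
    rw [e, show limitKernel γ₁ γ₂ τ t = _ from funext fun u => limitKernel_of_gt h]
    simpa only [zero_add] using this

theorem tendsto_normalization (hα : 0 < α) (hγ₁ : γ₁ < 1) (hγ₂ : γ₂ < 1) (hτ : 0 < τ) :
    Tendsto (normalization α γ₁ γ₂ τ) atTop atTop := by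
  have hp : 0 < (1 + τ) / α + limitExponent γ₁ γ₂ τ :=
    add_pos (by positivity) (limitExponent_pos hγ₁ hγ₂ hτ)
  exact (tendsto_natCast_rpow hp).congr fun n => (normalization_eq n).symm

end Limit

/-! ### From convergence of kernels to convergence of finite-dimensional distributions -/

section Convergence

variable {Ω Ω' : Type*} [MeasurableSpace Ω] [MeasurableSpace Ω'] {P : Measure Ω}
  [IsProbabilityMeasure P] {P' : Measure Ω'} [IsProbabilityMeasure P'] {α γ₁ γ₂ τ : ℝ}
  {ξ X : ℤ × ℤ → Ω → ℝ} {M : Set (ℝ × ℝ) → Ω' → ℝ}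

theorem convergesFDD_partialSum (hα : 1 ≤ α) (h₁ : 0 < γ₁) (hγ₁ : γ₁ < 1) (h₂ : 0 < γ₂)
    (hγ₂ : γ₂ < 1) (hαγ₁ : 1 < α * γ₁) (hαγ₂ : 1 < α * γ₂) (hγ : γ₂ ≤ γ₁) (hτ : 0 < τ)
    (hτγ : τ < tauZero γ₁ γ₂ ∨ γ₂ < γ₁) (hξ : IsStableNoise P α ξ)
    (hM : IsStableRandomMeasure P' α M) (hX : IsLinearField P (diagFilter γ₁ γ₂) ξ X)
    {V : ℝ≥0 × ℝ≥0 → Ω' → ℝ}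
    (hV : ∀ t, IsStableIntegral P' α M (limitKernel γ₁ γ₂ τ t) (V t)) :
    ConvergesFDD P (fun n t ω => (normalization α γ₁ γ₂ τ n)⁻¹ *
      partialSum X (n : ℝ) ((n : ℝ) ^ τ) t ω) P' V := by
  have hα0 : 0 < α := by linarith
  refine convergesFDD_of_hasStableLaw (α := α)
    (fun n t => (hX.aemeasurable_partialSum _ _ t).const_mul _)
    (fun t => (hV t).aemeasurable) fun m t θ => ?_
  have hlim := HasScalingLimit.finsetSum hα Finset.univ (fun l _ =>
    hasScalingLimit_partialSum hα h₁ hγ₁ h₂ hγ₂ hαγ₁ hαγ₂ hγ hτ hτγ (t l)) θ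
  obtain ⟨hfin, hκ⟩ := hlim.tendsto_lpPow_count hα
  refine ⟨_, _, ?_, (IsStableIntegral.finsetSum hα hM Finset.univ (fun l _ => hV (t l))
    θ).hasStableLaw hα hM, hκ⟩
  filter_upwards [hfin] with n hn
  have hs : ∀ l, IsNoiseSeries P ξ (fun j =>
      rayCoeff 0 γ₁ ⌊(n : ℝ) * ((t l).1 : ℝ)⌋₊ ⌊(n : ℝ) ^ τ * ((t l).2 : ℝ)⌋₊ j +
        rayCoeff 1 γ₂ ⌊(n : ℝ) * ((t l).1 : ℝ)⌋₊ ⌊(n : ℝ) ^ τ * ((t l).2 : ℝ)⌋₊ j)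
      (partialSum X (n : ℝ) ((n : ℝ) ^ τ) (t l)) := fun l => by
    have := hX.isNoiseSeries_partialSum (n : ℝ) ((n : ℝ) ^ τ) (t l)
    simpa only [sum_extendZero_diagFilter] using this
  have hsum := (IsNoiseSeries.finsetSum Finset.univ fun l _ => (hs l).const_mul (θ l)).const_mul
    ((n : ℝ) ^ ((1 + τ) / α + limitExponent γ₁ γ₂ τ))⁻¹
  have hlaw := hsum.hasStableLaw hα0 hξ hn
  refine hlaw.congr (Eventually.of_forall fun ω => ?_)
  simp only [normalization_eq]
  rw [Finset.mul_sum]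
  exact Finset.sum_congr rfl fun l _ => by ring

theorem sameFDD_of_kernel_eq (hα : 1 ≤ α) (hM : IsStableRandomMeasure P' α M) {T : Type*}
    {K : T → ℝ × ℝ → ℝ} {V W : T → Ω' → ℝ} (hV : ∀ t, IsStableIntegral P' α M (K t) (V t))
    (hW : ∀ t, IsStableIntegral P' α M (K t) (W t)) : SameFDD P' V W :=
  sameFDD_of_hasStableLaw (α := α) (fun t => (hV t).aemeasurable) (fun t => (hW t).aemeasurable)
    fun _ t θ => ⟨_, (IsStableIntegral.finsetSum hα hM Finset.univ (fun l _ => hV (t l))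
      θ).hasStableLaw hα hM, (IsStableIntegral.finsetSum hα hM Finset.univ (fun l _ => hW (t l))
      θ).hasStableLaw hα hM⟩

end Convergence

/-! ### The limit fields in the different regimes -/

section Regimes

variable {α γ γ₁ γ₂ τ : ℝ}

/-- Finiteness of the norm matters here: `lpPow` takes the value `0` also when the integral is
infinite. -/
theorem lpPow_ne_zero_of_pos (hα : 0 < α) {K : ℝ × ℝ → ℝ} (hK : MemLp K (ENNReal.ofReal α) volume)
    (h : ∀ u ∈ Set.Ioo (0 : ℝ) 1 ×ˢ Set.Ioo (0 : ℝ) 1, 0 < K u) : lpPow α volume K ≠ 0 := by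
  intro h0
  rw [lpPow_eq hα, Real.rpow_eq_zero ENNReal.toReal_nonneg hα.ne',
    ENNReal.toReal_eq_zero_iff] at h0
  have h1 := h0.resolve_right hK.2.ne
  rw [eLpNorm_eq_zero_iff hK.1 (by simpa using hα)] at h1
  have h2 : volume (Set.Ioo (0 : ℝ) 1 ×ˢ Set.Ioo (0 : ℝ) 1) = 0 :=
    measure_mono_null (fun u hu => (h u hu).ne') h1
  rw [Measure.volume_eq_prod, Measure.prod_prod] at h2
  simp at h2

theorem H_pos (hγ : γ < 1) {u : ℝ} (hu : u ∈ Set.Ioo (0 : ℝ) 1) : 0 < H γ u 1 := by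
  have h1 : 0 < 1 - γ := by linarith
  have h2 : 0 < 1 - u := by linarith [hu.2]
  rw [H, max_eq_right h2.le, max_eq_left (by linarith [hu.1]), Real.zero_rpow h1.ne', sub_zero]
  positivity

theorem ind_pos {u : ℝ} (hu : u ∈ Set.Ioo (0 : ℝ) 1) : ind u 1 = 1 := if_pos ⟨hu.1.le, hu.2.le⟩

theorem diagKernel_pos (hγ : γ < 1) {u₁ u₂ : ℝ} (h₁ : u₁ ∈ Set.Ioo (0 : ℝ) 1)
    (h₂ : u₂ ∈ Set.Ioo (0 : ℝ) 1) : 0 < diagKernel γ 1 1 u₁ u₂ := by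
  have h1 : 0 < 1 - γ := by linarith
  have h2 : max 0 (max (-u₁) (-u₂)) = 0 :=
    max_eq_left (max_le (by linarith [h₁.1]) (by linarith [h₂.1]))
  have h3 : 0 < min (1 - u₁) (1 - u₂) := lt_min (by linarith [h₁.2]) (by linarith [h₂.2])
  rw [diagKernel, h2, if_pos h3, Real.zero_rpow h1.ne', sub_zero]
  positivity

theorem limitKernel_pos (hγ₁ : γ₁ < 1) (hγ₂ : γ₂ < 1) {u : ℝ × ℝ}
    (hu : u ∈ Set.Ioo (0 : ℝ) 1 ×ˢ Set.Ioo (0 : ℝ) 1) : 0 < limitKernel γ₁ γ₂ τ (1, 1) u := by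
  obtain ⟨hu1, hu2⟩ := hu
  have a1 := H_pos hγ₁ hu1
  have a2 := H_pos hγ₂ hu1
  have a3 := H_pos hγ₂ hu2
  have a4 := diagKernel_pos hγ₂ hu1 hu2
  have b1 := ind_pos hu1
  have b2 := ind_pos hu2
  unfold limitKernel
  simp only [NNReal.coe_one, b1, b2]
  split_ifs <;> first | exact a4 | nlinarith

theorem lpPow_comp_snd_mul {f : ℝ × ℝ → ℝ} (hf : Measurable f) {c : ℝ} (hc : 0 < c) :
    lpPow α volume f = c * lpPow α volume (fun u : ℝ × ℝ => f (u.1, c * u.2)) := by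
  have hg : Measurable (fun u : ℝ × ℝ => ‖f u‖ₑ ^ α) := hf.enorm.pow_const _
  have hm : Measurable (fun u : ℝ × ℝ => (u.1, c * u.2)) := by fun_prop
  have hg' : Measurable (fun u : ℝ × ℝ => ‖f (u.1, c * u.2)‖ₑ ^ α) := hg.comp hm
  have h1 : ∫⁻ u, ‖f u‖ₑ ^ α = ENNReal.ofReal c * ∫⁻ u : ℝ × ℝ, ‖f (u.1, c * u.2)‖ₑ ^ α := by
    rw [Measure.volume_eq_prod, lintegral_prod _ hg.aemeasurable,
      lintegral_prod _ hg'.aemeasurable, ← lintegral_const_mul' _ _ ENNReal.ofReal_ne_top]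
    refine lintegral_congr fun x => ?_
    conv_lhs => rw [← Real.smul_map_volume_mul_left hc.ne']
    have hx : Measurable (fun y : ℝ => ‖f (x, y)‖ₑ ^ α) := hg.comp measurable_prodMk_left
    rw [lintegral_smul_measure, lintegral_map hx (measurable_const_mul c), abs_of_pos hc,
      smul_eq_mul]
  rw [lpPow, lpPow, h1, ENNReal.toReal_mul, ENNReal.toReal_ofReal hc.le]

theorem lpPow_H_mul_ind (hγ : γ < 1) :
    lpPow α volume (fun u : ℝ × ℝ => H γ u.1 1 * ind u.2 2)
      = 2 * lpPow α volume (fun u : ℝ × ℝ => H γ u.1 1 * ind u.2 1) := by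
  have hm : Measurable (fun u : ℝ × ℝ => H γ u.1 1 * ind u.2 2) :=
    ((continuous_H hγ 1).measurable.comp measurable_fst).mul
      ((measurable_ind 2).comp measurable_snd)
  rw [lpPow_comp_snd_mul hm two_pos]
  congr 2
  ext u
  have : (0 ≤ 2 * u.2 ∧ 2 * u.2 ≤ 2) ↔ (0 ≤ u.2 ∧ u.2 ≤ 1) := by
    constructor <;> rintro ⟨a, b⟩ <;> constructor <;> linarith
  simp only [ind, this]

theorem H_mul_mul {c : ℝ} (hc : 0 ≤ c) (u t : ℝ) :
    H γ (c * u) (c * t) = c ^ (1 - γ) * H γ u t := by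
  have h : ∀ x : ℝ, max 0 (c * x) = c * max 0 x := fun x => by
    rw [mul_max_of_nonneg _ _ hc, mul_zero]
  rw [H, H, ← mul_sub, ← mul_neg, h, h, Real.mul_rpow hc (le_max_left _ _),
    Real.mul_rpow hc (le_max_left _ _), ← mul_sub, mul_div_assoc]

/-- The substitution `u₂ ↦ 2 u₂` gives the Jacobian `2`, and the homogeneity of `H` of degree `1 -
γ` gives the remaining factor `2 ^ (α * (1 - γ))`. In `lpPow_H_mul_ind` only the Jacobian appears.
-/
theorem lpPow_ind_mul_H (hα : 0 < α) (hγ : γ < 1) :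
    lpPow α volume (fun u : ℝ × ℝ => ind u.1 1 * H γ u.2 2)
      = 2 ^ (1 + α * (1 - γ)) * lpPow α volume (fun u : ℝ × ℝ => ind u.1 1 * H γ u.2 1) := by
  have hm : Measurable (fun u : ℝ × ℝ => ind u.1 1 * H γ u.2 2) :=
    ((measurable_ind 1).comp measurable_fst).mul
      ((continuous_H hγ 2).measurable.comp measurable_snd)
  rw [lpPow_comp_snd_mul hm two_pos]
  have e : (fun u : ℝ × ℝ => ind u.1 1 * H γ (2 * u.2) 2)
      = fun u => 2 ^ (1 - γ) * (ind u.1 1 * H γ u.2 1) := by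
    ext u
    have := H_mul_mul (γ := γ) two_pos.le u.2 1
    rw [mul_one] at this
    rw [this]
    ring
  dsimp only
  rw [e, lpPow_const_mul hα, abs_of_nonneg (by positivity), ← Real.rpow_mul two_pos.le, ← mul_assoc,
    Real.rpow_add two_pos, Real.rpow_one, mul_comm α]

end Regimes

/-! ### Points of scaling transition -/

section Transition

variable {Ω' : Type*} [MeasurableSpace Ω'] {P' : Measure Ω'} [IsProbabilityMeasure P']
  {α γ γ' : ℝ} {M : Set (ℝ × ℝ) → Ω' → ℝ} {V W : ℝ≥0 × ℝ≥0 → Ω' → ℝ}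

theorem lpPow_eq_of_sameFDD (hα : 1 ≤ α) (hM : IsStableRandomMeasure P' α M)
    {K L : ℝ≥0 × ℝ≥0 → ℝ × ℝ → ℝ} (hV : ∀ t, IsStableIntegral P' α M (K t) (V t))
    (hW : ∀ t, IsStableIntegral P' α M (L t) (W t)) {a : ℝ}
    (h : SameFDD P' W (fun t ω => a * V t ω)) (t : ℝ≥0 × ℝ≥0) :
    lpPow α volume (L t) = |a| ^ α * lpPow α volume (K t) :=
  ((hW t).hasStableLaw hα hM).eq_of_map_eq (((hV t).hasStableLaw hα hM).const_mul a) (h.map_eq t)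

theorem two_lt_two_rpow (hα : 0 < α) (hγ : γ < 1) : (2 : ℝ) < 2 ^ (1 + α * (1 - γ)) := by
  have h : 0 < α * (1 - γ) := mul_pos hα (by linarith)
  calc (2 : ℝ) = 2 ^ (1 : ℝ) := (Real.rpow_one 2).symm
    _ < 2 ^ (1 + α * (1 - γ)) := Real.rpow_lt_rpow_of_exponent_lt one_lt_two (by linarith)

theorem lpPow_one_two_H_mul_ind (hγ : γ < 1) :
    lpPow α volume (fun u : ℝ × ℝ => H γ u.1 ((1 : ℝ≥0) : ℝ) * ind u.2 ((2 : ℝ≥0) : ℝ))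
      = 2 * lpPow α volume (fun u : ℝ × ℝ => H γ u.1 ((1 : ℝ≥0) : ℝ) * ind u.2 ((1 : ℝ≥0) : ℝ)) := by
  simpa using lpPow_H_mul_ind (α := α) hγ

theorem lpPow_one_two_ind_mul_H (hα : 0 < α) (hγ : γ < 1) :
    lpPow α volume (fun u : ℝ × ℝ => ind u.1 ((1 : ℝ≥0) : ℝ) * H γ u.2 ((2 : ℝ≥0) : ℝ))
      = 2 ^ (1 + α * (1 - γ)) *
        lpPow α volume (fun u : ℝ × ℝ => ind u.1 ((1 : ℝ≥0) : ℝ) * H γ u.2 ((1 : ℝ≥0) : ℝ)) := by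
  simpa using lpPow_ind_mul_H hα hγ

/-- The ratio of the scales at `(1, 2)` and `(1, 1)` is insensitive to the factor `a`. It is `2` for
the field `V` and strictly larger for `W`, whose scale at `(1, 1)` is nonzero. -/
theorem not_sameFDD_of_horizontal (hα : 1 ≤ α) (hM : IsStableRandomMeasure P' α M) (hγ : γ < 1)
    (hγ' : γ' < 1)
    (hV : ∀ t, IsStableIntegral P' α M (fun u => H γ u.1 t.1 * ind u.2 t.2) (V t))
    (hW : ∀ t, IsStableIntegral P' α M (fun u => ind u.1 t.1 * H γ' u.2 t.2) (W t)) (a : ℝ) :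
    ¬ SameFDD P' W (fun t ω => a * V t ω) := by
  intro h
  have hα0 : 0 < α := by linarith
  have h1 := lpPow_eq_of_sameFDD hα hM hV hW h (1, 1)
  have h2 := lpPow_eq_of_sameFDD hα hM hV hW h (1, 2)
  have hne := lpPow_ne_zero_of_pos hα0 (hW (1, 1)).memLp fun u hu => by
    simp [ind_pos hu.1, H_pos hγ' hu.2]
  dsimp only at h1 h2 hne
  rw [lpPow_one_two_ind_mul_H hα0 hγ', lpPow_one_two_H_mul_ind hγ, mul_left_comm, ← h1] at h2
  exact (two_lt_two_rpow hα0 hγ').ne' (mul_right_cancel₀ hne h2)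

theorem not_sameFDD_of_vertical (hα : 1 ≤ α) (hM : IsStableRandomMeasure P' α M) (hγ : γ < 1)
    (hγ' : γ' < 1)
    (hV : ∀ t, IsStableIntegral P' α M (fun u => ind u.1 t.1 * H γ u.2 t.2) (V t))
    (hW : ∀ t, IsStableIntegral P' α M (fun u => H γ' u.1 t.1 * ind u.2 t.2) (W t)) (a : ℝ) :
    ¬ SameFDD P' W (fun t ω => a * V t ω) := by
  intro h
  have hα0 : 0 < α := by linarith
  have h1 := lpPow_eq_of_sameFDD hα hM hV hW h (1, 1)
  have h2 := lpPow_eq_of_sameFDD hα hM hV hW h (1, 2)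
  have hne := lpPow_ne_zero_of_pos hα0 (hW (1, 1)).memLp fun u hu => by
    simp [ind_pos hu.2, H_pos hγ' hu.1]
  dsimp only at h1 h2 hne
  rw [lpPow_one_two_ind_mul_H hα0 hγ, lpPow_one_two_H_mul_ind hγ', mul_left_comm, ← h1] at h2
  exact (two_lt_two_rpow hα0 hγ).ne (mul_right_cancel₀ hne h2)

variable {γ₁ γ₂ : ℝ} {V : ℝ → ℝ≥0 × ℝ≥0 → Ω' → ℝ}

theorem limitKernel_eq_of_regime {τ τ' : ℝ}
    (h : (τ < tauZero γ₁ γ₂ ∧ τ' < tauZero γ₁ γ₂) ∨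
      (tauZero γ₁ γ₂ < τ ∧ τ < 1 ∧ tauZero γ₁ γ₂ < τ' ∧ τ' < 1) ∨
      (tauZero γ₁ γ₂ < τ ∧ 1 < τ ∧ tauZero γ₁ γ₂ < τ' ∧ 1 < τ')) :
    limitKernel γ₁ γ₂ τ = limitKernel γ₁ γ₂ τ' := by
  ext t u
  rcases h with ⟨h, h'⟩ | ⟨h, h1, h', h1'⟩ | ⟨h, h1, h', h1'⟩
  · rw [limitKernel_of_lt h, limitKernel_of_lt h']
  · rw [limitKernel_of_gt h, limitKernel_of_gt h', diagLimit, diagLimit, if_pos h1, if_pos h1']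
  · rw [limitKernel_of_gt h, limitKernel_of_gt h', diagLimit, diagLimit, if_neg h1.not_gt,
      if_neg h1'.not_gt, if_neg h1.ne', if_neg h1'.ne']

theorem sameFDD_of_regime (hα : 1 ≤ α) (hM : IsStableRandomMeasure P' α M)
    (hV : ∀ τ, 0 < τ → ∀ t, IsStableIntegral P' α M (limitKernel γ₁ γ₂ τ t) (V τ t))
    {τ τ' : ℝ} (hτ : 0 < τ) (hτ' : 0 < τ')
    (h : (τ < tauZero γ₁ γ₂ ∧ τ' < tauZero γ₁ γ₂) ∨
      (tauZero γ₁ γ₂ < τ ∧ τ < 1 ∧ tauZero γ₁ γ₂ < τ' ∧ τ' < 1) ∨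
      (tauZero γ₁ γ₂ < τ ∧ 1 < τ ∧ tauZero γ₁ γ₂ < τ' ∧ 1 < τ')) :
    SameFDD P' (V τ) (V τ') :=
  sameFDD_of_kernel_eq hα hM (hV τ hτ) fun t => by
    rw [limitKernel_eq_of_regime h]
    exact hV τ' hτ' t

/-- Any other point is interior to one of the three regimes, so `τstar - ε` and `τstar + ε` give the
same law for small `ε`, contradicting the definition with the multiple `1`. -/
theorem eq_of_isScalingTransitionPoint {Ω : Type*} [MeasurableSpace Ω] {P : Measure Ω}
    [IsProbabilityMeasure P] (hα : 1 ≤ α) (hM : IsStableRandomMeasure P' α M)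
    (h01 : tauZero γ₁ γ₂ < 1)
    (hV : ∀ τ, 0 < τ → ∀ t, IsStableIntegral P' α M (limitKernel γ₁ γ₂ τ t) (V τ t))
    {Z : ℝ → ℕ → ℝ≥0 × ℝ≥0 → Ω → ℝ} {A : ℝ → ℕ → ℝ} {τstar : ℝ}
    (h : IsScalingTransitionPoint P Z A P' V τstar) :
    τstar = tauZero γ₁ γ₂ ∨ τstar = 1 := by
  by_contra hne
  push Not at hne
  obtain ⟨δ, hδ, hδτ, -, -, hns⟩ := h.transition
  have key : ∀ ε, 0 < ε → ε < δ →
      ((τstar + ε < tauZero γ₁ γ₂ ∧ τstar - ε < tauZero γ₁ γ₂) ∨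
      (tauZero γ₁ γ₂ < τstar + ε ∧ τstar + ε < 1 ∧ tauZero γ₁ γ₂ < τstar - ε ∧ τstar - ε < 1) ∨
      (tauZero γ₁ γ₂ < τstar + ε ∧ 1 < τstar + ε ∧ tauZero γ₁ γ₂ < τstar - ε ∧ 1 < τstar - ε)) →
      False := by
    intro ε hε hεδ hreg
    refine hns (τstar - ε) ⟨by linarith, by linarith⟩ (τstar + ε) ⟨by linarith, by linarith⟩ 1 ?_
    simp only [one_mul]
    exact sameFDD_of_regime hα hM hV (by linarith) (by linarith) hreg
  rcases lt_or_gt_of_ne hne.1 with h1 | h1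
  · have e1 := min_le_left (δ / 2) ((tauZero γ₁ γ₂ - τstar) / 2)
    have e2 := min_le_right (δ / 2) ((tauZero γ₁ γ₂ - τstar) / 2)
    have e3 : 0 < min (δ / 2) ((tauZero γ₁ γ₂ - τstar) / 2) :=
      lt_min (by linarith) (by linarith)
    exact key _ e3 (by linarith) (Or.inl ⟨by linarith, by linarith⟩)
  rcases lt_or_gt_of_ne hne.2 with h2 | h2
  · have e1 := min_le_left (δ / 2) (min ((τstar - tauZero γ₁ γ₂) / 2) ((1 - τstar) / 2))
    have e2 := (min_le_right (δ / 2) (min ((τstar - tauZero γ₁ γ₂) / 2) ((1 - τstar) / 2))).trans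
      (min_le_left _ _)
    have e2' := (min_le_right (δ / 2) (min ((τstar - tauZero γ₁ γ₂) / 2) ((1 - τstar) / 2))).trans
      (min_le_right _ _)
    have e3 : 0 < min (δ / 2) (min ((τstar - tauZero γ₁ γ₂) / 2) ((1 - τstar) / 2)) :=
      lt_min (by linarith) (lt_min (by linarith) (by linarith))
    exact key _ e3 (by linarith) (Or.inr (Or.inl ⟨by linarith, by linarith, by linarith,
      by linarith⟩))
  · have e1 := min_le_left (δ / 2) ((τstar - 1) / 2)
    have e2 := min_le_right (δ / 2) ((τstar - 1) / 2)
    have e3 : 0 < min (δ / 2) ((τstar - 1) / 2) := lt_min (by linarith) (by linarith)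
    exact key _ e3 (by linarith) (Or.inr (Or.inr ⟨by linarith, by linarith, by linarith,
      by linarith⟩))

theorem transition_of_eq (hα : 1 ≤ α) (hM : IsStableRandomMeasure P' α M)
    (hγ₁ : γ₁ < 1) (hγ₂ : γ₂ < 1) (h01 : tauZero γ₁ γ₂ < 1)
    (hV : ∀ τ, 0 < τ → ∀ t, IsStableIntegral P' α M (limitKernel γ₁ γ₂ τ t) (V τ t))
    {τstar : ℝ} (h : τstar = tauZero γ₁ γ₂ ∨ τstar = 1) :
    ∃ δ, 0 < δ ∧ δ ≤ τstar ∧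
    (∀ τ ∈ Set.Ioo (τstar - δ) τstar, ∀ τ' ∈ Set.Ioo (τstar - δ) τstar,
      SameFDD P' (V τ) (V τ')) ∧
    (∀ τ ∈ Set.Ioo τstar (τstar + δ), ∀ τ' ∈ Set.Ioo τstar (τstar + δ),
      SameFDD P' (V τ) (V τ')) ∧
    (∀ τ ∈ Set.Ioo (τstar - δ) τstar, ∀ τ' ∈ Set.Ioo τstar (τstar + δ), ∀ a : ℝ,
      ¬ SameFDD P' (V τ') (fun t ω => a * V τ t ω)) := by
  have h0 : 0 < tauZero γ₁ γ₂ := tauZero_pos hγ₁ hγ₂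
  have mid : ∀ {τ}, tauZero γ₁ γ₂ < τ → τ < 1 →
      ∀ t, IsStableIntegral P' α M (fun u => ind u.1 t.1 * H γ₂ u.2 t.2) (V τ t) := by
    intro τ h1 h2 t
    have := hV τ (by linarith) t
    rwa [show limitKernel γ₁ γ₂ τ t = fun u => ind u.1 t.1 * H γ₂ u.2 t.2 from
      funext fun u => by rw [limitKernel_of_gt h1, diagLimit, if_pos h2]] at this
  rcases h with rfl | rfl
  · have e1 := min_le_left (tauZero γ₁ γ₂) (1 - tauZero γ₁ γ₂)
    have e2 := min_le_right (tauZero γ₁ γ₂) (1 - tauZero γ₁ γ₂)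
    -- This radius keeps the left neighbourhood positive and the right one below `1`.
    refine ⟨min (tauZero γ₁ γ₂) (1 - tauZero γ₁ γ₂), lt_min h0 (by linarith), e1, ?_, ?_, ?_⟩
    · rintro τ ⟨a, b⟩ τ' ⟨a', b'⟩
      exact sameFDD_of_regime hα hM hV (by linarith) (by linarith) (Or.inl ⟨b, b'⟩)
    · rintro τ ⟨a, b⟩ τ' ⟨a', b'⟩
      exact sameFDD_of_regime hα hM hV (by linarith) (by linarith)
        (Or.inr (Or.inl ⟨a, by linarith, a', by linarith⟩))
    · rintro τ ⟨a, b⟩ τ' ⟨a', b'⟩ c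
      refine not_sameFDD_of_horizontal hα hM hγ₁ hγ₂ (fun t => ?_) (mid a' (by linarith)) c
      have := hV τ (by linarith) t
      rwa [show limitKernel γ₁ γ₂ τ t = fun u => H γ₁ u.1 t.1 * ind u.2 t.2 from
        funext fun u => limitKernel_of_lt b] at this
  -- This radius keeps the left neighbourhood of `1` above `τ₀`.
  · refine ⟨1 - tauZero γ₁ γ₂, by linarith, by linarith, ?_, ?_, ?_⟩
    · rintro τ ⟨a, b⟩ τ' ⟨a', b'⟩
      exact sameFDD_of_regime hα hM hV (by linarith) (by linarith)
        (Or.inr (Or.inl ⟨by linarith, b, by linarith, b'⟩))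
    · rintro τ ⟨a, b⟩ τ' ⟨a', b'⟩
      exact sameFDD_of_regime hα hM hV (by linarith) (by linarith)
        (Or.inr (Or.inr ⟨by linarith, a, by linarith, a'⟩))
    · rintro τ ⟨a, b⟩ τ' ⟨a', b'⟩ c
      refine not_sameFDD_of_vertical hα hM hγ₂ hγ₂ (mid (by linarith) b) (fun t => ?_) c
      have := hV τ' (by linarith) t
      rwa [show limitKernel γ₁ γ₂ τ' t = fun u => H γ₂ u.1 t.1 * ind u.2 t.2 from
        funext fun u => by
          rw [limitKernel_of_gt (by linarith), diagLimit, if_neg a'.not_gt, if_neg a'.ne']] at this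

end Transition

end DiagonalField

open DiagonalField in
theorem mainTheorem4 {Ω Ω' : Type*} [MeasurableSpace Ω] [MeasurableSpace Ω']
    (P : Measure Ω) [IsProbabilityMeasure P] (P' : Measure Ω') [IsProbabilityMeasure P']
    (α γ₁ γ₂ : ℝ) (hα : 0 < α) (hα2 : α ≤ 2)
    (hγ₂ : 1 / α < γ₂) (hγ : γ₂ ≤ γ₁) (hγ₁ : γ₁ < 1)
    (ξ : ℤ × ℤ → Ω → ℝ) (hξ : IsStableNoise P α ξ)
    (M : Set (ℝ × ℝ) → Ω' → ℝ) (hM : IsStableRandomMeasure P' α M) :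
    -- the linear field and the stable integrals are well defined
    (∃ X, IsLinearField P (diagFilter γ₁ γ₂) ξ X) ∧
    (∀ τ, 0 < τ → ∀ t, ∃ I, IsStableIntegral P' α M (limitKernel γ₁ γ₂ τ t) I) ∧
    ∀ X, IsLinearField P (diagFilter γ₁ γ₂) ξ X →
    ∀ V : ℝ → ℝ≥0 × ℝ≥0 → Ω' → ℝ,
    (∀ τ, 0 < τ → ∀ t, IsStableIntegral P' α M (limitKernel γ₁ γ₂ τ t) (V τ t)) →
      -- convergence of finite-dimensional distributions
      (∀ τ, 0 < τ → (τ < tauZero γ₁ γ₂ ∨ γ₂ < γ₁) →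
        ConvergesFDD P
          (fun n t ω => (normalization α γ₁ γ₂ τ n)⁻¹ *
            partialSum X (n : ℝ) ((n : ℝ) ^ τ) t ω)
          P' (V τ)) ∧
      -- exactly two points of scaling transition
      (γ₂ < γ₁ → tauZero γ₁ γ₂ < 1 ∧ ∀ τstar, 0 < τstar →
        (IsScalingTransitionPoint P (fun τ n => partialSum X (n : ℝ) ((n : ℝ) ^ τ))
          (normalization α γ₁ γ₂) P' V τstar ↔ (τstar = tauZero γ₁ γ₂ ∨ τstar = 1))) := by
  -- The parameter range forces `α > 1`, so the triangle inequality holds in `L^α`.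
  have hα1 : 1 < α := by
    have h1 : 1 / α < 1 := hγ₂.trans_le (hγ.trans hγ₁.le)
    rwa [div_lt_one hα] at h1
  have hγ₂0 : 0 < γ₂ := (by positivity : (0 : ℝ) < 1 / α).trans hγ₂
  have hγ₁0 : 0 < γ₁ := hγ₂0.trans_le hγ
  have hγ₂1 : γ₂ < 1 := hγ.trans_lt hγ₁
  have hαγ₂ : 1 < α * γ₂ := by rwa [div_lt_iff₀' hα] at hγ₂
  have hαγ₁ : 1 < α * γ₁ := hαγ₂.trans_le (by gcongr)
  refine ⟨exists_isLinearField hα hξ (summable_diagFilter hα hαγ₁ hαγ₂), fun τ hτ t =>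
    IsStableIntegral.exists_of_memLp hα1.le hM
      (memLp_limitKernel hα1.le hγ₁0 hγ₁ hγ₂0 hγ₂1 hαγ₁ hαγ₂ hτ t), fun X hX V hV => ?_⟩
  have hconv : ∀ τ, 0 < τ → (τ < tauZero γ₁ γ₂ ∨ γ₂ < γ₁) →
      ConvergesFDD P (fun n t ω => (normalization α γ₁ γ₂ τ n)⁻¹ *
        partialSum X (n : ℝ) ((n : ℝ) ^ τ) t ω) P' (V τ) := fun τ hτ hτγ =>
    convergesFDD_partialSum hα1.le hγ₁0 hγ₁ hγ₂0 hγ₂1 hαγ₁ hαγ₂ hγ hτ hτγ hξ hM hX (hV τ hτ)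
  refine ⟨hconv, fun hlt => ?_⟩
  have h01 := tauZero_lt_one hγ₂1 hlt
  refine ⟨h01, fun τstar _ => ⟨eq_of_isScalingTransitionPoint hα1.le hM h01 hV, fun h => ?_⟩⟩
  refine ⟨fun τ hτ => tendsto_normalization hα hγ₁ hγ₂1 hτ,
    fun τ hτ => hconv τ hτ (Or.inr hlt), fun τ hτ => ⟨(1, 1), ?_⟩,
    transition_of_eq hα1.le hM hγ₁ hγ₂1 h01 hV h⟩
  -- In every regime the kernel at `t = (1, 1)` is positive on the open unit square, so its scale is
  -- nonzero.
  exact ((hV τ hτ (1, 1)).hasStableLaw hα1.le hM).not_ae_eq_zero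
    (lpPow_ne_zero_of_pos hα (hV τ hτ (1, 1)).memLp fun u hu => limitKernel_pos hγ₁ hγ₂1 hu)
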